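/- Consider the fine Kolmogorov backward equation $u_t+xu_y=x^2u_{xx}$ for $u=u(t,x,y)$. A point symmetry is a smooth diffeomorphism $\Phi$ between two open subsets of $\mathbb R^4_{t,x,y,u}$ such that, whenever $\Phi$ maps the graph of a smooth function $g$ on an open set $\Omega\subseteq\mathbb R^3_{t,x,y}$ onto the graph of a smooth function $g'$ on an open set $\Omega'$, the function $g$ is a solution on $\Omega$ if and only if $g'$ is a solution on $\Omega'$. Fix $k\in\{0,1,2,\dots,\infty\}$. A point symmetry $C$ with domain $V$ is called continuous if it can be joined to $\mathrm{id}_V$ by a family $(H_s)_{s\in[0,1]}$ of point symmetries with domain $V$ that is jointly of class $C^k$ in $(s,p)\in[0,1]\times V$. Let $\mathscr I'\colon(t,x,y,u)\mapsto(t,x,y,-u)$ and $\mathscr J'\colon(t,x,y,u)\mapsto(t,-x,-y,u)$. Then the following hold for every $k$. 1. $\mathscr I'$ and $\mathscr J'$ are involutive point symmetries. 2. For every point symmetry $\Phi$ with nonempty connected domain $U$ there is exactly one $D\in\{\mathrm{id},\mathscr I',\mathscr J',\mathscr I'\circ\mathscr J'\}$ such that (a) every point of $U$ has an open neighbourhood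 $V\subseteq U$ with $\Phi|_V=D\circ C$ for some continuous point symmetry $C$ with domain $V$, and (b) if every line parallel to the $u$-axis meets $U$ in an interval (possibly empty), then $\Phi=D\circ C$ on all of $U$ for some continuous point symmetry $C$ with domain $U$. 3. Let the group of discrete symmetries be the group generated by symbols $[\Phi]$, one for each point symmetry $\Phi$ with nonempty connected domain, subject to the relations $[\Phi][\Psi]=[\Theta]$ whenever $\Theta$ is a restriction of $\Phi\circ\Psi$, and $[C]=1$ for every continuous $C$. It is isomorphic to the Klein four-group $\mathbb Z_2\times\mathbb Z_2$, by an isomorphism that maps $[\mathscr I']$ to $(1,0)$ and $[\mathscr J']$ to $(0,1)$. -/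

import Mathlib

namespace FineKolmogorov

open scoped ContDiff

/-- The space of the independent variables `(t, x, y)`. -/
abbrev Base : Type := ℝ × ℝ × ℝ

/-- The space of the independent and dependent variables `(t, x, y, u)`. -/
abbrev Total : Type := ℝ × ℝ × ℝ × ℝ

/-- `g` is a (smooth, local) solution of `u_t + x u_y = x² u_xx` on the set `Ω`. -/
def IsSolutionOn (g : Base → ℝ) (Ω : Set Base) : Prop :=
  ContDiffOn ℝ ∞ g Ω ∧
    ∀ t x y : ℝ, (t, x, y) ∈ Ω →
      deriv (fun τ => g (τ, x, y)) t + x * deriv (fun η => g (t, x, η)) y =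
        x ^ 2 * deriv (deriv fun ξ => g (t, ξ, y)) x

/-- The graph `{(t, x, y, u) | (t, x, y) ∈ Ω, u = g (t, x, y)}`. -/
def graphOver (g : Base → ℝ) (Ω : Set Base) : Set Total :=
  {p | (p.1, p.2.1, p.2.2.1) ∈ Ω ∧ p.2.2.2 = g (p.1, p.2.1, p.2.2.1)}

/-- A point transformation: a diffeomorphism between two open subsets of the space of
`(t, x, y, u)`. -/
def IsPointTransformation (Φ : OpenPartialHomeomorph Total Total) : Prop :=
  ContDiffOn ℝ ∞ Φ Φ.source ∧ ContDiffOn ℝ ∞ Φ.symm Φ.target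

/-- A point symmetry of the equation: a point transformation that, together with its inverse,
maps (graphs of) solutions to (graphs of) solutions. The set of all `Φ` with this property is
the point symmetry pseudogroup. -/
def IsPointSymmetry (Φ : OpenPartialHomeomorph Total Total) : Prop :=
  IsPointTransformation Φ ∧
    ∀ (Ω Ω' : Set Base) (g g' : Base → ℝ), IsOpen Ω → IsOpen Ω' →
      ContDiffOn ℝ ∞ g Ω → ContDiffOn ℝ ∞ g' Ω' →
      graphOver g Ω ⊆ Φ.source → Φ '' graphOver g Ω = graphOver g' Ω' →
      (IsSolutionOn g Ω ↔ IsSolutionOn g' Ω')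

/-- A continuous point symmetry: a point symmetry that can be joined to the identity
transformation of its domain by a family of point symmetries with the same domain, which is
jointly of class `C^k` in the parameter `s ∈ [0, 1]` and the point. -/
def IsContinuousSymmetry (k : ℕ∞) (C : OpenPartialHomeomorph Total Total) : Prop :=
  ∃ H : ℝ → OpenPartialHomeomorph Total Total,
    (∀ s ∈ Set.Icc (0 : ℝ) 1, IsPointSymmetry (H s) ∧ (H s).source = C.source) ∧
    ContDiffOn ℝ k (fun q : ℝ × Total => H q.1 q.2) (Set.Icc (0 : ℝ) 1 ×ˢ C.source) ∧
    Set.EqOn (H 0) id C.source ∧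
    Set.EqOn (H 1) C C.source

/-- On the set `V`, the transformation `Φ` is the composition of `D` with a continuous point
symmetry with domain `V`. -/
def FactorsOn (k : ℕ∞) (Φ : OpenPartialHomeomorph Total Total) (D : Total ≃ₜ Total)
    (V : Set Total) : Prop :=
  ∃ C : OpenPartialHomeomorph Total Total,
    IsContinuousSymmetry k C ∧ C.source = V ∧ Set.EqOn Φ (fun p => D (C p)) V

/-- Every line parallel to the `u`-axis meets `V` in an interval (possibly empty). -/
def VerticallyConnected (V : Set Total) : Prop :=
  ∀ t x y : ℝ, {u : ℝ | (t, x, y, u) ∈ V}.OrdConnected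

/-- The involution `(t, x, y, u) ↦ (t, x, y, -u)`. -/
def involI : Total ≃ₜ Total where
  toFun p := (p.1, p.2.1, p.2.2.1, -p.2.2.2)
  invFun p := (p.1, p.2.1, p.2.2.1, -p.2.2.2)
  left_inv p := by simp
  right_inv p := by simp
  continuous_toFun := by fun_prop
  continuous_invFun := by fun_prop

/-- The involution `(t, x, y, u) ↦ (t, -x, -y, u)`. -/
def involJ : Total ≃ₜ Total where
  toFun p := (p.1, -p.2.1, -p.2.2.1, p.2.2.2)
  invFun p := (p.1, -p.2.1, -p.2.2.1, p.2.2.2)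
  left_inv p := by simp
  right_inv p := by simp
  continuous_toFun := by fun_prop
  continuous_invFun := by fun_prop

/-- The point symmetries whose domain is nonempty and connected. -/
def ConnSymmetry : Type :=
  {Φ : OpenPartialHomeomorph Total Total // IsPointSymmetry Φ ∧ IsConnected Φ.source}

/-- The relations of the group of discrete symmetries: `[Φ] [Ψ] = [Θ]` whenever `Θ` is a
restriction of `Φ ∘ Ψ`, and `[C] = 1` for every continuous symmetry `C`. -/
inductive DiscreteRel (k : ℕ∞) : FreeGroup ConnSymmetry → Prop
  | comp (Φ Ψ Θ : ConnSymmetry) (hs : Θ.1.source ⊆ (Ψ.1.trans Φ.1).source)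
      (he : Set.EqOn Θ.1 (fun p => Φ.1 (Ψ.1 p)) Θ.1.source) :
      DiscreteRel k (FreeGroup.of Φ * FreeGroup.of Ψ * (FreeGroup.of Θ)⁻¹)
  | cont (C : ConnSymmetry) (hC : IsContinuousSymmetry k C.1) :
      DiscreteRel k (FreeGroup.of C)

/-- The group of discrete symmetries: the quotient of the point symmetry pseudogroup by the
continuous point symmetries. As composition in a pseudogroup is only partially defined, the
quotient is formed as the universal group to which point symmetries (with connected domains)
map multiplicatively with continuous ones going to `1`. -/
abbrev DiscreteSymmetryGroup (k : ℕ∞) : Type :=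
  PresentedGroup {r : FreeGroup ConnSymmetry | DiscreteRel k r}

/-- The discrete symmetry represented by a point symmetry with connected domain. -/
def discreteClass (k : ℕ∞) (Φ : ConnSymmetry) : DiscreteSymmetryGroup k :=
  PresentedGroup.of Φ

end FineKolmogorov

/-! Everything rests on the explicit form of a point symmetry `(T, X, Y, U)` with connected domain:
`T = t + τ`, `X = εx/(cy+d)²`, `Y = (ay+b)/(cy+d)`, `U = K exp(cx/(cy+d)) (u + h)`, where `ad - bc =
ε = ±1`, `cy + d > 0`, and `h` has zero `u`-derivative and satisfies the equation.

The form is extracted directly from the definition. For a global solution `g`, the preimage of its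
graph is the zero set of `F = g(T, X, Y) - U`. Where `F_u ≠ 0` this set is locally the graph of a
function, which must be a solution, so `F` obeys a second-order relation (`zero_set_relation`).
Where `X ≠ 0`, enough of the 2-jet of `g` can be prescribed freely (`exists_solution_jet`) to make
the relation an identity in independent parameters (`IsPointSymmetry.jet_relation`). Comparing
coefficients shows that `T` and `Y` do not depend on `x, u`, that `X` does not depend on `u`, and
that `U` is affine in `u`. Eliminating `X` leaves a polynomial identity of degree at most five in
`x` (`quintic_coeffs`), which forces `T_t = 1`, `T_y = Y_t = 0` and `X = x Y_y`. The locus `x = 0`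
or `X = 0` has dense complement, so all this holds on the whole domain. Compatibility of the
equations for `U_u` kills the Schwarzian derivative of `Y` (`IsPointSymmetry.theta_kap`); hence `Y`
is fractional linear and the rest integrates.

The discrete information is the pair of signs of `U_u` and `Y_y`. Neither derivative vanishes, so
the signs are constant on a connected domain, and they are multiplicative under composition. Both
are positive for continuous symmetries, even if the family is merely continuous in the parameter
(`pd_pos_of_family`). Conversely, once the signs are corrected by an involution, the parameters of
the normal form can be moved to those of the identity (`IsPointSymmetry.factorsOn`). The signs
therefore define a homomorphism from the group of discrete symmetries to the Klein four-group. It is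
invertible because restriction to a ball does not change a class, so each class is that of one of
the four involutions (`discreteClass_eq`). -/

namespace FineKolmogorov

open scoped ContDiff Topology
open Set

/-! ### Directional derivatives -/

section Calculus

variable {E : Type*} [NormedAddCommGroup E] [NormedSpace ℝ E]

/-- The derivative of `f` in the direction `v`. -/
noncomputable def pd (v : E) (f : E → ℝ) (p : E) : ℝ := fderiv ℝ f p v

variable {U : Set E} {f g : E → ℝ} {p : E}

theorem differentiableAt_of_smooth (hU : IsOpen U) (hf : ContDiffOn ℝ ∞ f U) (hp : p ∈ U) :
    DifferentiableAt ℝ f p :=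
  (hf.contDiffAt (hU.mem_nhds hp)).differentiableAt (by simp)

theorem smooth_pd (hU : IsOpen U) (hf : ContDiffOn ℝ ∞ f U) (v : E) :
    ContDiffOn ℝ ∞ (pd v f) U :=
  (hf.fderiv_of_isOpen hU (m := ∞) (by simp)).clm_apply contDiffOn_const

theorem pd_congr (hU : IsOpen U) (h : EqOn f g U) (hp : p ∈ U) (v : E) :
    pd v f p = pd v g p := by
  have : f =ᶠ[nhds p] g := Filter.eventuallyEq_of_mem (hU.mem_nhds hp) h
  simp only [pd, this.fderiv_eq]

theorem pd_const (v : E) (c : ℝ) (p : E) : pd v (fun _ => c) p = 0 := by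
  simp [pd]

theorem pd_eq_zero_of_eqOn (hU : IsOpen U) {c : ℝ} (h : ∀ q ∈ U, f q = c) (hp : p ∈ U) (v : E) :
    pd v f p = 0 := by
  rw [pd_congr hU (g := fun _ => c) h hp, pd_const]

theorem pd_comm (hU : IsOpen U) (hf : ContDiffOn ℝ ∞ f U) (hp : p ∈ U) (v w : E) :
    pd v (pd w f) p = pd w (pd v f) p := by
  have hc : ContDiffAt ℝ ∞ f p := hf.contDiffAt (hU.mem_nhds hp)
  have hs : IsSymmSndFDerivAt ℝ f p := hc.isSymmSndFDerivAt (by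
    simp only [minSmoothness_of_isRCLikeNormedField]
    exact WithTop.coe_le_coe.2 (le_top (a := (2 : ℕ∞))))
  have hd : DifferentiableAt ℝ (fderiv ℝ f) p :=
    (hc.fderiv_right (m := 1) (by norm_cast)).differentiableAt (by simp)
  have key : ∀ a b : E, pd a (pd b f) p = fderiv ℝ (fderiv ℝ f) p a b := by
    intro a b
    unfold pd
    rw [fderiv_clm_apply hd (differentiableAt_const b)]
    simp
  rw [key, key]
  exact hs v w

theorem pd_add (hf : DifferentiableAt ℝ f p) (hg : DifferentiableAt ℝ g p) (v : E) :
    pd v (fun q => f q + g q) p = pd v f p + pd v g p := by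
  simp only [pd]
  rw [fderiv_fun_add hf hg]; rfl

theorem pd_sub (hf : DifferentiableAt ℝ f p) (hg : DifferentiableAt ℝ g p) (v : E) :
    pd v (fun q => f q - g q) p = pd v f p - pd v g p := by
  simp only [pd]
  rw [fderiv_fun_sub hf hg]; rfl

theorem pd_mul (hf : DifferentiableAt ℝ f p) (hg : DifferentiableAt ℝ g p) (v : E) :
    pd v (fun q => f q * g q) p = pd v f p * g p + f p * pd v g p := by
  simp only [pd]
  rw [fderiv_fun_mul hf hg]
  simp; ring

theorem pd_const_mul (hf : DifferentiableAt ℝ f p) (c : ℝ) (v : E) :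
    pd v (fun q => c * f q) p = c * pd v f p := by
  rw [pd_mul (differentiableAt_const c) hf, pd_const]; ring

theorem pd_comp_real {φ : ℝ → ℝ} {φ' : ℝ} (hφ : HasDerivAt φ φ' (f p))
    (hf : DifferentiableAt ℝ f p) (v : E) :
    pd v (fun q => φ (f q)) p = φ' * pd v f p := by
  have := (hφ.comp_hasFDerivAt p hf.hasFDerivAt).fderiv
  simp only [pd]
  rw [show (fun q => φ (f q)) = φ ∘ f from rfl, this]
  simp

theorem pd_clm (L : E →L[ℝ] ℝ) (v p : E) : pd v (fun q => L q) p = L v := by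
  simp [pd]

theorem deriv_line (hf : DifferentiableAt ℝ f p) {γ : ℝ → E} {v : E} {s : ℝ}
    (hγ : HasDerivAt γ v s) (hs : γ s = p) : HasDerivAt (fun r => f (γ r)) (pd v f p) s := by
  subst hs
  exact hf.hasFDerivAt.comp_hasDerivAt s hγ

end Calculus

/-! ### Coordinate derivatives, chain rules and the operator of the equation -/

section Coordinates

/-- The coordinate directions in the space of `(t, x, y, u)`. -/
abbrev et : Total := (1, 0, 0, 0)
abbrev ex : Total := (0, 1, 0, 0)
abbrev ey : Total := (0, 0, 1, 0)
abbrev eu : Total := (0, 0, 0, 1)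

/-- The coordinate directions in the space of `(t, x, y)`. -/
abbrev bt : Base := (1, 0, 0)
abbrev bx : Base := (0, 1, 0)
abbrev bY : Base := (0, 0, 1)

theorem total_decomp (v : Total) :
    v = v.1 • et + v.2.1 • ex + v.2.2.1 • ey + v.2.2.2 • eu := by
  ext <;> simp

theorem base_decomp (v : Base) : v = v.1 • bt + v.2.1 • bx + v.2.2 • bY := by
  ext <;> simp

theorem pd_total (f : Total → ℝ) (v p : Total) :
    pd v f p = v.1 * pd et f p + v.2.1 * pd ex f p + v.2.2.1 * pd ey f p
      + v.2.2.2 * pd eu f p := by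
  unfold pd
  conv_lhs => rw [total_decomp v]
  simp only [map_add, map_smul, smul_eq_mul]

theorem pd_base (f : Base → ℝ) (v p : Base) :
    pd v f p = v.1 * pd bt f p + v.2.1 * pd bx f p + v.2.2 * pd bY f p := by
  unfold pd
  conv_lhs => rw [base_decomp v]
  simp only [map_add, map_smul, smul_eq_mul]

theorem pd_coord_t (v p : Total) : pd v (fun q => q.1) p = v.1 :=
  pd_clm (ContinuousLinearMap.fst ℝ ℝ (ℝ × ℝ × ℝ)) v p

theorem pd_coord_x (v p : Total) : pd v (fun q => q.2.1) p = v.2.1 :=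
  pd_clm ((ContinuousLinearMap.fst ℝ ℝ (ℝ × ℝ)).comp (ContinuousLinearMap.snd ℝ ℝ (ℝ × ℝ × ℝ))) v p

theorem pd_coord_y (v p : Total) : pd v (fun q => q.2.2.1) p = v.2.2.1 :=
  pd_clm ((ContinuousLinearMap.fst ℝ ℝ ℝ).comp ((ContinuousLinearMap.snd ℝ ℝ (ℝ × ℝ)).comp
    (ContinuousLinearMap.snd ℝ ℝ (ℝ × ℝ × ℝ)))) v p

theorem pd_coord_u (v p : Total) : pd v (fun q => q.2.2.2) p = v.2.2.2 :=
  pd_clm ((ContinuousLinearMap.snd ℝ ℝ ℝ).comp ((ContinuousLinearMap.snd ℝ ℝ (ℝ × ℝ)).comp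
    (ContinuousLinearMap.snd ℝ ℝ (ℝ × ℝ × ℝ)))) v p

variable {E : Type*} [NormedAddCommGroup E] [NormedSpace ℝ E]

/-- Chain rule for a function of `(t, x, y)`. -/
theorem pd_comp_base {g : Base → ℝ} {T X Y : E → ℝ} {p : E}
    (hg : DifferentiableAt ℝ g (T p, X p, Y p)) (hT : DifferentiableAt ℝ T p)
    (hX : DifferentiableAt ℝ X p) (hY : DifferentiableAt ℝ Y p) (v : E) :
    pd v (fun q => g (T q, X q, Y q)) p =
      pd bt g (T p, X p, Y p) * pd v T p + pd bx g (T p, X p, Y p) * pd v X p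
        + pd bY g (T p, X p, Y p) * pd v Y p := by
  have h : HasFDerivAt (fun q => (T q, X q, Y q)) _ p :=
    hT.hasFDerivAt.prodMk (hX.hasFDerivAt.prodMk hY.hasFDerivAt)
  have h2 := (hg.hasFDerivAt.comp p h).fderiv
  have h3 : pd v (fun q => g (T q, X q, Y q)) p
      = pd ((pd v T p, pd v X p, pd v Y p) : Base) g (T p, X p, Y p) := by
    unfold pd
    rw [show (fun q => g (T q, X q, Y q)) = g ∘ fun q => (T q, X q, Y q) from rfl, h2]
    rfl
  rw [h3, pd_base]
  ring

/-- Chain rule for a function of `(t, x, y, u)`. -/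
theorem pd_comp_total {g : Total → ℝ} {T X Y W : E → ℝ} {p : E}
    (hg : DifferentiableAt ℝ g (T p, X p, Y p, W p)) (hT : DifferentiableAt ℝ T p)
    (hX : DifferentiableAt ℝ X p) (hY : DifferentiableAt ℝ Y p) (hW : DifferentiableAt ℝ W p)
    (v : E) :
    pd v (fun q => g (T q, X q, Y q, W q)) p =
      pd et g (T p, X p, Y p, W p) * pd v T p + pd ex g (T p, X p, Y p, W p) * pd v X p
        + pd ey g (T p, X p, Y p, W p) * pd v Y p + pd eu g (T p, X p, Y p, W p) * pd v W p := by
  have h : HasFDerivAt (fun q => (T q, X q, Y q, W q)) _ p :=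
    hT.hasFDerivAt.prodMk (hX.hasFDerivAt.prodMk (hY.hasFDerivAt.prodMk hW.hasFDerivAt))
  have h2 := (hg.hasFDerivAt.comp p h).fderiv
  have h3 : pd v (fun q => g (T q, X q, Y q, W q)) p
      = pd ((pd v T p, pd v X p, pd v Y p, pd v W p) : Total) g (T p, X p, Y p, W p) := by
    unfold pd
    rw [show (fun q => g (T q, X q, Y q, W q)) = g ∘ fun q => (T q, X q, Y q, W q) from rfl, h2]
    rfl
  rw [h3, pd_total]
  ring

theorem hasDerivAt_line_bt (t x y : ℝ) : HasDerivAt (fun s => ((s, x, y) : Base)) bt t :=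
  (hasDerivAt_id t).prodMk ((hasDerivAt_const t x).prodMk (hasDerivAt_const t y))

theorem hasDerivAt_line_bx (t x y : ℝ) : HasDerivAt (fun s => ((t, s, y) : Base)) bx x :=
  (hasDerivAt_const x t).prodMk ((hasDerivAt_id x).prodMk (hasDerivAt_const x y))

theorem hasDerivAt_line_bY (t x y : ℝ) : HasDerivAt (fun s => ((t, x, s) : Base)) bY y :=
  (hasDerivAt_const y t).prodMk ((hasDerivAt_const y x).prodMk (hasDerivAt_id y))

theorem hasDerivAt_line_ex (t x y u : ℝ) : HasDerivAt (fun s => ((t, s, y, u) : Total)) ex x :=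
  (hasDerivAt_const x t).prodMk ((hasDerivAt_id x).prodMk
    ((hasDerivAt_const x y).prodMk (hasDerivAt_const x u)))

theorem hasDerivAt_line_eu (t x y u : ℝ) : HasDerivAt (fun s => ((t, x, y, s) : Total)) eu u :=
  (hasDerivAt_const u t).prodMk ((hasDerivAt_const u x).prodMk
    ((hasDerivAt_const u y).prodMk (hasDerivAt_id u)))

theorem pd_bt_eq {f : Base → ℝ} {t x y : ℝ} (hf : DifferentiableAt ℝ f (t, x, y)) :
    pd bt f (t, x, y) = deriv (fun s => f (s, x, y)) t :=
  (deriv_line hf (hasDerivAt_line_bt t x y) rfl).deriv.symm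

theorem pd_bx_eq {f : Base → ℝ} {t x y : ℝ} (hf : DifferentiableAt ℝ f (t, x, y)) :
    pd bx f (t, x, y) = deriv (fun s => f (t, s, y)) x :=
  (deriv_line hf (hasDerivAt_line_bx t x y) rfl).deriv.symm

theorem pd_bY_eq {f : Base → ℝ} {t x y : ℝ} (hf : DifferentiableAt ℝ f (t, x, y)) :
    pd bY f (t, x, y) = deriv (fun s => f (t, x, s)) y :=
  (deriv_line hf (hasDerivAt_line_bY t x y) rfl).deriv.symm

/-- The operator `u ↦ u_t + x u_y - x² u_xx`. -/
noncomputable def kolm (g : Base → ℝ) (b : Base) : ℝ :=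
  pd bt g b + b.2.1 * pd bY g b - b.2.1 ^ 2 * pd bx (pd bx g) b

theorem isSolutionOn_iff {Ω : Set Base} (hΩ : IsOpen Ω) {g : Base → ℝ}
    (hg : ContDiffOn ℝ ∞ g Ω) : IsSolutionOn g Ω ↔ ∀ b ∈ Ω, kolm g b = 0 := by
  have key : ∀ t x y : ℝ, (t, x, y) ∈ Ω → (kolm g (t, x, y) = 0 ↔
      deriv (fun τ => g (τ, x, y)) t + x * deriv (fun η => g (t, x, η)) y =
        x ^ 2 * deriv (deriv fun ξ => g (t, ξ, y)) x) := by
    intro t x y h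
    have hd := differentiableAt_of_smooth hΩ hg h
    have h2 : pd bx (pd bx g) (t, x, y) = deriv (deriv fun ξ => g (t, ξ, y)) x := by
      -- The outer derivative sees the inner one only near `x`, where the line stays in the open set
      -- `Ω`.
      rw [pd_bx_eq (differentiableAt_of_smooth hΩ (smooth_pd hΩ hg bx) h)]
      apply Filter.EventuallyEq.deriv_eq
      have hc : Continuous fun s : ℝ => ((t, s, y) : Base) := by fun_prop
      filter_upwards [(hΩ.preimage hc).mem_nhds h] with s hs
      exact pd_bx_eq (differentiableAt_of_smooth hΩ hg hs)
    rw [kolm, h2, pd_bt_eq hd, pd_bY_eq hd]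
    constructor <;> intro h <;> linarith
  constructor
  · rintro ⟨-, h⟩ ⟨t, x, y⟩ hb
    exact (key t x y hb).2 (h t x y hb)
  · intro h
    exact ⟨hg, fun t x y hb => (key t x y hb).1 (h _ hb)⟩

end Coordinates

/-! ### Explicit solutions with prescribed jets -/

/-- A family of solutions of the equation, centred at `t = t₀` and `y = y₀`. -/
noncomputable def testSol (t₀ y₀ A₀ A₁ A₂ A₃ A₄ B M : ℝ) (b : Base) : ℝ :=
  A₀ + A₁ * b.2.1 + A₂ * b.2.1 ^ 2 * Real.exp (2 * (b.1 - t₀))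
    + A₃ * b.2.1 ^ 3 * Real.exp (6 * (b.1 - t₀)) + A₄ * b.2.1 ^ 4 * Real.exp (12 * (b.1 - t₀))
    + B * ((b.1 - t₀) * b.2.1 - (b.2.2 - y₀))
    + M * ((b.2.2 - y₀) ^ 2 - 2 * b.2.1 * (b.1 - t₀) * (b.2.2 - y₀) - b.2.1 ^ 2 * (b.1 - t₀)
      - b.2.1 ^ 2 / 2)

section TestSol

variable (t₀ y₀ A₀ A₁ A₂ A₃ A₄ B M : ℝ)

theorem contDiff_testSol : ContDiff ℝ ∞ (testSol t₀ y₀ A₀ A₁ A₂ A₃ A₄ B M) := by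
  unfold testSol; fun_prop

theorem hasDerivAt_exp_lin (c t : ℝ) :
    HasDerivAt (fun s => Real.exp (c * (s - t₀))) (c * Real.exp (c * (t - t₀))) t := by
  have h := (((hasDerivAt_id t).sub_const t₀).const_mul c).exp
  simp only [id, mul_one] at h
  rw [mul_comm]; exact h

theorem pd_bt_testSol : pd bt (testSol t₀ y₀ A₀ A₁ A₂ A₃ A₄ B M) = fun b : Base =>
    2 * A₂ * b.2.1 ^ 2 * Real.exp (2 * (b.1 - t₀))
      + 6 * A₃ * b.2.1 ^ 3 * Real.exp (6 * (b.1 - t₀))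
      + 12 * A₄ * b.2.1 ^ 4 * Real.exp (12 * (b.1 - t₀)) + B * b.2.1
      + M * (-2 * b.2.1 * (b.2.2 - y₀) - b.2.1 ^ 2) := by
  ext ⟨t, x, y⟩
  rw [pd_bt_eq ((contDiff_testSol t₀ y₀ A₀ A₁ A₂ A₃ A₄ B M).differentiable (by simp) _)]
  apply HasDerivAt.deriv
  unfold testSol
  have h2 := hasDerivAt_exp_lin t₀ 2 t
  have h6 := hasDerivAt_exp_lin t₀ 6 t
  have h12 := hasDerivAt_exp_lin t₀ 12 t
  have h1 := (hasDerivAt_id t).sub_const t₀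
  have := ((((h2.const_mul (A₂ * x ^ 2)).const_add (A₀ + A₁ * x)).add
    (h6.const_mul (A₃ * x ^ 3))).add (h12.const_mul (A₄ * x ^ 4))).add
    ((((h1.mul_const x).sub_const (y - y₀)).const_mul B))
  have := this.add (((((h1.const_mul (2 * x)).mul_const (y - y₀)).const_sub ((y - y₀) ^ 2)).sub
    (h1.const_mul (x ^ 2))).sub_const (x ^ 2 / 2) |>.const_mul M)
  refine this.congr_deriv ?_
  simp only
  ring

theorem pd_bx_testSol : pd bx (testSol t₀ y₀ A₀ A₁ A₂ A₃ A₄ B M) = fun b : Base =>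
    A₁ + 2 * A₂ * b.2.1 * Real.exp (2 * (b.1 - t₀))
      + 3 * A₃ * b.2.1 ^ 2 * Real.exp (6 * (b.1 - t₀))
      + 4 * A₄ * b.2.1 ^ 3 * Real.exp (12 * (b.1 - t₀)) + B * (b.1 - t₀)
      + M * (-2 * (b.1 - t₀) * (b.2.2 - y₀) - 2 * b.2.1 * (b.1 - t₀) - b.2.1) := by
  ext ⟨t, x, y⟩
  rw [pd_bx_eq ((contDiff_testSol t₀ y₀ A₀ A₁ A₂ A₃ A₄ B M).differentiable (by simp) _)]
  apply HasDerivAt.deriv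
  unfold testSol
  have h1 := hasDerivAt_id x
  have hp : ∀ n : ℕ, HasDerivAt (fun s : ℝ => s ^ n) (n * x ^ (n - 1)) x := fun n =>
    hasDerivAt_pow n x
  have := ((((h1.const_mul A₁).const_add A₀).add
    (((hp 2).const_mul A₂).mul_const (Real.exp (2 * (t - t₀))))).add
    (((hp 3).const_mul A₃).mul_const (Real.exp (6 * (t - t₀))))).add
    (((hp 4).const_mul A₄).mul_const (Real.exp (12 * (t - t₀))))
  have := (this.add (((h1.const_mul (t - t₀)).sub_const (y - y₀)).const_mul B)).add
    (((((((h1.const_mul 2).mul_const (t - t₀)).mul_const (y - y₀)).const_sub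
    ((y - y₀) ^ 2)).sub ((hp 2).mul_const (t - t₀))).sub ((hp 2).div_const 2)).const_mul M)
  refine this.congr_deriv ?_
  simp only [Nat.cast_ofNat]
  norm_num
  ring

theorem pd_bY_testSol : pd bY (testSol t₀ y₀ A₀ A₁ A₂ A₃ A₄ B M) = fun b : Base =>
    -B + M * (2 * (b.2.2 - y₀) - 2 * b.2.1 * (b.1 - t₀)) := by
  ext ⟨t, x, y⟩
  rw [pd_bY_eq ((contDiff_testSol t₀ y₀ A₀ A₁ A₂ A₃ A₄ B M).differentiable (by simp) _)]
  apply HasDerivAt.deriv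
  unfold testSol
  have h1 := (hasDerivAt_id y).sub_const y₀
  have := ((h1.const_sub ((t - t₀) * x)).const_mul B).add
    (((((h1.pow 2).sub (h1.const_mul (2 * x * (t - t₀)))).sub_const
      (x ^ 2 * (t - t₀))).sub_const (x ^ 2 / 2)).const_mul M)
  have := this.const_add (A₀ + A₁ * x + A₂ * x ^ 2 * Real.exp (2 * (t - t₀))
    + A₃ * x ^ 3 * Real.exp (6 * (t - t₀)) + A₄ * x ^ 4 * Real.exp (12 * (t - t₀)))
  refine (this.congr_deriv ?_).congr_of_eventuallyEq (Filter.Eventually.of_forall fun s => ?_)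
  · simp only [id, Nat.cast_ofNat]
    norm_num
  · simp
    ring

theorem pd_bx_bx_testSol : pd bx (pd bx (testSol t₀ y₀ A₀ A₁ A₂ A₃ A₄ B M)) = fun b : Base =>
    2 * A₂ * Real.exp (2 * (b.1 - t₀)) + 6 * A₃ * b.2.1 * Real.exp (6 * (b.1 - t₀))
      + 12 * A₄ * b.2.1 ^ 2 * Real.exp (12 * (b.1 - t₀)) + M * (-2 * (b.1 - t₀) - 1) := by
  rw [pd_bx_testSol]
  ext ⟨t, x, y⟩
  rw [pd_bx_eq (Differentiable.differentiableAt (by fun_prop))]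
  apply HasDerivAt.deriv
  have h1 := hasDerivAt_id x
  have hp : ∀ n : ℕ, HasDerivAt (fun s : ℝ => s ^ n) (n * x ^ (n - 1)) x := fun n =>
    hasDerivAt_pow n x
  have := (((((h1.const_mul (2 * A₂)).mul_const (Real.exp (2 * (t - t₀)))).const_add A₁).add
    (((hp 2).const_mul (3 * A₃)).mul_const (Real.exp (6 * (t - t₀))))).add
    (((hp 3).const_mul (4 * A₄)).mul_const (Real.exp (12 * (t - t₀))))).add_const (B * (t - t₀))
  have := this.add (((((h1.const_mul 2).mul_const (t - t₀)).const_sub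
    (-2 * (t - t₀) * (y - y₀))).sub h1).const_mul M)
  refine this.congr_deriv ?_
  simp only [Nat.cast_ofNat]
  norm_num
  ring

theorem pd_bx_bY_testSol (x₀ : ℝ) :
    pd bx (pd bY (testSol t₀ y₀ A₀ A₁ A₂ A₃ A₄ B M)) (t₀, x₀, y₀) = 0 := by
  rw [pd_bY_testSol, pd_bx_eq (Differentiable.differentiableAt (by fun_prop))]
  simp

theorem pd_bY_bY_testSol (x₀ : ℝ) :
    pd bY (pd bY (testSol t₀ y₀ A₀ A₁ A₂ A₃ A₄ B M)) (t₀, x₀, y₀) = 2 * M := by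
  rw [pd_bY_testSol, pd_bY_eq (Differentiable.differentiableAt (by fun_prop))]
  simp
  ring

theorem pd_bY_bt_testSol (x₀ : ℝ) :
    pd bY (pd bt (testSol t₀ y₀ A₀ A₁ A₂ A₃ A₄ B M)) (t₀, x₀, y₀) = -2 * x₀ * M := by
  rw [pd_bt_testSol, pd_bY_eq (Differentiable.differentiableAt (by fun_prop))]
  simp
  ring

theorem pd_bt_bt_testSol (x₀ : ℝ) :
    pd bt (pd bt (testSol t₀ y₀ A₀ A₁ A₂ A₃ A₄ B M)) (t₀, x₀, y₀)
      = 4 * A₂ * x₀ ^ 2 + 36 * A₃ * x₀ ^ 3 + 144 * A₄ * x₀ ^ 4 := by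
  rw [pd_bt_testSol, pd_bt_eq (Differentiable.differentiableAt (by fun_prop))]
  apply HasDerivAt.deriv
  have h2 := hasDerivAt_exp_lin t₀ 2 t₀
  have h6 := hasDerivAt_exp_lin t₀ 6 t₀
  have h12 := hasDerivAt_exp_lin t₀ 12 t₀
  have := ((((h2.const_mul (2 * A₂ * x₀ ^ 2)).add (h6.const_mul (6 * A₃ * x₀ ^ 3))).add
    (h12.const_mul (12 * A₄ * x₀ ^ 4))).add_const (B * x₀)).add_const
    (M * (-2 * x₀ * (y₀ - y₀) - x₀ ^ 2))
  refine this.congr_deriv ?_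
  simp
  ring

theorem pd_bt_bx_testSol (x₀ : ℝ) :
    pd bt (pd bx (testSol t₀ y₀ A₀ A₁ A₂ A₃ A₄ B M)) (t₀, x₀, y₀)
      = 4 * A₂ * x₀ + 18 * A₃ * x₀ ^ 2 + 48 * A₄ * x₀ ^ 3 + B - 2 * M * x₀ := by
  rw [pd_bx_testSol, pd_bt_eq (Differentiable.differentiableAt (by fun_prop))]
  apply HasDerivAt.deriv
  have h2 := hasDerivAt_exp_lin t₀ 2 t₀
  have h6 := hasDerivAt_exp_lin t₀ 6 t₀
  have h12 := hasDerivAt_exp_lin t₀ 12 t₀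
  have h1 := (hasDerivAt_id t₀).sub_const t₀
  have := (((((h2.const_mul (2 * A₂ * x₀)).const_add A₁).add (h6.const_mul (3 * A₃ * x₀ ^ 2))).add
    (h12.const_mul (4 * A₄ * x₀ ^ 3))).add (h1.const_mul B)).add
    (((((h1.const_mul (-2)).mul_const (y₀ - y₀)).sub (h1.const_mul (2 * x₀))).sub_const
      x₀).const_mul M)
  refine this.congr_deriv ?_
  simp
  ring

theorem kolm_testSol (b : Base) : kolm (testSol t₀ y₀ A₀ A₁ A₂ A₃ A₄ B M) b = 0 := by
  rw [kolm, pd_bx_bx_testSol, pd_bt_testSol, pd_bY_testSol]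
  ring

end TestSol

/-- Away from `x = 0` there are solutions with prescribed value, prescribed first derivatives
and prescribed second derivatives `g_tt` and `g_yy`. -/
theorem exists_solution_jet (t₀ x₀ y₀ : ℝ) (hx : x₀ ≠ 0) (u₀ τ a η l m : ℝ) :
    ∃ g : Base → ℝ, ContDiff ℝ ∞ g ∧ (∀ b, kolm g b = 0) ∧ g (t₀, x₀, y₀) = u₀ ∧
      pd bt g (t₀, x₀, y₀) = τ ∧ pd bx g (t₀, x₀, y₀) = a ∧ pd bY g (t₀, x₀, y₀) = η ∧
      pd bt (pd bt g) (t₀, x₀, y₀) = l ∧ pd bt (pd bx g) (t₀, x₀, y₀) = 0 ∧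
      pd bY (pd bt g) (t₀, x₀, y₀) = -x₀ * m ∧ pd bx (pd bY g) (t₀, x₀, y₀) = 0 ∧
      pd bY (pd bY g) (t₀, x₀, y₀) = m := by
  -- With `P = A₂x₀²`, `Q = A₃x₀³`, `R = A₄x₀⁴`, `B = -η`, `M = m/2`, the conditions on `g_t`, `x₀
  -- g_tx` and `g_tt` read `2P + 6Q + 12R = r₁`, `4P + 18Q + 48R = r₂`, `4P + 36Q + 144R = l`.
  -- Elimination gives `R`, `Q`, `P` in this order; `A₁` and `A₀` then adjust `g_x` and the value.
  obtain ⟨r₁, hr₁⟩ : ∃ r, r = τ + η * x₀ + m / 2 * x₀ ^ 2 := ⟨_, rfl⟩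
  obtain ⟨r₂, hr₂⟩ : ∃ r, r = η * x₀ + m * x₀ ^ 2 := ⟨_, rfl⟩
  obtain ⟨R, hR⟩ : ∃ r, r = (l - 4 * r₂ + 6 * r₁) / 24 := ⟨_, rfl⟩
  obtain ⟨Q, hQ⟩ : ∃ r, r = (r₂ - 2 * r₁ - 24 * R) / 6 := ⟨_, rfl⟩
  obtain ⟨P, hP⟩ : ∃ r, r = (r₁ - 6 * Q - 12 * R) / 2 := ⟨_, rfl⟩
  obtain ⟨A₂, hA₂⟩ : ∃ r, r * x₀ ^ 2 = P := ⟨P / x₀ ^ 2, by field_simp⟩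
  obtain ⟨A₃, hA₃⟩ : ∃ r, r * x₀ ^ 3 = Q := ⟨Q / x₀ ^ 3, by field_simp⟩
  obtain ⟨A₄, hA₄⟩ : ∃ r, r * x₀ ^ 4 = R := ⟨R / x₀ ^ 4, by field_simp⟩
  obtain ⟨A₁, hA₁⟩ : ∃ r, r = a - (2 * A₂ * x₀ + 3 * A₃ * x₀ ^ 2 + 4 * A₄ * x₀ ^ 3
    - m / 2 * x₀) := ⟨_, rfl⟩
  obtain ⟨A₀, hA₀⟩ : ∃ r, r = u₀ - (A₁ * x₀ + A₂ * x₀ ^ 2 + A₃ * x₀ ^ 3 + A₄ * x₀ ^ 4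
    - m / 2 * x₀ ^ 2 / 2) := ⟨_, rfl⟩
  refine ⟨testSol t₀ y₀ A₀ A₁ A₂ A₃ A₄ (-η) (m / 2), contDiff_testSol ..,
    fun b => kolm_testSol .., ?_,
    ?_,
    ?_, ?_, ?_, ?_, ?_, ?_, ?_⟩
  · simp only [testSol, sub_self, mul_zero, Real.exp_zero]
    rw [hA₀]; ring
  · simp only [pd_bt_testSol, sub_self, mul_zero, Real.exp_zero]
    linear_combination 2 * hA₂ + 6 * hA₃ + 12 * hA₄ + 2 * hP + hr₁
  · simp only [pd_bx_testSol, sub_self, mul_zero, Real.exp_zero]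
    rw [hA₁]; ring
  · simp only [pd_bY_testSol, sub_self, mul_zero]; ring
  · rw [pd_bt_bt_testSol]
    linear_combination 4 * hA₂ + 36 * hA₃ + 144 * hA₄ + 4 * hP + 24 * hQ + 24 * hR
  · rw [pd_bt_bx_testSol]
    apply mul_left_cancel₀ hx
    linear_combination 4 * hA₂ + 18 * hA₃ + 48 * hA₄ + 4 * hP + 6 * hQ + hr₂
  · rw [pd_bY_bt_testSol]; ring
  · rw [pd_bx_bY_testSol]
  · rw [pd_bY_bY_testSol]; ring

/-! ### Pulling solutions back along a point transformation -/

/-- The projection to the base. -/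
abbrev toBase (p : Total) : Base := (p.1, p.2.1, p.2.2.1)

/-- The point of the total space over `b` with `u`-coordinate `u`. -/
abbrev lift (b : Base) (u : ℝ) : Total := (b.1, b.2.1, b.2.2, u)

/-- The four components of a transformation. -/
abbrev cT (Φ : Total → Total) (p : Total) : ℝ := (Φ p).1
abbrev cX (Φ : Total → Total) (p : Total) : ℝ := (Φ p).2.1
abbrev cY (Φ : Total → Total) (p : Total) : ℝ := (Φ p).2.2.1
abbrev cU (Φ : Total → Total) (p : Total) : ℝ := (Φ p).2.2.2

theorem IsPointTransformation.smooth_cT {Φ : OpenPartialHomeomorph Total Total}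
    (h : IsPointTransformation Φ) : ContDiffOn ℝ ∞ (cT Φ) Φ.source :=
  contDiff_fst.comp_contDiffOn h.1

theorem IsPointTransformation.smooth_cX {Φ : OpenPartialHomeomorph Total Total}
    (h : IsPointTransformation Φ) : ContDiffOn ℝ ∞ (cX Φ) Φ.source :=
  (contDiff_fst.comp contDiff_snd).comp_contDiffOn h.1

theorem IsPointTransformation.smooth_cY {Φ : OpenPartialHomeomorph Total Total}
    (h : IsPointTransformation Φ) : ContDiffOn ℝ ∞ (cY Φ) Φ.source :=
  (contDiff_fst.comp (contDiff_snd.comp contDiff_snd)).comp_contDiffOn h.1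

theorem IsPointTransformation.smooth_cU {Φ : OpenPartialHomeomorph Total Total}
    (h : IsPointTransformation Φ) : ContDiffOn ℝ ∞ (cU Φ) Φ.source :=
  (contDiff_snd.comp (contDiff_snd.comp contDiff_snd)).comp_contDiffOn h.1

/-- The function whose zero set is the preimage of the graph of `g` under `Φ`. -/
def pullFun (Φ : Total → Total) (g : Base → ℝ) (p : Total) : ℝ :=
  g (cT Φ p, cX Φ p, cY Φ p) - cU Φ p

theorem smooth_pullFun {Φ : OpenPartialHomeomorph Total Total} (h : IsPointTransformation Φ)
    {g : Base → ℝ} (hg : ContDiff ℝ ∞ g) : ContDiffOn ℝ ∞ (pullFun Φ g) Φ.source :=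
  (hg.comp_contDiffOn (h.smooth_cT.prodMk (h.smooth_cX.prodMk h.smooth_cY))).sub h.smooth_cU

/-- The implicit function theorem in the form needed here: near a zero of `F` at which the
derivative in `u` does not vanish, the zero set of `F` is the graph of a smooth function. -/
theorem exists_implicit {F : Total → ℝ} {U : Set Total} (hU : IsOpen U)
    (hF : ContDiffOn ℝ ∞ F U) {p₀ : Total} (hp₀ : p₀ ∈ U)
    (hu : pd eu F p₀ ≠ 0) :
    ∃ (N : Set Total) (Ω : Set Base) (g : Base → ℝ), IsOpen N ∧ p₀ ∈ N ∧ N ⊆ U ∧ IsOpen Ω ∧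
      ContDiffOn ℝ ∞ g Ω ∧ graphOver g Ω = N ∩ {p | F p = 0} := by
  -- Straighten `F`: the map `(t, x, y, F)` is a local diffeomorphism where `F_u ≠ 0`, and its
  -- inverse on the slice of last coordinate `0` parametrizes the zero set.
  let Ψ : Total → Total := fun p => (p.1, p.2.1, p.2.2.1, F p)
  have hΨ : ContDiffOn ℝ ∞ Ψ U := by
    refine contDiffOn_fst.prodMk (ContDiffOn.prodMk ?_ (ContDiffOn.prodMk ?_ hF))
    · exact ContDiff.contDiffOn (by fun_prop)
    · exact ContDiff.contDiffOn (by fun_prop)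
  have hinv : ∀ q ∈ U, pd eu F q ≠ 0 → ∃ e : Total ≃L[ℝ] Total,
      HasFDerivAt Ψ (e : Total →L[ℝ] Total) q := by
    intro q hq hq'
    have hFq := (differentiableAt_of_smooth hU hF hq).hasFDerivAt
    have hd : HasFDerivAt Ψ ((ContinuousLinearMap.fst ℝ ℝ (ℝ × ℝ × ℝ)).prod
        (((ContinuousLinearMap.fst ℝ ℝ (ℝ × ℝ)).comp
          (ContinuousLinearMap.snd ℝ ℝ (ℝ × ℝ × ℝ))).prod
        (((ContinuousLinearMap.fst ℝ ℝ ℝ).comp ((ContinuousLinearMap.snd ℝ ℝ (ℝ × ℝ)).comp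
          (ContinuousLinearMap.snd ℝ ℝ (ℝ × ℝ × ℝ)))).prod (fderiv ℝ F q)))) q := by
      refine hasFDerivAt_fst.prodMk (HasFDerivAt.prodMk ?_ (HasFDerivAt.prodMk ?_ hFq))
      · exact ContinuousLinearMap.hasFDerivAt ((ContinuousLinearMap.fst ℝ ℝ (ℝ × ℝ)).comp
          (ContinuousLinearMap.snd ℝ ℝ (ℝ × ℝ × ℝ)))
      · exact ContinuousLinearMap.hasFDerivAt ((ContinuousLinearMap.fst ℝ ℝ ℝ).comp
          ((ContinuousLinearMap.snd ℝ ℝ (ℝ × ℝ)).comp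
            (ContinuousLinearMap.snd ℝ ℝ (ℝ × ℝ × ℝ))))
    set L := (ContinuousLinearMap.fst ℝ ℝ (ℝ × ℝ × ℝ)).prod
        (((ContinuousLinearMap.fst ℝ ℝ (ℝ × ℝ)).comp
          (ContinuousLinearMap.snd ℝ ℝ (ℝ × ℝ × ℝ))).prod
        (((ContinuousLinearMap.fst ℝ ℝ ℝ).comp ((ContinuousLinearMap.snd ℝ ℝ (ℝ × ℝ)).comp
          (ContinuousLinearMap.snd ℝ ℝ (ℝ × ℝ × ℝ)))).prod (fderiv ℝ F q))) with hL
    have hinj : Function.Injective (L : Total →ₗ[ℝ] Total) := by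
      rw [← LinearMap.ker_eq_bot, LinearMap.ker_eq_bot']
      intro v hv
      have h1 : v.1 = 0 := congrArg (fun w : Total => w.1) hv
      have h2 : v.2.1 = 0 := congrArg (fun w : Total => w.2.1) hv
      have h3 : v.2.2.1 = 0 := congrArg (fun w : Total => w.2.2.1) hv
      have h4 : pd v F q = 0 := congrArg (fun w : Total => w.2.2.2) hv
      rw [pd_total, h1, h2, h3] at h4
      have h5 : v.2.2.2 = 0 := by simpa [hq'] using h4
      ext <;> simp [h1, h2, h3, h5]
    refine ⟨(LinearEquiv.ofInjectiveEndo (L : Total →ₗ[ℝ] Total)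
      hinj).toContinuousLinearEquiv, ?_⟩
    convert hd using 1
    ext <;> rfl
  obtain ⟨e₀, he₀⟩ := hinv p₀ hp₀ hu
  have hc₀ : ContDiffAt ℝ ∞ Ψ p₀ := hΨ.contDiffAt (hU.mem_nhds hp₀)
  have hN : IsOpen (U ∩ {p | pd eu F p ≠ 0}) :=
    (smooth_pd hU hF eu).continuousOn.isOpen_inter_preimage hU isOpen_ne
  -- The restriction to `F_u ≠ 0` makes the inverse smooth at every point of the target, not only at
  -- the image of `p₀`.
  let e := (hc₀.toOpenPartialHomeomorph Ψ he₀ (by simp)).restrOpen _ hN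
  have hse : e.source ⊆ U ∩ {p | pd eu F p ≠ 0} := by
    intro q hq
    rw [OpenPartialHomeomorph.restrOpen_source] at hq
    exact hq.2
  have hecoe : ∀ q, e q = Ψ q := fun q => rfl
  have hpe : p₀ ∈ e.source := by
    rw [OpenPartialHomeomorph.restrOpen_source]
    exact ⟨hc₀.mem_toOpenPartialHomeomorph_source he₀ (by simp), hp₀, hu⟩
  have hcl : Continuous fun b : Base => lift b 0 := by fun_prop
  refine ⟨e.source, (fun b => lift b 0) ⁻¹' e.target, fun b => (e.symm (lift b 0)).2.2.2,
    e.open_source, hpe, fun q hq => (hse hq).1, e.open_target.preimage hcl, ?_, ?_⟩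
  · intro b hb
    have hq := e.map_target hb
    obtain ⟨e', he'⟩ := hinv _ (hse hq).1 (hse hq).2
    have h1 : ContDiffAt ℝ ∞ e.symm (lift b 0) :=
      e.contDiffAt_symm hb he' (hΨ.contDiffAt (hU.mem_nhds (hse hq).1))
    have h2 : ContDiffAt ℝ ∞ (fun b : Base => lift b 0) b := by
      apply ContDiff.contDiffAt; fun_prop
    have h3 : ContDiffAt ℝ ∞ (fun b : Base => e.symm (lift b 0)) b := h1.comp b h2
    exact h3.snd.snd.snd.contDiffWithinAt
  · ext p
    constructor
    · rintro ⟨hb, hpu⟩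
      have hq := e.map_target hb
      have hr : Ψ (e.symm (lift (toBase p) 0)) = lift (toBase p) 0 := e.right_inv hb
      simp only [Ψ, Prod.mk.injEq] at hr
      obtain ⟨h1, h2, h3, h4⟩ := hr
      have h5 : e.symm (lift (toBase p) 0) = p := by
        ext
        exacts [h1, h2, h3, hpu.symm]
      rw [h5] at h4 hq
      exact ⟨hq, h4⟩
    · rintro ⟨hp, hFp⟩
      have h1 : e p = lift (toBase p) 0 := by
        rw [hecoe]; ext <;> simp [Ψ, show F p = 0 from hFp]
      refine ⟨?_, ?_⟩
      · change lift (toBase p) 0 ∈ e.target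
        rw [← h1]; exact e.map_source hp
      · change p.2.2.2 = (e.symm (lift (toBase p) 0)).2.2.2
        rw [← h1, e.left_inv hp]

/-- The second-order relation satisfied by a function whose zero set is a graph of a solution. -/
theorem zero_set_relation {F : Total → ℝ} {U : Set Total} (hU : IsOpen U)
    (hF : ContDiffOn ℝ ∞ F U) {Ω : Set Base} (hΩ : IsOpen Ω) {g : Base → ℝ}
    (hg : ContDiffOn ℝ ∞ g Ω) (hsub : graphOver g Ω ⊆ U ∩ {p | F p = 0})
    {p : Total} (hp : p ∈ graphOver g Ω) (hk : kolm g (toBase p) = 0) :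
    (pd et F p + p.2.1 * pd ey F p) * pd eu F p ^ 2 =
      p.2.1 ^ 2 * (pd ex (pd ex F) p * pd eu F p ^ 2
        - 2 * pd ex (pd eu F) p * pd ex F p * pd eu F p + pd eu (pd eu F) p * pd ex F p ^ 2) := by
  have hlift : ∀ b ∈ Ω, lift b (g b) ∈ U ∧ F (lift b (g b)) = 0 := fun b hb =>
    hsub (a := lift b (g b)) ⟨hb, rfl⟩
  have chain : ∀ (G : Total → ℝ), ContDiffOn ℝ ∞ G U → ∀ b ∈ Ω, ∀ v : Base,
      pd v (fun b => G (lift b (g b))) b = pd et G (lift b (g b)) * v.1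
        + pd ex G (lift b (g b)) * v.2.1 + pd ey G (lift b (g b)) * v.2.2
        + pd eu G (lift b (g b)) * pd v g b := by
    intro G hG b hb v
    have hGd := differentiableAt_of_smooth hU hG (hlift b hb).1
    have := pd_comp_total (E := Base) (T := fun b => b.1) (X := fun b => b.2.1)
      (Y := fun b => b.2.2) (W := g) (p := b) hGd (by fun_prop) (by fun_prop) (by fun_prop)
      (differentiableAt_of_smooth hΩ hg hb) v
    rw [this]
    congr 1
    congr 1
    · congr 1
      · congr 1
        exact pd_clm (ContinuousLinearMap.fst ℝ ℝ (ℝ × ℝ)) v b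
      · congr 1
        exact pd_clm ((ContinuousLinearMap.fst ℝ ℝ ℝ).comp
          (ContinuousLinearMap.snd ℝ ℝ (ℝ × ℝ))) v b
    · congr 1
      exact pd_clm ((ContinuousLinearMap.snd ℝ ℝ ℝ).comp
        (ContinuousLinearMap.snd ℝ ℝ (ℝ × ℝ))) v b
  have first : ∀ b ∈ Ω, ∀ v : Base, pd et F (lift b (g b)) * v.1
        + pd ex F (lift b (g b)) * v.2.1 + pd ey F (lift b (g b)) * v.2.2
        + pd eu F (lift b (g b)) * pd v g b = 0 := by
    intro b hb v
    rw [← chain F hF b hb v]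
    exact pd_eq_zero_of_eqOn hΩ (fun b hb => (hlift b hb).2) hb v
  have hb : toBase p ∈ Ω := hp.1
  have hpl : lift (toBase p) (g (toBase p)) = p := by
    ext
    exacts [rfl, rfl, rfl, hp.2.symm]
  have h1 := first _ hb bt
  have h2 := first _ hb bx
  have h3 := first _ hb bY
  have hcomp : ∀ G : Total → ℝ, ContDiffOn ℝ ∞ G U →
      DifferentiableAt ℝ (fun b => G (lift b (g b))) (toBase p) := by
    intro G hG
    have hGd := differentiableAt_of_smooth hU hG (hlift _ hb).1
    have hgd := differentiableAt_of_smooth hΩ hg hb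
    exact DifferentiableAt.comp (toBase p) (f := fun b => lift b (g b)) hGd (by fun_prop)
  -- Second `x`-derivative of the identity `F(b, g(b)) = 0`.
  have h4 : pd bx (fun b => pd ex F (lift b (g b)) + pd eu F (lift b (g b)) * pd bx g b)
      (toBase p) = 0 := by
    refine pd_eq_zero_of_eqOn hΩ (c := 0) (fun b hb => ?_) hb bx
    simpa using first b hb bx
  have hgx := differentiableAt_of_smooth hΩ (smooth_pd hΩ hg bx) hb
  have hFx := hcomp _ (smooth_pd hU hF ex)
  have hFu := hcomp _ (smooth_pd hU hF eu)
  rw [pd_add hFx (hFu.fun_mul hgx), pd_mul hFu hgx, chain _ (smooth_pd hU hF ex) _ hb,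
    chain _ (smooth_pd hU hF eu) _ hb, hpl,
    pd_comm hU hF (hsub hp).1 eu ex] at h4
  rw [hpl] at h1 h2 h3
  simp only [mul_one, mul_zero, add_zero, zero_add] at h1 h2 h3 h4
  rw [kolm] at hk
  simp only at hk
  set a := pd bx g (toBase p)
  have e1 : pd ex F p = -(pd eu F p * a) := by linarith
  have e2 : pd et F p = -(pd eu F p * pd bt g (toBase p)) := by linarith
  have e3 : pd ey F p = -(pd eu F p * pd bY g (toBase p)) := by linarith
  -- After the first derivatives of `F` are replaced by `-F_u` times those of `g`, and `F_xx` is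
  -- removed by `h4`, the two sides differ by `-F_u³ (g_t + x g_y - x² g_xx)`.
  rw [e1, e2, e3]
  linear_combination (-(pd eu F p) ^ 3) * hk - p.2.1 ^ 2 * pd eu F p ^ 2 * h4

/-- A point symmetry pulls solutions back to solutions. -/
theorem IsPointSymmetry.relation {Φ : OpenPartialHomeomorph Total Total} (hΦ : IsPointSymmetry Φ)
    {g' : Base → ℝ} (hg' : ContDiff ℝ ∞ g') (hsol : ∀ b, kolm g' b = 0)
    {p : Total} (hp : p ∈ Φ.source) (hz : pullFun Φ g' p = 0) (hu : pd eu (pullFun Φ g') p ≠ 0) :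
    (pd et (pullFun Φ g') p + p.2.1 * pd ey (pullFun Φ g') p) * pd eu (pullFun Φ g') p ^ 2 =
      p.2.1 ^ 2 * (pd ex (pd ex (pullFun Φ g')) p * pd eu (pullFun Φ g') p ^ 2
        - 2 * pd ex (pd eu (pullFun Φ g')) p * pd ex (pullFun Φ g') p * pd eu (pullFun Φ g') p
        + pd eu (pd eu (pullFun Φ g')) p * pd ex (pullFun Φ g') p ^ 2) := by
  have hF := smooth_pullFun hΦ.1 hg'
  obtain ⟨N, Ω, g, hN, hpN, hNU, hΩ, hg, hgr⟩ := exists_implicit Φ.open_source hF hp hu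
  have himg : IsOpen (Φ '' N) := Φ.isOpen_image_of_subset_source hN hNU
  have hcg : Continuous fun b : Base => lift b (g' b) := by
    have := hg'.continuous
    fun_prop
  -- The second domain consists of the base points over which the graph of `g'` lies in `Φ '' N`;
  -- over it, the graph of `g'` is exactly the image of the graph of `g`.
  have hΩ' : IsOpen ((fun b : Base => lift b (g' b)) ⁻¹' (Φ '' N)) := himg.preimage hcg
  have hgU : graphOver g Ω ⊆ Φ.source ∩ {p | pullFun Φ g' p = 0} := by
    rw [hgr]; exact inter_subset_inter_left _ hNU
  have hzero : ∀ q, pullFun Φ g' q = 0 ↔ lift (toBase (Φ q)) (g' (toBase (Φ q))) = Φ q := by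
    intro q
    constructor
    · intro h
      ext
      exacts [rfl, rfl, rfl, sub_eq_zero.1 h]
    · intro h
      exact sub_eq_zero.2 (congrArg (fun w : Total => w.2.2.2) h)
  have himage : Φ '' graphOver g Ω
      = graphOver g' ((fun b : Base => lift b (g' b)) ⁻¹' (Φ '' N)) := by
    rw [hgr]
    ext q
    constructor
    · rintro ⟨r, ⟨hrN, hr⟩, rfl⟩
      have h := (hzero r).1 hr
      refine ⟨?_, congrArg (fun w : Total => w.2.2.2) h.symm⟩
      change lift (toBase (Φ r)) (g' (toBase (Φ r))) ∈ Φ '' N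
      rw [h]; exact ⟨r, hrN, rfl⟩
    · rintro ⟨hq, hqu⟩
      have hql : lift (toBase q) (g' (toBase q)) = q := by
        ext
        exacts [rfl, rfl, rfl, hqu.symm]
      change lift (toBase q) (g' (toBase q)) ∈ Φ '' N at hq
      rw [hql] at hq
      obtain ⟨r, hrN, rfl⟩ := hq
      exact ⟨r, ⟨hrN, (hzero r).2 hql⟩, rfl⟩
  have hs := (hΦ.2 Ω _ g g' hΩ hΩ' hg hg'.contDiffOn (fun q hq => (hgU hq).1) himage).2
    ((isSolutionOn_iff hΩ' hg'.contDiffOn).2 fun b _ => hsol b)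
  have hpg : p ∈ graphOver g Ω := by rw [hgr]; exact ⟨hpN, hz⟩
  exact zero_set_relation Φ.open_source hF hΩ hg hgU hpg
    ((isSolutionOn_iff hΩ hg).1 hs _ hpg.1)

/-! ### The determining relation as an identity in the jet -/

/-- The first derivative of `pullFun Φ g` in terms of the first derivatives `τ, a, η` of `g`. -/
noncomputable def jetOne (Φ : Total → Total) (p : Total) (τ a η : ℝ) (v : Total) : ℝ :=
  τ * pd v (cT Φ) p + a * pd v (cX Φ) p + η * pd v (cY Φ) p - pd v (cU Φ) p

/-- The second derivative of `pullFun Φ g` for a solution `g` with first derivatives `τ, a, η` and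
second derivatives `g_tt = l`, `g_yy = m`, `g_ty = -x m`, `g_tx = g_xy = 0`. -/
noncomputable def jetTwo (Φ : Total → Total) (p : Total) (τ a η l m : ℝ) (v w : Total) : ℝ :=
  l * (pd v (cT Φ) p * pd w (cT Φ) p)
    - cX Φ p * m * (pd v (cT Φ) p * pd w (cY Φ) p + pd v (cY Φ) p * pd w (cT Φ) p)
    + m * (pd v (cY Φ) p * pd w (cY Φ) p)
    + (τ + cX Φ p * η) / cX Φ p ^ 2 * (pd v (cX Φ) p * pd w (cX Φ) p)
    + τ * pd v (pd w (cT Φ)) p + a * pd v (pd w (cX Φ)) p + η * pd v (pd w (cY Φ)) p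
    - pd v (pd w (cU Φ)) p

theorem pd_pullFun {Φ : OpenPartialHomeomorph Total Total} (hΦ : IsPointTransformation Φ)
    {g : Base → ℝ} (hg : ContDiff ℝ ∞ g) {p : Total} (hp : p ∈ Φ.source) (v : Total) :
    pd v (pullFun Φ g) p = pd bt g (toBase (Φ p)) * pd v (cT Φ) p
      + pd bx g (toBase (Φ p)) * pd v (cX Φ) p + pd bY g (toBase (Φ p)) * pd v (cY Φ) p
      - pd v (cU Φ) p := by
  have hT := differentiableAt_of_smooth Φ.open_source hΦ.smooth_cT hp
  have hX := differentiableAt_of_smooth Φ.open_source hΦ.smooth_cX hp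
  have hY := differentiableAt_of_smooth Φ.open_source hΦ.smooth_cY hp
  have hU := differentiableAt_of_smooth Φ.open_source hΦ.smooth_cU hp
  have hgd : Differentiable ℝ g := hg.differentiable (by simp)
  have h1 : DifferentiableAt ℝ (fun q => g (cT Φ q, cX Φ q, cY Φ q)) p :=
    DifferentiableAt.comp p (hgd _) (hT.prodMk (hX.prodMk hY))
  change pd v (fun q => g (cT Φ q, cX Φ q, cY Φ q) - cU Φ q) p = _
  rw [pd_sub h1 hU, pd_comp_base (hgd _) hT hX hY]

theorem pd_pd_pullFun {Φ : OpenPartialHomeomorph Total Total} (hΦ : IsPointTransformation Φ)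
    {g : Base → ℝ} (hg : ContDiff ℝ ∞ g) {p : Total} (hp : p ∈ Φ.source) (v w : Total) :
    pd v (pd w (pullFun Φ g)) p =
      (pd bt (pd bt g) (toBase (Φ p)) * pd v (cT Φ) p
        + pd bx (pd bt g) (toBase (Φ p)) * pd v (cX Φ) p
        + pd bY (pd bt g) (toBase (Φ p)) * pd v (cY Φ) p) * pd w (cT Φ) p
      + pd bt g (toBase (Φ p)) * pd v (pd w (cT Φ)) p
      + ((pd bt (pd bx g) (toBase (Φ p)) * pd v (cT Φ) p
        + pd bx (pd bx g) (toBase (Φ p)) * pd v (cX Φ) p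
        + pd bY (pd bx g) (toBase (Φ p)) * pd v (cY Φ) p) * pd w (cX Φ) p
      + pd bx g (toBase (Φ p)) * pd v (pd w (cX Φ)) p)
      + ((pd bt (pd bY g) (toBase (Φ p)) * pd v (cT Φ) p
        + pd bx (pd bY g) (toBase (Φ p)) * pd v (cX Φ) p
        + pd bY (pd bY g) (toBase (Φ p)) * pd v (cY Φ) p) * pd w (cY Φ) p
      + pd bY g (toBase (Φ p)) * pd v (pd w (cY Φ)) p)
      - pd v (pd w (cU Φ)) p := by
  have hT := differentiableAt_of_smooth Φ.open_source hΦ.smooth_cT hp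
  have hX := differentiableAt_of_smooth Φ.open_source hΦ.smooth_cX hp
  have hY := differentiableAt_of_smooth Φ.open_source hΦ.smooth_cY hp
  have hgs : ∀ z : Base, Differentiable ℝ (pd z g) := fun z => by
    have h := smooth_pd isOpen_univ hg.contDiffOn z
    exact (contDiffOn_univ.1 h).differentiable (by simp)
  have hc : ∀ z : Base, DifferentiableAt ℝ (fun q => pd z g (cT Φ q, cX Φ q, cY Φ q)) p :=
    fun z => DifferentiableAt.comp p (hgs z _) (hT.prodMk (hX.prodMk hY))
  have h2 : ∀ f : Total → ℝ, ContDiffOn ℝ ∞ f Φ.source → DifferentiableAt ℝ (pd w f) p :=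
    fun f hf => differentiableAt_of_smooth Φ.open_source (smooth_pd Φ.open_source hf w) hp
  rw [pd_congr Φ.open_source (fun q hq => pd_pullFun hΦ hg hq w) hp]
  have hTw := h2 _ hΦ.smooth_cT
  have hXw := h2 _ hΦ.smooth_cX
  have hYw := h2 _ hΦ.smooth_cY
  have hUw := h2 _ hΦ.smooth_cU
  rw [pd_sub (((hc bt).fun_mul hTw).fun_add ((hc bx).fun_mul hXw) |>.fun_add
      ((hc bY).fun_mul hYw)) hUw,
    pd_add (((hc bt).fun_mul hTw).fun_add ((hc bx).fun_mul hXw)) ((hc bY).fun_mul hYw),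
    pd_add ((hc bt).fun_mul hTw) ((hc bx).fun_mul hXw), pd_mul (hc bt) hTw, pd_mul (hc bx) hXw,
    pd_mul (hc bY) hYw, pd_comp_base (hgs bt _) hT hX hY, pd_comp_base (hgs bx _) hT hX hY,
    pd_comp_base (hgs bY _) hT hX hY]

/-- For each choice of the parameters there is a global solution with that jet at the image point;
its `g_xx` is dictated by the equation, which is solvable for it because `X ≠ 0`. The concrete
solution thereby disappears, and the five parameters may be varied independently as long as `F_u ≠
0`. -/
theorem IsPointSymmetry.jet_relation {Φ : OpenPartialHomeomorph Total Total}
    (hΦ : IsPointSymmetry Φ) {p : Total} (hp : p ∈ Φ.source) (hX : cX Φ p ≠ 0)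
    (τ a η l m : ℝ) (hu : jetOne Φ p τ a η eu ≠ 0) :
    (jetOne Φ p τ a η et + p.2.1 * jetOne Φ p τ a η ey) * jetOne Φ p τ a η eu ^ 2 =
      p.2.1 ^ 2 * (jetTwo Φ p τ a η l m ex ex * jetOne Φ p τ a η eu ^ 2
        - 2 * jetTwo Φ p τ a η l m ex eu * jetOne Φ p τ a η ex * jetOne Φ p τ a η eu
        + jetTwo Φ p τ a η l m eu eu * jetOne Φ p τ a η ex ^ 2) := by
  obtain ⟨g, hg, hk, h0, ht, hx, hy, htt, htx, hyt, hxy, hyy⟩ :=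
    exists_solution_jet (cT Φ p) (cX Φ p) (cY Φ p) hX (cU Φ p) τ a η l m
  have h1 : ∀ v, pd v (pullFun Φ g) p = jetOne Φ p τ a η v := by
    intro v
    rw [pd_pullFun hΦ.1 hg hp, ht, hx, hy, jetOne]
  have hgu := hg.contDiffOn (s := univ)
  have hxx : pd bx (pd bx g) (toBase (Φ p)) = (τ + cX Φ p * η) / cX Φ p ^ 2 := by
    have := hk (toBase (Φ p))
    rw [kolm, ht, hy] at this
    field_simp
    linarith
  have h2 : ∀ v w, pd v (pd w (pullFun Φ g)) p = jetTwo Φ p τ a η l m v w := by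
    intro v w
    rw [pd_pd_pullFun hΦ.1 hg hp, ht, hx, hy, htt, htx, hyt, hxy, hyy, hxx,
      pd_comm isOpen_univ hgu (mem_univ _) bx bt, htx,
      pd_comm isOpen_univ hgu (mem_univ _) bY bx, hxy,
      pd_comm isOpen_univ hgu (mem_univ _) bt bY, hyt, jetTwo]
    ring
  have hz : pullFun Φ g p = 0 := by simp [pullFun, h0]
  have := hΦ.relation hg hk hp hz (by rwa [h1])
  simpa only [h1, h2] using this

/-- The differential of a point transformation is injective. -/
theorem IsPointTransformation.eq_zero_of_pd {Φ : OpenPartialHomeomorph Total Total}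
    (hΦ : IsPointTransformation Φ) {p : Total} (hp : p ∈ Φ.source) {v : Total}
    (hT : pd v (cT Φ) p = 0) (hX : pd v (cX Φ) p = 0) (hY : pd v (cY Φ) p = 0)
    (hU : pd v (cU Φ) p = 0) : v = 0 := by
  have h1 : DifferentiableAt ℝ Φ p :=
    (hΦ.1.contDiffAt (Φ.open_source.mem_nhds hp)).differentiableAt (by simp)
  have h2 : DifferentiableAt ℝ Φ.symm (Φ p) :=
    (hΦ.2.contDiffAt (Φ.open_target.mem_nhds (Φ.map_source hp))).differentiableAt (by simp)
  have h3 : fderiv ℝ Φ p v = 0 := by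
    have e : fderiv ℝ Φ p v = (pd v (cT Φ) p, pd v (cX Φ) p, pd v (cY Φ) p, pd v (cU Φ) p) := by
      ext
      · exact congrArg (fun L => L v) h1.hasFDerivAt.fst.fderiv.symm
      · exact congrArg (fun L => L v) h1.hasFDerivAt.snd.fst.fderiv.symm
      · exact congrArg (fun L => L v) h1.hasFDerivAt.snd.snd.fst.fderiv.symm
      · exact congrArg (fun L => L v) h1.hasFDerivAt.snd.snd.snd.fderiv.symm
    rw [e, hT, hX, hY, hU]; rfl
  have h4 : HasFDerivAt (Φ.symm ∘ Φ) ((fderiv ℝ Φ.symm (Φ p)).comp (fderiv ℝ Φ p)) p :=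
    h2.hasFDerivAt.comp p h1.hasFDerivAt
  have h5 : HasFDerivAt (Φ.symm ∘ Φ) (ContinuousLinearMap.id ℝ Total) p := by
    refine (hasFDerivAt_id p).congr_of_eventuallyEq ?_
    filter_upwards [Φ.open_source.mem_nhds hp] with q hq
    exact Φ.left_inv hq
  have h6 := congrArg (fun L : Total →L[ℝ] Total => L v) (h4.unique h5)
  simpa [h3] using h6.symm

/-- Two nonzero affine functions of `(τ, a, η)` have a common nonzero. -/
theorem exists_affine_ne_zero {m₁ m₂ m₃ m₄ n₁ n₂ n₃ n₄ : ℝ}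
    (hm : ¬(m₁ = 0 ∧ m₂ = 0 ∧ m₃ = 0 ∧ m₄ = 0)) (hn : ¬(n₁ = 0 ∧ n₂ = 0 ∧ n₃ = 0 ∧ n₄ = 0)) :
    ∃ τ a η : ℝ, τ * m₁ + a * m₂ + η * m₃ - m₄ ≠ 0 ∧ τ * n₁ + a * n₂ + η * n₃ - n₄ ≠ 0 := by
  -- Restricted to the curve `(s, s², s³)`, a nonzero affine function becomes a nonzero polynomial
  -- in `s`; the product of two such polynomials has a non-root.
  open Polynomial in
  let P : ℝ → ℝ → ℝ → ℝ → ℝ[X] := fun m₁ m₂ m₃ m₄ => C m₁ * X + C m₂ * X ^ 2 + C m₃ * X ^ 3 - C m₄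
  have hP : ∀ m₁ m₂ m₃ m₄ : ℝ, ¬(m₁ = 0 ∧ m₂ = 0 ∧ m₃ = 0 ∧ m₄ = 0) → P m₁ m₂ m₃ m₄ ≠ 0 := by
    intro m₁ m₂ m₃ m₄ h h0
    apply h
    have hc : ∀ n, (P m₁ m₂ m₃ m₄).coeff n = 0 := fun n => by rw [h0]; simp
    have c0 := hc 0
    have c1 := hc 1
    have c2 := hc 2
    have c3 := hc 3
    simp [P, Polynomial.coeff_X, Polynomial.coeff_X_pow, Polynomial.coeff_C] at c0 c1 c2 c3
    exact ⟨c1, c2, c3, c0⟩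
  have hne : P m₁ m₂ m₃ m₄ * P n₁ n₂ n₃ n₄ ≠ 0 := mul_ne_zero (hP _ _ _ _ hm) (hP _ _ _ _ hn)
  obtain ⟨s, hs⟩ : ∃ s, (P m₁ m₂ m₃ m₄ * P n₁ n₂ n₃ n₄).eval s ≠ 0 := by
    by_contra! h
    exact hne (Polynomial.funext (by simpa using h))
  rw [Polynomial.eval_mul] at hs
  refine ⟨s, s ^ 2, s ^ 3, ?_, ?_⟩
  · intro h
    apply left_ne_zero_of_mul hs
    simp [P]; linarith
  · intro h
    apply right_ne_zero_of_mul hs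
    simp [P]; linarith

/-- If `v_x F_u - v_u F_x` vanishes for all admissible first derivatives, then
`v_x = v_u = 0`. -/
theorem IsPointTransformation.eq_zero_of_jetOne {Φ : OpenPartialHomeomorph Total Total}
    (hΦ : IsPointTransformation Φ) {p : Total} (hp : p ∈ Φ.source) {α β : ℝ}
    (h : ∀ τ a η, jetOne Φ p τ a η eu ≠ 0 →
      α * jetOne Φ p τ a η eu - β * jetOne Φ p τ a η ex = 0) : α = 0 ∧ β = 0 := by
  by_contra hne
  have key : ∀ v : Total, v ≠ 0 → ¬(pd v (cT Φ) p = 0 ∧ pd v (cX Φ) p = 0 ∧ pd v (cY Φ) p = 0 ∧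
      pd v (cU Φ) p = 0) := fun v hv ⟨h1, h2, h3, h4⟩ =>
    hv (hΦ.eq_zero_of_pd hp h1 h2 h3 h4)
  -- The expression `α F_u - β F_x` is the derivative of `F` along `(0, -β, 0, α)`. For a nonzero
  -- vector, injectivity of the differential makes it a nonzero affine function of `(τ, a, η)`.
  have hw : ((0, -β, 0, α) : Total) ≠ 0 := by
    intro h0
    simp only [Prod.mk_eq_zero, neg_eq_zero] at h0
    exact hne ⟨h0.2.2.2, h0.2.1⟩
  have hu : (eu : Total) ≠ 0 := by simp [eu]
  obtain ⟨τ, a, η, h1, h2⟩ := exists_affine_ne_zero (key _ hu) (key _ hw)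
  apply h2
  have := h τ a η h1
  simp only [jetOne] at this
  rw [pd_total (cT Φ) (0, -β, 0, α), pd_total (cX Φ) (0, -β, 0, α),
    pd_total (cY Φ) (0, -β, 0, α), pd_total (cU Φ) (0, -β, 0, α)]
  simp only
  linear_combination this

/-- The parameter `l = g_tt` enters a second derivative of `F` only through `l T_v T_w`. Its
coefficient in the relation is therefore `x² (T_x F_u - T_u F_x)²`, which must vanish for all first
derivatives of `g`. -/
theorem IsPointSymmetry.cT_ex_eu {Φ : OpenPartialHomeomorph Total Total}
    (hΦ : IsPointSymmetry Φ) {p : Total} (hp : p ∈ Φ.source) (hx : p.2.1 ≠ 0) (hX : cX Φ p ≠ 0) :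
    pd ex (cT Φ) p = 0 ∧ pd eu (cT Φ) p = 0 := by
  apply hΦ.1.eq_zero_of_jetOne hp
  intro τ a η hu
  have h0 := hΦ.jet_relation hp hX τ a η 0 0 hu
  have h1 := hΦ.jet_relation hp hX τ a η 1 0 hu
  set A := jetOne Φ p τ a η eu
  set B := jetOne Φ p τ a η ex
  simp only [jetTwo] at h0 h1
  have : p.2.1 ^ 2 * (pd ex (cT Φ) p * A - pd eu (cT Φ) p * B) ^ 2 = 0 := by
    linear_combination h0 - h1
  simpa [hx] using this

/-- The same argument with `m = g_yy`: the cross terms from `g_ty = -X m` drop out because `T_x =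
T_u = 0`, which leaves the square of `Y_x F_u - Y_u F_x`. -/
theorem IsPointSymmetry.cY_ex_eu {Φ : OpenPartialHomeomorph Total Total}
    (hΦ : IsPointSymmetry Φ) {p : Total} (hp : p ∈ Φ.source) (hx : p.2.1 ≠ 0) (hX : cX Φ p ≠ 0) :
    pd ex (cY Φ) p = 0 ∧ pd eu (cY Φ) p = 0 := by
  apply hΦ.1.eq_zero_of_jetOne hp
  intro τ a η hu
  have h0 := hΦ.jet_relation hp hX τ a η 0 0 hu
  have h1 := hΦ.jet_relation hp hX τ a η 0 1 hu
  obtain ⟨e1, e2⟩ := hΦ.cT_ex_eu hp hx hX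
  set A := jetOne Φ p τ a η eu
  set B := jetOne Φ p τ a η ex
  simp only [jetTwo, e1, e2] at h0 h1
  have : p.2.1 ^ 2 * (pd ex (cY Φ) p * A - pd eu (cY Φ) p * B) ^ 2 = 0 := by
    linear_combination h0 - h1
  simpa [hx] using this

/-! ### The regular set and its density -/

/-- The points of the domain at which the equation is nondegenerate both at the point and at its
image. -/
def regularSet (Φ : OpenPartialHomeomorph Total Total) : Set Total :=
  {p | p ∈ Φ.source ∧ p.2.1 ≠ 0 ∧ cX Φ p ≠ 0}

theorem isOpen_regularSet (Φ : OpenPartialHomeomorph Total Total) :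
    IsOpen (regularSet Φ) := by
  have h1 : IsOpen (Φ.source ∩ cX Φ ⁻¹' {0}ᶜ) :=
    ((continuous_fst.comp continuous_snd).comp_continuousOn Φ.continuousOn).isOpen_inter_preimage
      Φ.open_source isOpen_compl_singleton
  have h2 : IsOpen {p : Total | p.2.1 ≠ 0} := isOpen_ne_fun (by fun_prop) (by fun_prop)
  convert h1.inter h2 using 1
  ext p
  simp only [regularSet, mem_ofPred_eq, mem_inter_iff, mem_preimage, mem_compl_iff,
    mem_singleton_iff]
  tauto

theorem dense_x_ne_zero : Dense {p : Total | p.2.1 ≠ 0} := by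
  have h : Dense {x : ℝ | x ≠ 0} := dense_compl_singleton 0
  exact h.preimage (f := fun p : Total => p.2.1) (isOpenMap_fst.comp isOpenMap_snd)

theorem subset_closure_x_ne_zero {U : Set Total} (hU : IsOpen U) :
    U ⊆ closure (U ∩ {p | p.2.1 ≠ 0}) := dense_x_ne_zero.open_subset_closure_inter hU

/-- A nonempty open piece of the domain contains an open piece with `x ≠ 0`; its image is open,
hence contains a point with nonzero second coordinate. -/
theorem source_subset_closure_regularSet (Φ : OpenPartialHomeomorph Total Total) :
    Φ.source ⊆ closure (regularSet Φ) := by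
  intro p hp
  rw [mem_closure_iff]
  intro O hO hpO
  obtain ⟨q, hq⟩ := dense_x_ne_zero.inter_open_nonempty (Φ.source ∩ O) (Φ.open_source.inter hO)
    ⟨p, hp, hpO⟩
  have hN : IsOpen ((Φ.source ∩ O) ∩ {p : Total | p.2.1 ≠ 0}) :=
    (Φ.open_source.inter hO).inter (isOpen_ne_fun (by fun_prop) (by fun_prop))
  have himg := Φ.isOpen_image_of_subset_source hN fun q hq => hq.1.1
  obtain ⟨_, ⟨r, hr, rfl⟩, hrX⟩ := dense_x_ne_zero.inter_open_nonempty _ himg ⟨_, q, hq, rfl⟩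
  exact ⟨r, hr.1.2, hr.1.1, hr.2, hrX⟩

/-- Continuous functions that agree on the regular set agree on the domain. -/
theorem eq_of_regular {Φ : OpenPartialHomeomorph Total Total} {f g : Total → ℝ}
    (hf : ContDiffOn ℝ ∞ f Φ.source) (hg : ContDiffOn ℝ ∞ g Φ.source)
    (h : ∀ p ∈ regularSet Φ, f p = g p) {p : Total} (hp : p ∈ Φ.source) : f p = g p :=
  EqOn.of_subset_closure h hf.continuousOn hg.continuousOn (fun _ hq => hq.1)
    (source_subset_closure_regularSet Φ) hp

/-! ### Algebra of the splitting -/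

/-- First stage of splitting the determining relation with respect to the first derivatives. -/
theorem split_first {x X α β γ δ Xx Xu Ux Uu Xxx Xxu Xuu Uxx Uxu Uuu : ℝ} (hx : x ≠ 0)
    (hX : X ≠ 0) (hJ : Xx * Uu - Xu * Ux ≠ 0)
    (h : ∀ τ a η, a * Xu - Uu ≠ 0 →
      (τ * α + a * β + η * γ - δ) * (a * Xu - Uu) ^ 2 =
        x ^ 2 * (((τ + X * η) / X ^ 2 * (Xx * Xx) + a * Xxx - Uxx) * (a * Xu - Uu) ^ 2
        - 2 * ((τ + X * η) / X ^ 2 * (Xx * Xu) + a * Xxu - Uxu) * (a * Xx - Ux) * (a * Xu - Uu)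
        + ((τ + X * η) / X ^ 2 * (Xu * Xu) + a * Xuu - Uuu) * (a * Xx - Ux) ^ 2)) :
    Xu = 0 := by
  by_contra hXu
  -- The coefficient of `τ`. In the right-hand side the quadratic form collapses to the squared
  -- Jacobian of `(X, U)` in `(x, u)`, which does not involve `a`. If `X_u ≠ 0`, then `f = a X_u -
  -- U_u` takes every nonzero value, and `f = 1, 2` contradict each other.
  have key : ∀ f : ℝ, f ≠ 0 → α * f ^ 2 = x ^ 2 * (1 / X ^ 2) * (Xx * Uu - Xu * Ux) ^ 2 := by
    intro f hf
    obtain ⟨a, ha⟩ : ∃ a, a * Xu - Uu = f := ⟨(f + Uu) / Xu, by field_simp; ring⟩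
    have h1 := h 1 a 0 (by rwa [ha])
    have h0 := h 0 a 0 (by rwa [ha])
    have e : (1 + X * 0) / X ^ 2 = 1 / X ^ 2 := by ring
    have e' : (0 + X * 0) / X ^ 2 = 0 := by ring
    rw [e] at h1
    rw [e'] at h0
    rw [← ha]
    linear_combination h1 - h0
  have k1 := key 1 one_ne_zero
  have k2 := key 2 two_ne_zero
  have : x ^ 2 * (1 / X ^ 2) * (Xx * Uu - Xu * Ux) ^ 2 = 0 := by linarith
  have hp : x ^ 2 * (1 / X ^ 2) * (Xx * Uu - Xu * Ux) ^ 2 ≠ 0 := by positivity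
  exact hp this

/-- Second stage of the splitting. -/
theorem split_second {x X α β γ δ Xx Ux Uu Xxx Uxx Uxu Uuu : ℝ} (hx : x ≠ 0)
    (hX : X ≠ 0) (hXx : Xx ≠ 0) (hUu : Uu ≠ 0)
    (h : ∀ τ a η, (τ * α + a * β + η * γ - δ) * Uu ^ 2 =
        x ^ 2 * (((τ + X * η) / X ^ 2 * (Xx * Xx) + a * Xxx - Uxx) * Uu ^ 2
        - 2 * Uxu * (a * Xx - Ux) * Uu - Uuu * (a * Xx - Ux) ^ 2)) :
    α * X ^ 2 = x ^ 2 * Xx ^ 2 ∧ γ * X = x ^ 2 * Xx ^ 2 ∧ Uuu = 0 ∧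
      β * Uu = x ^ 2 * (Xxx * Uu - 2 * Uxu * Xx) ∧
      δ * Uu = x ^ 2 * (Uxx * Uu - 2 * Uxu * Ux) := by
  have h000 := h 0 0 0
  have h100 := h 1 0 0
  have h001 := h 0 0 1
  have h010 := h 0 1 0
  have h0m0 := h 0 (-1) 0
  have e0 : (0 + X * 0) / X ^ 2 = 0 := by ring
  rw [e0] at h000 h010 h0m0
  -- The even part in `a` isolates the coefficient of `a²`.
  have hUuu : Uuu = 0 := by
    have : x ^ 2 * Xx ^ 2 * Uuu = 0 := by
      linear_combination (h010 + h0m0) / 2 - h000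
    simpa [hx, hXx] using this
  subst hUuu
  refine ⟨?_, ?_, rfl, ?_, ?_⟩
  · have e1 : (1 + X * 0) / X ^ 2 * X ^ 2 = 1 := by field_simp; ring
    have : Uu ^ 2 * (α * X ^ 2 - x ^ 2 * Xx ^ 2) = 0 := by
      linear_combination X ^ 2 * (h100 - h000) + x ^ 2 * Xx ^ 2 * Uu ^ 2 * e1
    have := (mul_eq_zero.1 this).resolve_left (by positivity)
    linarith
  · have e1 : (0 + X * 1) / X ^ 2 * X = 1 := by field_simp; ring
    have : Uu ^ 2 * (γ * X - x ^ 2 * Xx ^ 2) = 0 := by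
      linear_combination X * (h001 - h000) + x ^ 2 * Xx ^ 2 * Uu ^ 2 * e1
    have := (mul_eq_zero.1 this).resolve_left (by positivity)
    linarith
  · apply mul_left_cancel₀ hUu
    linear_combination (h010 - h0m0) / 2
  · apply mul_left_cancel₀ hUu
    linear_combination - h000

/-- Agreement at infinitely many points makes this an identity of polynomials. If `B ≠ 0`, the root
of `A + sB` forces `A = 0`, and at `s = -B` the left side is positive while the right side is
nonpositive. With `B = 0`, the value at `s = 0` gives `C = 0`, and the value at `s = 1` gives `A =
1`. -/
theorem quintic_coeffs {A B C D : ℝ} {S : Set ℝ} (hS : S.Infinite) (hW : A * D - B * C ≠ 0)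
    (h : ∀ s ∈ S, s ^ 2 * (A * D - B * C) ^ 2 = (C + s * D) ^ 2 * (A + s * B) ^ 3) :
    A = 1 ∧ B = 0 ∧ C = 0 := by
  have hall : ∀ s : ℝ, s ^ 2 * (A * D - B * C) ^ 2 = (C + s * D) ^ 2 * (A + s * B) ^ 3 := by
    have heq : (Polynomial.X ^ 2 * Polynomial.C ((A * D - B * C) ^ 2) : Polynomial ℝ)
        = (Polynomial.C C + Polynomial.X * Polynomial.C D) ^ 2 *
          (Polynomial.C A + Polynomial.X * Polynomial.C B) ^ 3 := by
      apply Polynomial.eq_of_infinite_eval_eq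
      refine hS.mono fun s hs => ?_
      have e := h s hs
      simp
      linear_combination e
    intro s
    have e := congrArg (Polynomial.eval s) heq
    simp at e
    linear_combination e
  have hB : B = 0 := by
    by_contra hB
    have h1 := hall (-A / B)
    have e : A + -A / B * B = 0 := by field_simp; ring
    rw [e] at h1
    have hA : A = 0 := by
      have : (-A / B) ^ 2 * (A * D - B * C) ^ 2 = 0 := by rw [h1]; ring
      simpa [hW, hB] using this
    subst hA
    have h2 := hall (-B)
    have h3 : 0 < (-B) ^ 2 * (0 * D - B * C) ^ 2 :=
      mul_pos (sq_pos_iff.2 (neg_ne_zero.2 hB)) (sq_pos_iff.2 hW)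
    have h4 : 0 ≤ (C - B * D) ^ 2 * B ^ 6 := by positivity
    nlinarith
  subst hB
  have hA : A ≠ 0 := by rintro rfl; simp at hW
  have hD : D ≠ 0 := by rintro rfl; simp at hW
  have hC : C = 0 := by simpa [hA] using (hall 0).symm
  subst hC
  have h1 := hall 1
  have : A ^ 2 * D ^ 2 * (A - 1) = 0 := by linear_combination -h1
  refine ⟨?_, rfl, rfl⟩
  have := (mul_eq_zero.1 this).resolve_left (by positivity)
  linarith

theorem const_along_x {f : Total → ℝ} {O : Set Total} (hO : IsOpen O)
    (hf : ContDiffOn ℝ ∞ f O) (h : ∀ q ∈ O, pd ex f q = 0) {p : Total} {r : ℝ}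
    (hr : Metric.ball p r ⊆ O) {s : ℝ} (hs : s ∈ Metric.ball p.2.1 r) :
    f (p.1, s, p.2.2.1, p.2.2.2) = f p := by
  have hmem : ∀ s ∈ Metric.ball p.2.1 r, ((p.1, s, p.2.2.1, p.2.2.2) : Total) ∈ O := by
    intro s hs
    apply hr
    have h0 : 0 < r := Metric.pos_of_mem_ball hs
    simpa [Metric.mem_ball, Prod.dist_eq, h0] using hs
  have hd : ∀ s ∈ Metric.ball p.2.1 r,
      HasDerivAt (fun s => f (p.1, s, p.2.2.1, p.2.2.2)) 0 s := by
    intro s hs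
    have h1 := deriv_line (differentiableAt_of_smooth hO hf (hmem s hs))
      (hasDerivAt_line_ex p.1 s p.2.2.1 p.2.2.2) rfl
    rwa [h _ (hmem s hs)] at h1
  exact Metric.isOpen_ball.is_const_of_deriv_eq_zero (convex_ball _ _).isPreconnected
    (fun s hs => (hd s hs).differentiableAt.differentiableWithinAt)
    (fun s hs => (hd s hs).deriv) hs (Metric.mem_ball_self (Metric.pos_of_mem_ball hs))

/-! ### Determining equations on the regular set -/

section Regular

variable {Φ : OpenPartialHomeomorph Total Total} {p : Total}

/-- Since `T` and `Y` do not depend on `x, u`, the injective differential maps the `(x, u)`-plane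
into the `(X, U)`-plane. -/
theorem IsPointSymmetry.jacobian_ne_zero (hΦ : IsPointSymmetry Φ) (hp : p ∈ regularSet Φ) :
    pd ex (cX Φ) p * pd eu (cU Φ) p - pd eu (cX Φ) p * pd ex (cU Φ) p ≠ 0 := by
  intro hJ
  obtain ⟨t1, t2⟩ := hΦ.cT_ex_eu hp.1 hp.2.1 hp.2.2
  obtain ⟨y1, y2⟩ := hΦ.cY_ex_eu hp.1 hp.2.1 hp.2.2
  have key : ∀ α β : ℝ, α * pd ex (cX Φ) p + β * pd eu (cX Φ) p = 0 →
      α * pd ex (cU Φ) p + β * pd eu (cU Φ) p = 0 → α = 0 ∧ β = 0 := by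
    intro α β h1 h2
    have h0 : ((0, α, 0, β) : Total) = 0 := by
      apply hΦ.1.eq_zero_of_pd hp.1 <;> rw [pd_total] <;> simp only [zero_mul, zero_add, add_zero]
      · simp [t1, t2]
      · exact h1
      · simp [y1, y2]
      · exact h2
    simp only [Prod.mk_eq_zero] at h0
    exact ⟨h0.2.1, h0.2.2.2⟩
  -- If the determinant vanishes, the vectors `(-X_u, X_x)` and `(-U_u, U_x)` lie in the kernel,
  -- hence are zero; but then `(0, 1)` lies in the kernel too.
  obtain ⟨a1, a2⟩ := key (-pd eu (cX Φ) p) (pd ex (cX Φ) p) (by ring) (by linarith)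
  obtain ⟨b1, b2⟩ := key (-pd eu (cU Φ) p) (pd ex (cU Φ) p) (by linarith) (by ring)
  have a1' : pd eu (cX Φ) p = 0 := by linarith
  have b1' : pd eu (cU Φ) p = 0 := by linarith
  exact one_ne_zero (key 0 1 (by simp [a1']) (by simp [b1'])).2

theorem IsPointSymmetry.cX_eu (hΦ : IsPointSymmetry Φ)
    (hp : p ∈ regularSet Φ) : pd eu (cX Φ) p = 0 := by
  have hO := isOpen_regularSet Φ
  have tz : ∀ v w : Total, (w = ex ∨ w = eu) → pd v (pd w (cT Φ)) p = 0 := by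
    rintro v w (rfl | rfl) <;> refine pd_eq_zero_of_eqOn hO (c := 0) (fun q hq => ?_) hp v
    exacts [(hΦ.cT_ex_eu hq.1 hq.2.1 hq.2.2).1, (hΦ.cT_ex_eu hq.1 hq.2.1 hq.2.2).2]
  have yz : ∀ v w : Total, (w = ex ∨ w = eu) → pd v (pd w (cY Φ)) p = 0 := by
    rintro v w (rfl | rfl) <;> refine pd_eq_zero_of_eqOn hO (c := 0) (fun q hq => ?_) hp v
    exacts [(hΦ.cY_ex_eu hq.1 hq.2.1 hq.2.2).1, (hΦ.cY_ex_eu hq.1 hq.2.1 hq.2.2).2]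
  obtain ⟨t1, t2⟩ := hΦ.cT_ex_eu hp.1 hp.2.1 hp.2.2
  obtain ⟨y1, y2⟩ := hΦ.cY_ex_eu hp.1 hp.2.1 hp.2.2
  refine split_first (x := p.2.1) (X := cX Φ p) (α := pd et (cT Φ) p + p.2.1 * pd ey (cT Φ) p)
    (β := pd et (cX Φ) p + p.2.1 * pd ey (cX Φ) p) (γ := pd et (cY Φ) p + p.2.1 * pd ey (cY Φ) p)
    (δ := pd et (cU Φ) p + p.2.1 * pd ey (cU Φ) p) (Xxx := pd ex (pd ex (cX Φ)) p)
    (Xxu := pd ex (pd eu (cX Φ)) p) (Xuu := pd eu (pd eu (cX Φ)) p)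
    (Uxx := pd ex (pd ex (cU Φ)) p) (Uxu := pd ex (pd eu (cU Φ)) p)
    (Uuu := pd eu (pd eu (cU Φ)) p) hp.2.1 hp.2.2 (hΦ.jacobian_ne_zero hp) ?_
  intro τ a η hu
  have e1 : jetOne Φ p τ a η eu = a * pd eu (cX Φ) p - pd eu (cU Φ) p := by
    simp [jetOne, t2, y2]
  have e2 : jetOne Φ p τ a η ex = a * pd ex (cX Φ) p - pd ex (cU Φ) p := by
    simp [jetOne, t1, y1]
  have h := hΦ.jet_relation hp.1 hp.2.2 τ a η 0 0 (by rwa [e1])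
  rw [e1, e2] at h
  simp only [jetOne, jetTwo, tz _ ex (.inl rfl), tz _ eu (.inr rfl), yz _ ex (.inl rfl),
    yz _ eu (.inr rfl)] at h
  linear_combination h

theorem IsPointSymmetry.cX_ex_ne_zero (hΦ : IsPointSymmetry Φ)
    (hp : p ∈ regularSet Φ) : pd ex (cX Φ) p ≠ 0 := by
  have := hΦ.jacobian_ne_zero hp
  rw [hΦ.cX_eu hp] at this
  intro h
  simp [h] at this

/-- With `T_x = T_u = Y_x = Y_u = X_u = 0` one has `F_u = -U_u`, which is never zero. The relation
is then polynomial in `τ, a, η` without side condition, and these are its coefficients. -/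
theorem IsPointSymmetry.regular_relations (hΦ : IsPointSymmetry Φ) (hp : p ∈ regularSet Φ) :
    (pd et (cT Φ) p + p.2.1 * pd ey (cT Φ) p) * cX Φ p ^ 2 = p.2.1 ^ 2 * pd ex (cX Φ) p ^ 2 ∧
    (pd et (cY Φ) p + p.2.1 * pd ey (cY Φ) p) * cX Φ p = p.2.1 ^ 2 * pd ex (cX Φ) p ^ 2 ∧
    pd eu (pd eu (cU Φ)) p = 0 ∧
    (pd et (cX Φ) p + p.2.1 * pd ey (cX Φ) p) * pd eu (cU Φ) p =
      p.2.1 ^ 2 * (pd ex (pd ex (cX Φ)) p * pd eu (cU Φ) p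
        - 2 * pd ex (pd eu (cU Φ)) p * pd ex (cX Φ) p) ∧
    (pd et (cU Φ) p + p.2.1 * pd ey (cU Φ) p) * pd eu (cU Φ) p =
      p.2.1 ^ 2 * (pd ex (pd ex (cU Φ)) p * pd eu (cU Φ) p
        - 2 * pd ex (pd eu (cU Φ)) p * pd ex (cU Φ) p) := by
  have hO := isOpen_regularSet Φ
  have tz : ∀ v w : Total, (w = ex ∨ w = eu) → pd v (pd w (cT Φ)) p = 0 := by
    rintro v w (rfl | rfl) <;> refine pd_eq_zero_of_eqOn hO (c := 0) (fun q hq => ?_) hp v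
    exacts [(hΦ.cT_ex_eu hq.1 hq.2.1 hq.2.2).1, (hΦ.cT_ex_eu hq.1 hq.2.1 hq.2.2).2]
  have yz : ∀ v w : Total, (w = ex ∨ w = eu) → pd v (pd w (cY Φ)) p = 0 := by
    rintro v w (rfl | rfl) <;> refine pd_eq_zero_of_eqOn hO (c := 0) (fun q hq => ?_) hp v
    exacts [(hΦ.cY_ex_eu hq.1 hq.2.1 hq.2.2).1, (hΦ.cY_ex_eu hq.1 hq.2.1 hq.2.2).2]
  have xz : ∀ v : Total, pd v (pd eu (cX Φ)) p = 0 := fun v =>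
    pd_eq_zero_of_eqOn hO (c := 0) (fun q hq => hΦ.cX_eu hq) hp v
  obtain ⟨t1, t2⟩ := hΦ.cT_ex_eu hp.1 hp.2.1 hp.2.2
  obtain ⟨y1, y2⟩ := hΦ.cY_ex_eu hp.1 hp.2.1 hp.2.2
  have x2 := hΦ.cX_eu hp
  have hJ := hΦ.jacobian_ne_zero hp
  rw [x2, zero_mul, sub_zero] at hJ
  refine split_second hp.2.1 hp.2.2 (left_ne_zero_of_mul hJ) (right_ne_zero_of_mul hJ) ?_
  intro τ a η
  have e1 : jetOne Φ p τ a η eu = - pd eu (cU Φ) p := by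
    simp [jetOne, t2, y2, x2]
  have e2 : jetOne Φ p τ a η ex = a * pd ex (cX Φ) p - pd ex (cU Φ) p := by
    simp [jetOne, t1, y1]
  have h := hΦ.jet_relation hp.1 hp.2.2 τ a η 0 0
    (by rw [e1]; exact neg_ne_zero.2 (right_ne_zero_of_mul hJ))
  rw [e1, e2] at h
  simp only [jetOne, jetTwo, tz _ ex (.inl rfl), tz _ eu (.inr rfl), yz _ ex (.inl rfl),
    yz _ eu (.inr rfl), xz, x2] at h
  linear_combination h

/-- Put `q = T_t + x T_y` and `W = T_t Y_y - T_y Y_t`. The first two regular relations give `X q =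
Y_t + x Y_y`, whose `x`-derivative gives `X_x q² = W`. Substituting both into `q X² = x² X_x²`
eliminates `X`. The coefficients left over do not depend on `x`, so along a segment in the
`x`-direction the result is a polynomial identity in `x`. -/
theorem IsPointSymmetry.regular_base (hΦ : IsPointSymmetry Φ) (hp : p ∈ regularSet Φ) :
    pd et (cT Φ) p = 1 ∧ pd ey (cT Φ) p = 0 ∧ pd et (cY Φ) p = 0 ∧
      cX Φ p = p.2.1 * pd ey (cY Φ) p := by
  have hO := isOpen_regularSet Φ
  have hsub : regularSet Φ ⊆ Φ.source := fun q hq => hq.1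
  have sT := hΦ.1.smooth_cT.mono hsub
  have sY := hΦ.1.smooth_cY.mono hsub
  have sX := hΦ.1.smooth_cX.mono hsub
  have rel : ∀ q ∈ regularSet Φ, cX Φ q * (pd et (cT Φ) q + q.2.1 * pd ey (cT Φ) q) =
      pd et (cY Φ) q + q.2.1 * pd ey (cY Φ) q := by
    intro q hq
    obtain ⟨h1, h2, -⟩ := hΦ.regular_relations hq
    apply mul_left_cancel₀ hq.2.2
    linear_combination h1 - h2
  have tz : ∀ v : Total, ∀ q ∈ regularSet Φ, pd ex (pd v (cT Φ)) q = 0 := by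
    intro v q hq
    rw [pd_comm hO sT hq]
    exact pd_eq_zero_of_eqOn hO (c := 0) (fun q hq => (hΦ.cT_ex_eu hq.1 hq.2.1 hq.2.2).1) hq v
  have yz : ∀ v : Total, ∀ q ∈ regularSet Φ, pd ex (pd v (cY Φ)) q = 0 := by
    intro v q hq
    rw [pd_comm hO sY hq]
    exact pd_eq_zero_of_eqOn hO (c := 0) (fun q hq => (hΦ.cY_ex_eu hq.1 hq.2.1 hq.2.2).1) hq v
  have rel' : ∀ q ∈ regularSet Φ,
      pd ex (cX Φ) q * (pd et (cT Φ) q + q.2.1 * pd ey (cT Φ) q) + cX Φ q * pd ey (cT Φ) q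
        = pd ey (cY Φ) q := by
    intro q hq
    have hd : ∀ f : Total → ℝ, ContDiffOn ℝ ∞ f (regularSet Φ) → ∀ v,
        DifferentiableAt ℝ (pd v f) q := fun f hf v =>
      differentiableAt_of_smooth hO (smooth_pd hO hf v) hq
    have hx : DifferentiableAt ℝ (fun q : Total => q.2.1) q := by fun_prop
    have h := pd_congr hO rel hq ex
    rw [pd_mul (differentiableAt_of_smooth hO sX hq)
        ((hd _ sT et).fun_add (hx.fun_mul (hd _ sT ey))),
      pd_add (hd _ sT et) (hx.fun_mul (hd _ sT ey)), pd_mul hx (hd _ sT ey),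
      pd_add (hd _ sY et) (hx.fun_mul (hd _ sY ey)), pd_mul hx (hd _ sY ey),
      tz et q hq, tz ey q hq, yz et q hq, yz ey q hq, pd_coord_x] at h
    simp only at h
    linear_combination h
  have quint : ∀ q ∈ regularSet Φ, q.2.1 ^ 2 * (pd et (cT Φ) q * pd ey (cY Φ) q
      - pd ey (cT Φ) q * pd et (cY Φ) q) ^ 2 = (pd et (cY Φ) q + q.2.1 * pd ey (cY Φ) q) ^ 2 *
        (pd et (cT Φ) q + q.2.1 * pd ey (cT Φ) q) ^ 3 := by
    intro q hq
    have hr := rel q hq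
    have hr' := rel' q hq
    obtain ⟨h1, -⟩ := hΦ.regular_relations hq
    have hW : pd et (cT Φ) q * pd ey (cY Φ) q - pd ey (cT Φ) q * pd et (cY Φ) q
        = pd ex (cX Φ) q * (pd et (cT Φ) q + q.2.1 * pd ey (cT Φ) q) ^ 2 := by
      linear_combination (-(pd et (cT Φ) q + q.2.1 * pd ey (cT Φ) q)) * hr' + pd ey (cT Φ) q * hr
    rw [hW, ← hr]
    linear_combination (-(pd et (cT Φ) q + q.2.1 * pd ey (cT Φ) q) ^ 4) * h1
  -- Nonzero because `q X² = x² X_x²` with `x ≠ 0` and `X_x ≠ 0` forces `q ≠ 0`.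
  have hW : pd et (cT Φ) p * pd ey (cY Φ) p - pd ey (cT Φ) p * pd et (cY Φ) p ≠ 0 := by
    have hr := rel p hp
    have hr' := rel' p hp
    obtain ⟨h1, -⟩ := hΦ.regular_relations hp
    have hXx := hΦ.cX_ex_ne_zero hp
    have hx := hp.2.1
    have hq : pd et (cT Φ) p + p.2.1 * pd ey (cT Φ) p ≠ 0 := by
      intro h0
      rw [h0, zero_mul] at h1
      exact (by positivity : p.2.1 ^ 2 * pd ex (cX Φ) p ^ 2 ≠ 0) h1.symm
    have hW : pd et (cT Φ) p * pd ey (cY Φ) p - pd ey (cT Φ) p * pd et (cY Φ) p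
        = pd ex (cX Φ) p * (pd et (cT Φ) p + p.2.1 * pd ey (cT Φ) p) ^ 2 := by
      linear_combination (-(pd et (cT Φ) p + p.2.1 * pd ey (cT Φ) p)) * hr' + pd ey (cT Φ) p * hr
    rw [hW]
    exact mul_ne_zero hXx (pow_ne_zero 2 hq)
  obtain ⟨r, hr0, hr⟩ := Metric.isOpen_iff.1 hO p hp
  have hmem : ∀ s ∈ Metric.ball p.2.1 r,
      ((p.1, s, p.2.2.1, p.2.2.2) : Total) ∈ regularSet Φ := by
    intro s hs
    apply hr
    simpa [Metric.mem_ball, Prod.dist_eq, hr0] using hs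
  obtain ⟨hA, hB, hC⟩ := quintic_coeffs (S := Metric.ball p.2.1 r)
    (infinite_of_mem_nhds p.2.1 (Metric.ball_mem_nhds _ hr0)) hW (by
      intro s hs
      have h := quint _ (hmem s hs)
      rw [const_along_x hO (smooth_pd hO sT et) (tz et) hr hs,
        const_along_x hO (smooth_pd hO sT ey) (tz ey) hr hs,
        const_along_x hO (smooth_pd hO sY et) (yz et) hr hs,
        const_along_x hO (smooth_pd hO sY ey) (yz ey) hr hs] at h
      exact h)
  refine ⟨hA, hB, hC, ?_⟩
  have := rel p hp
  rw [hA, hB, hC] at this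
  linear_combination this

end Regular

theorem exists_const_of_pd {f : Total → ℝ} {U : Set Total} (hU : IsOpen U)
    (hc : IsPreconnected U) (hf : ContDiffOn ℝ ∞ f U) (ht : ∀ p ∈ U, pd et f p = 0)
    (hx : ∀ p ∈ U, pd ex f p = 0) (hy : ∀ p ∈ U, pd ey f p = 0) (hu : ∀ p ∈ U, pd eu f p = 0) :
    ∃ c, ∀ p ∈ U, f p = c := by
  refine hU.exists_is_const_of_fderiv_eq_zero hc (hf.differentiableOn (by simp)) ?_
  intro p hp
  refine ContinuousLinearMap.ext fun v => ?_
  change pd v f p = 0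
  rw [pd_total, ht p hp, hx p hp, hy p hp, hu p hp]
  ring

/-! ### Extension to the whole domain by density -/

section Global

variable {Φ : OpenPartialHomeomorph Total Total} {p : Total}

theorem IsPointSymmetry.pd_cT (hΦ : IsPointSymmetry Φ)
    (hp : p ∈ Φ.source) (v : Total) : pd v (cT Φ) p = v.1 := by
  have hs := fun v => smooth_pd Φ.open_source hΦ.1.smooth_cT v
  have h1 : pd et (cT Φ) p = 1 :=
    eq_of_regular (g := fun _ => 1) (hs et) contDiffOn_const (fun q hq => (hΦ.regular_base hq).1) hp
  have h2 : pd ex (cT Φ) p = 0 :=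
    eq_of_regular (g := fun _ => 0) (hs ex) contDiffOn_const
      (fun q hq => (hΦ.cT_ex_eu hq.1 hq.2.1 hq.2.2).1) hp
  have h3 : pd ey (cT Φ) p = 0 :=
    eq_of_regular (g := fun _ => 0) (hs ey) contDiffOn_const
      (fun q hq => (hΦ.regular_base hq).2.1) hp
  have h4 : pd eu (cT Φ) p = 0 :=
    eq_of_regular (g := fun _ => 0) (hs eu) contDiffOn_const
      (fun q hq => (hΦ.cT_ex_eu hq.1 hq.2.1 hq.2.2).2) hp
  rw [pd_total, h1, h2, h3, h4]; ring

theorem IsPointSymmetry.pd_cY (hΦ : IsPointSymmetry Φ) (hp : p ∈ Φ.source) (v : Total) :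
    pd v (cY Φ) p = v.2.2.1 * pd ey (cY Φ) p := by
  have hs := fun v => smooth_pd Φ.open_source hΦ.1.smooth_cY v
  have h1 : pd et (cY Φ) p = 0 :=
    eq_of_regular (g := fun _ => 0) (hs et) contDiffOn_const
      (fun q hq => (hΦ.regular_base hq).2.2.1) hp
  have h2 : pd ex (cY Φ) p = 0 :=
    eq_of_regular (g := fun _ => 0) (hs ex) contDiffOn_const
      (fun q hq => (hΦ.cY_ex_eu hq.1 hq.2.1 hq.2.2).1) hp
  have h4 : pd eu (cY Φ) p = 0 :=
    eq_of_regular (g := fun _ => 0) (hs eu) contDiffOn_const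
      (fun q hq => (hΦ.cY_ex_eu hq.1 hq.2.1 hq.2.2).2) hp
  rw [pd_total, h1, h2, h4]; ring

theorem IsPointSymmetry.cX_eq (hΦ : IsPointSymmetry Φ)
    (hp : p ∈ Φ.source) : cX Φ p = p.2.1 * pd ey (cY Φ) p := by
  refine eq_of_regular (g := fun q => q.2.1 * pd ey (cY Φ) q) hΦ.1.smooth_cX ?_
    (fun q hq => (hΦ.regular_base hq).2.2.2) hp
  exact (ContDiff.contDiffOn (by fun_prop)).mul (smooth_pd Φ.open_source hΦ.1.smooth_cY ey)

theorem IsPointSymmetry.pd_cY_ey (hΦ : IsPointSymmetry Φ) (hp : p ∈ Φ.source) (v : Total) :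
    pd v (pd ey (cY Φ)) p = v.2.2.1 * pd ey (pd ey (cY Φ)) p := by
  rw [pd_comm Φ.open_source hΦ.1.smooth_cY hp,
    pd_congr Φ.open_source (fun q hq => hΦ.pd_cY hq v) hp,
    pd_const_mul (differentiableAt_of_smooth Φ.open_source
      (smooth_pd Φ.open_source hΦ.1.smooth_cY ey) hp)]

theorem IsPointSymmetry.pd_cX (hΦ : IsPointSymmetry Φ) (hp : p ∈ Φ.source) (v : Total) :
    pd v (cX Φ) p = v.2.1 * pd ey (cY Φ) p + p.2.1 * (v.2.2.1 * pd ey (pd ey (cY Φ)) p) := by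
  rw [pd_congr Φ.open_source (fun q hq => hΦ.cX_eq hq) hp, pd_mul (by fun_prop)
    (differentiableAt_of_smooth Φ.open_source (smooth_pd Φ.open_source hΦ.1.smooth_cY ey) hp),
    pd_coord_x, hΦ.pd_cY_ey hp]

/-- `T`, `X` and `Y` have zero `u`-derivative, so otherwise the differential would kill the
`u`-direction. -/
theorem IsPointSymmetry.cU_eu_ne_zero (hΦ : IsPointSymmetry Φ)
    (hp : p ∈ Φ.source) : pd eu (cU Φ) p ≠ 0 := by
  intro h
  have : (eu : Total) = 0 := by
    apply hΦ.1.eq_zero_of_pd hp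
    · rw [hΦ.pd_cT hp]
    · rw [hΦ.pd_cX hp]; simp
    · rw [hΦ.pd_cY hp]; simp
    · exact h
  simp at this

/-- If `Y_y = 0`, then `X_x = 0` as well, and the differential kills `(0, U_u, 0, -U_x)`. -/
theorem IsPointSymmetry.cY_ey_ne_zero (hΦ : IsPointSymmetry Φ)
    (hp : p ∈ Φ.source) : pd ey (cY Φ) p ≠ 0 := by
  intro h
  have hU := hΦ.cU_eu_ne_zero hp
  have : ((0, pd eu (cU Φ) p, 0, -pd ex (cU Φ) p) : Total) = 0 := by
    apply hΦ.1.eq_zero_of_pd hp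
    · rw [hΦ.pd_cT hp]
    · rw [hΦ.pd_cX hp, h]; simp
    · rw [hΦ.pd_cY hp]; simp
    · rw [pd_total]; ring
  simp [hU] at this

theorem IsPointSymmetry.cU_eu_eu (hΦ : IsPointSymmetry Φ)
    (hp : p ∈ Φ.source) : pd eu (pd eu (cU Φ)) p = 0 :=
  eq_of_regular (g := fun _ => 0)
    (smooth_pd Φ.open_source (smooth_pd Φ.open_source hΦ.1.smooth_cU eu) eu) contDiffOn_const
    (fun _ hq => (hΦ.regular_relations hq).2.2.1) hp

end Global

/-! ### The equations for `κ = Y_yy / (2 Y_y)` and `U_u` -/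

/-- Half of the logarithmic derivative of `Y_y`. -/
noncomputable def kap (Φ : Total → Total) (p : Total) : ℝ :=
  pd ey (pd ey (cY Φ)) p / (2 * pd ey (cY Φ) p)

section Kap

variable {Φ : OpenPartialHomeomorph Total Total} {p : Total}

theorem IsPointSymmetry.smooth_kap (hΦ : IsPointSymmetry Φ) : ContDiffOn ℝ ∞ (kap Φ) Φ.source := by
  have h := smooth_pd Φ.open_source hΦ.1.smooth_cY ey
  refine (smooth_pd Φ.open_source h ey).div (contDiffOn_const.mul h) ?_
  intro q hq
  exact mul_ne_zero two_ne_zero (hΦ.cY_ey_ne_zero hq)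

theorem IsPointSymmetry.cY_ey_ey (hΦ : IsPointSymmetry Φ) (hp : p ∈ Φ.source) :
    pd ey (pd ey (cY Φ)) p = 2 * kap Φ p * pd ey (cY Φ) p := by
  have := hΦ.cY_ey_ne_zero hp
  rw [kap]; field_simp

theorem IsPointSymmetry.pd_kap (hΦ : IsPointSymmetry Φ) (hp : p ∈ Φ.source) (v : Total) :
    pd v (kap Φ) p = v.2.2.1 * pd ey (kap Φ) p := by
  have hO := Φ.open_source
  have sY := smooth_pd hO hΦ.1.smooth_cY ey
  have dY := differentiableAt_of_smooth hO sY hp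
  have dk := differentiableAt_of_smooth hO hΦ.smooth_kap hp
  have key : ∀ w, pd w (pd ey (pd ey (cY Φ))) p = 2 * pd w (kap Φ) p * pd ey (cY Φ) p
      + 2 * kap Φ p * pd w (pd ey (cY Φ)) p := by
    intro w
    rw [pd_congr hO (fun q hq => hΦ.cY_ey_ey hq) hp, pd_mul (dk.const_mul 2) dY,
      pd_const_mul dk]
  have h1 : pd v (pd ey (pd ey (cY Φ))) p = v.2.2.1 * pd ey (pd ey (pd ey (cY Φ))) p := by
    rw [pd_comm hO sY hp, pd_congr hO (fun q hq => hΦ.pd_cY_ey hq v) hp,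
      pd_const_mul (differentiableAt_of_smooth hO (smooth_pd hO sY ey) hp)]
  have h2 := hΦ.pd_cY_ey hp v
  have k1 := key v
  have k2 := key ey
  have hne := hΦ.cY_ey_ne_zero hp
  apply mul_left_cancel₀ hne
  linear_combination (h1 - k1 + v.2.2.1 * k2) / 2 - kap Φ p * h2

/-- Insert `X = x Y_y` into the fourth regular relation: `X_t = X_xx = 0` and `X_y = x Y_yy`, after
which the common factor `x² Y_y` cancels on the regular set. -/
theorem IsPointSymmetry.cU_ex_eu (hΦ : IsPointSymmetry Φ) (hp : p ∈ Φ.source) :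
    pd ex (pd eu (cU Φ)) p = -(kap Φ p * pd eu (cU Φ) p) := by
  have hO := Φ.open_source
  have sU := smooth_pd hO hΦ.1.smooth_cU eu
  refine eq_of_regular (g := fun p => -(kap Φ p * pd eu (cU Φ) p)) (smooth_pd hO sU ex)
    (hΦ.smooth_kap.mul sU).neg (fun q hq => ?_) hp
  have h := (hΦ.regular_relations hq).2.2.2.1
  have hxx : pd ex (pd ex (cX Φ)) q = 0 := by
    have e : ∀ r ∈ Φ.source, pd ex (cX Φ) r = pd ey (cY Φ) r := fun r hr => by
      rw [hΦ.pd_cX hr]; simp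
    rw [pd_congr hO e hq.1, hΦ.pd_cY_ey hq.1]; simp
  rw [hxx, hΦ.pd_cX hq.1 et, hΦ.pd_cX hq.1 ey, hΦ.pd_cX hq.1 ex, hΦ.cY_ey_ey hq.1] at h
  simp only at h
  have hne := hΦ.cY_ey_ne_zero hq.1
  have hx := hq.2.1
  have : q.2.1 ^ 2 * pd ey (cY Φ) q * (pd ex (pd eu (cU Φ)) q + kap Φ q * pd eu (cU Φ) q) = 0 := by
    linear_combination h / 2
  have := (mul_eq_zero.1 this).resolve_left (by positivity)
  linarith

theorem IsPointSymmetry.cU_equation (hΦ : IsPointSymmetry Φ) (hp : p ∈ Φ.source) :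
    pd et (cU Φ) p + p.2.1 * pd ey (cU Φ) p =
      p.2.1 ^ 2 * (pd ex (pd ex (cU Φ)) p + 2 * (kap Φ p * pd ex (cU Φ) p)) := by
  have hO := Φ.open_source
  have s := fun v => smooth_pd hO hΦ.1.smooth_cU v
  have sx : ContDiffOn ℝ ∞ (fun q : Total => q.2.1) Φ.source := ContDiff.contDiffOn (by fun_prop)
  refine eq_of_regular (f := fun p => pd et (cU Φ) p + p.2.1 * pd ey (cU Φ) p)
    (g := fun p => p.2.1 ^ 2 * (pd ex (pd ex (cU Φ)) p + 2 * (kap Φ p * pd ex (cU Φ) p)))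
    ((s et).add (sx.mul (s ey))) ((sx.pow 2).mul ((smooth_pd hO (s ex) ex).add
      (contDiffOn_const.mul (hΦ.smooth_kap.mul (s ex))))) (fun q hq => ?_) hp
  have h := (hΦ.regular_relations hq).2.2.2.2
  rw [hΦ.cU_ex_eu hq.1] at h
  apply mul_right_cancel₀ (hΦ.cU_eu_ne_zero hq.1)
  linear_combination h

/-- The equations for `θ = U_u` and `κ`. -/
theorem IsPointSymmetry.theta_kap (hΦ : IsPointSymmetry Φ) (hp : p ∈ Φ.source) :
    pd ey (kap Φ) p = kap Φ p ^ 2 ∧ pd et (pd eu (cU Φ)) p = 0 ∧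
      pd ey (pd eu (cU Φ)) p = -(p.2.1 * kap Φ p ^ 2 * pd eu (cU Φ) p) := by
  have hO := Φ.open_source
  obtain ⟨θ, hθ⟩ : ∃ θ, θ = pd eu (cU Φ) := ⟨_, rfl⟩
  have sU := hΦ.1.smooth_cU
  have sθ : ContDiffOn ℝ ∞ θ Φ.source := hθ ▸ smooth_pd hO sU eu
  have sk := hΦ.smooth_kap
  have sx : ContDiffOn ℝ ∞ (fun q : Total => q.2.1) Φ.source := ContDiff.contDiffOn (by fun_prop)
  have θx : ∀ q ∈ Φ.source, pd ex θ q = -(kap Φ q * θ q) := fun q hq => by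
    rw [hθ]; exact hΦ.cU_ex_eu hq
  have dd : ∀ {f : Total → ℝ}, ContDiffOn ℝ ∞ f Φ.source → ∀ q ∈ Φ.source,
      DifferentiableAt ℝ f q := fun hf q hq => differentiableAt_of_smooth hO hf hq
  have pθx : ∀ v, ∀ q ∈ Φ.source, pd v (pd ex θ) q =
      -(v.2.2.1 * pd ey (kap Φ) q * θ q + kap Φ q * pd v θ q) := by
    intro v q hq
    have e : EqOn (pd ex θ) (fun q => (-1) * (kap Φ q * θ q)) Φ.source := fun q hq => by
      simp only [θx q hq]; ring
    rw [pd_congr hO e hq, pd_const_mul ((dd sk q hq).fun_mul (dd sθ q hq)),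
      pd_mul (dd sk q hq) (dd sθ q hq), hΦ.pd_kap hq]
    ring
  -- The `u`-derivative of `IsPointSymmetry.cU_equation`, in which `θ_x = -κθ` turns `θ_xx + 2κθ_x`
  -- into `-κ²θ`.
  have eq1 : ∀ q ∈ Φ.source, pd et θ q + q.2.1 * pd ey θ q
      = -(q.2.1 ^ 2 * (kap Φ q ^ 2 * θ q)) := by
    intro q hq
    have s := fun v => smooth_pd hO sU v
    have h := pd_congr hO (fun q hq => hΦ.cU_equation hq) hq eu
    have dx2 : DifferentiableAt ℝ (fun q : Total => q.2.1 ^ 2) q := by fun_prop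
    have dx : DifferentiableAt ℝ (fun q : Total => q.2.1) q := by fun_prop
    have dxx := dd (smooth_pd hO (s ex) ex) q hq
    have x2u : pd eu (fun q : Total => q.2.1 ^ 2) q = 0 := by
      have e : EqOn (fun q : Total => q.2.1 ^ 2) (fun q => q.2.1 * q.2.1) Φ.source :=
        fun r _ => sq r.2.1
      rw [pd_congr hO e hq, pd_mul dx dx, pd_coord_x]; simp
    have kx := (dd sk q hq).fun_mul (dd (s ex) q hq)
    rw [pd_add (dd (s et) q hq) (dx.fun_mul (dd (s ey) q hq)), pd_mul dx (dd (s ey) q hq),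
      pd_coord_x, pd_mul dx2 (dxx.fun_add (kx.const_mul 2)), x2u, pd_add dxx (kx.const_mul 2),
      pd_const_mul kx, pd_mul (dd sk q hq) (dd (s ex) q hq), hΦ.pd_kap hq,
      pd_comm hO sU hq eu et, pd_comm hO sU hq eu ey, pd_comm hO sU hq eu ex,
      pd_comm hO (s ex) hq eu ex, pd_congr hO (fun r hr => pd_comm hO sU hr eu ex) hq ex,
      ← hθ, pθx ex q hq, θx q hq] at h
    simp only at h
    linear_combination h
  -- Compatibility of `eq1` with `θ_x = -κθ`: the `x`-derivative of `eq1` plus `κ` times `eq1`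
  -- involves no derivative of `θ` except `θ_y`.
  have eq3 : ∀ q ∈ Φ.source, pd ey θ q
      = q.2.1 * (pd ey (kap Φ) q - 2 * kap Φ q ^ 2) * θ q := by
    intro q hq
    have h := pd_congr hO eq1 hq ex
    have dx : DifferentiableAt ℝ (fun q : Total => q.2.1) q := by fun_prop
    have e : EqOn (fun q : Total => -(q.2.1 ^ 2 * (kap Φ q ^ 2 * θ q)))
        (fun q => (q.2.1 * kap Φ q) * (q.2.1 * pd ex θ q)) Φ.source := by
      intro r hr
      simp only [θx r hr]; ring
    have s := fun v => smooth_pd hO sθ v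
    rw [pd_congr hO e hq, pd_add (dd (s et) q hq) (dx.fun_mul (dd (s ey) q hq)),
      pd_mul dx (dd (s ey) q hq), pd_coord_x, pd_comm hO sθ hq ex et, pd_comm hO sθ hq ex ey,
      pθx _ _ hq, pθx _ _ hq, pd_mul (dx.fun_mul (dd sk q hq)) (dx.fun_mul (dd (s ex) q hq)),
      pd_mul dx (dd sk q hq), pd_mul dx (dd (s ex) q hq), pd_coord_x, hΦ.pd_kap hq ex, pθx _ _ hq,
      θx q hq] at h
    simp only at h
    linear_combination h + kap Φ q * eq1 q hq
  have eq4 : ∀ q ∈ Φ.source, pd et θ q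
      = q.2.1 * q.2.1 * ((kap Φ q * kap Φ q - pd ey (kap Φ) q) * θ q) := by
    intro q hq
    linear_combination eq1 q hq - q.2.1 * eq3 q hq
  -- A second compatibility condition: the `x`-derivative of `eq4` reduces to `2xθ(κ_y - κ²) = 0`.
  -- The condition `κ_y = κ²` is the vanishing of the Schwarzian derivative of `Y`.
  have hk : ∀ q ∈ Φ.source, pd ey (kap Φ) q = kap Φ q ^ 2 := by
    intro q hq
    have hz : ∀ q ∈ Φ.source ∩ {p | p.2.1 ≠ 0}, pd ey (kap Φ) q = kap Φ q ^ 2 := by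
      rintro q ⟨hq, hx⟩
      have h := pd_congr hO eq4 hq ex
      have dx : DifferentiableAt ℝ (fun q : Total => q.2.1) q := by fun_prop
      have dk := dd sk q hq
      have dky := dd (smooth_pd hO sk ey) q hq
      have dθ := dd sθ q hq
      have kyx : pd ex (pd ey (kap Φ)) q = 0 := by
        rw [pd_comm hO sk hq]
        refine pd_eq_zero_of_eqOn hO (c := 0) (fun r hr => ?_) hq ey
        rw [hΦ.pd_kap hr]; simp
      rw [pd_comm hO sθ hq ex et, pθx _ _ hq, pd_mul (dx.fun_mul dx)
        (((dk.fun_mul dk).fun_sub dky).fun_mul dθ), pd_mul dx dx,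
        pd_mul ((dk.fun_mul dk).fun_sub dky) dθ, pd_sub (dk.fun_mul dk) dky, pd_mul dk dk,
        pd_coord_x, hΦ.pd_kap hq ex, kyx, eq4 q hq, θx q hq] at h
      simp only at h
      have hne : θ q ≠ 0 := hθ ▸ hΦ.cU_eu_ne_zero hq
      have : q.2.1 * θ q * (pd ey (kap Φ) q - kap Φ q ^ 2) = 0 := by
        linear_combination h / 2
      have := (mul_eq_zero.1 this).resolve_left (mul_ne_zero hx hne)
      linarith
    exact EqOn.of_subset_closure hz (smooth_pd hO sk ey).continuousOn (sk.pow 2).continuousOn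
      inter_subset_left (subset_closure_x_ne_zero hO) hq
  rw [← hθ]
  refine ⟨hk p hp, ?_, ?_⟩
  · rw [eq4 p hp, hk p hp]; ring
  · rw [eq3 p hp, hk p hp]; ring

end Kap

/-! ### Integration to the normal form -/

theorem sign_const_of_ne_zero {E : Type*} [TopologicalSpace E] {U : Set E} (hc : IsPreconnected U)
    {f : E → ℝ} (hf : ContinuousOn f U) (h0 : ∀ p ∈ U, f p ≠ 0) :
    (∀ p ∈ U, 0 < f p) ∨ (∀ p ∈ U, f p < 0) := by
  by_contra! h
  obtain ⟨⟨p, hp, hpf⟩, q, hq, hqf⟩ := h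
  obtain ⟨r, hr, hr0⟩ := hc.intermediate_value hp hq hf ⟨hpf, hqf⟩
  exact h0 r hr hr0

/-- The general form of a point symmetry; `z` is the value of the added solution. -/
noncomputable def normalForm (τ ε a b c d K z : ℝ) (p : Total) : Total :=
  (p.1 + τ, ε * p.2.1 / (c * p.2.2.1 + d) ^ 2, (a * p.2.2.1 + b) / (c * p.2.2.1 + d),
    K * Real.exp (c * p.2.1 / (c * p.2.2.1 + d)) * (p.2.2.2 + z))

section NormalForm

variable {Φ : OpenPartialHomeomorph Total Total}

/-- The transformation in the `y`-direction is fractional linear. -/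
theorem IsPointSymmetry.exists_moebius (hΦ : IsPointSymmetry Φ) (hc : IsConnected Φ.source) :
    ∃ ε a b c d : ℝ, (ε = 1 ∨ ε = -1) ∧ a * d - b * c = ε ∧ ∀ p ∈ Φ.source,
      0 < c * p.2.2.1 + d ∧ 0 < ε * pd ey (cY Φ) p ∧
      ε * pd ey (cY Φ) p * (c * p.2.2.1 + d) ^ 2 = 1 ∧
      cY Φ p * (c * p.2.2.1 + d) = a * p.2.2.1 + b ∧ kap Φ p * (c * p.2.2.1 + d) = -c := by
  have hO := Φ.open_source
  have sYy := smooth_pd hO hΦ.1.smooth_cY ey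
  have dd : ∀ {f : Total → ℝ}, ContDiffOn ℝ ∞ f Φ.source → ∀ q ∈ Φ.source,
      DifferentiableAt ℝ f q := fun hf q hq => differentiableAt_of_smooth hO hf hq
  obtain ⟨ε, hε, hpos⟩ : ∃ ε : ℝ, (ε = 1 ∨ ε = -1) ∧ ∀ p ∈ Φ.source, 0 < ε * pd ey (cY Φ) p := by
    rcases sign_const_of_ne_zero hc.isPreconnected sYy.continuousOn
      (fun p hp => hΦ.cY_ey_ne_zero hp) with h | h
    · exact ⟨1, .inl rfl, fun p hp => by simpa using h p hp⟩
    · exact ⟨-1, .inr rfl, fun p hp => by simpa using h p hp⟩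
  -- The function `w = |Y_y|^(-1/2)` linearizes the Schwarzian equation: `w_y = -κw` and `κ_y = κ²`
  -- make `κw` constant, so `w` is affine in `y` and becomes the denominator `cy + d`.
  obtain ⟨w, hw⟩ : ∃ w : Total → ℝ, w = fun p => (Real.sqrt (ε * pd ey (cY Φ) p))⁻¹ := ⟨_, rfl⟩
  have hw0 : ∀ p ∈ Φ.source, 0 < w p := fun p hp => by
    rw [hw]; exact inv_pos.2 (Real.sqrt_pos.2 (hpos p hp))
  have hw2 : ∀ p ∈ Φ.source, ε * pd ey (cY Φ) p * w p ^ 2 = 1 := fun p hp => by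
    have h := hpos p hp
    simp only [hw, inv_pow, Real.sq_sqrt h.le]
    exact mul_inv_cancel₀ h.ne'
  have sw : ContDiffOn ℝ ∞ w Φ.source := by
    rw [hw]
    refine ContDiffOn.inv ((contDiffOn_const.mul sYy).sqrt fun p hp => (hpos p hp).ne') ?_
    exact fun p hp => (Real.sqrt_pos.2 (hpos p hp)).ne'
  have pw : ∀ p ∈ Φ.source, ∀ v, pd v w p = -(v.2.2.1 * kap Φ p * w p) := by
    intro p hp v
    have h := hpos p hp
    have hd := (Real.hasDerivAt_sqrt h.ne').inv (Real.sqrt_pos.2 h).ne'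
    have e := pd_comp_real (f := fun p => ε * pd ey (cY Φ) p) hd ((dd sYy p hp).const_mul ε) v
    rw [pd_const_mul (dd sYy p hp), hΦ.pd_cY_ey hp, hΦ.cY_ey_ey hp] at e
    rw [hw]
    refine e.trans ?_
    have hs := Real.sq_sqrt h.le
    have hs0 := (Real.sqrt_pos.2 h).ne'
    set z := Real.sqrt (ε * pd ey (cY Φ) p)
    change _ = -(v.2.2.1 * kap Φ p * z⁻¹)
    field_simp
    linear_combination (v.2.2.1 * kap Φ p) * hs
  have sk := hΦ.smooth_kap
  have sY := hΦ.1.smooth_cY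
  have sy : ContDiffOn ℝ ∞ (fun p : Total => p.2.2.1) Φ.source :=
    ContDiff.contDiffOn (by fun_prop)
  have const : ∀ f : Total → ℝ, ContDiffOn ℝ ∞ f Φ.source →
      (∀ p ∈ Φ.source, ∀ v, pd v f p = 0) → ∃ c, ∀ p ∈ Φ.source, f p = c := fun f hf h =>
    exists_const_of_pd hO hc.isPreconnected hf (fun p hp => h p hp _) (fun p hp => h p hp _)
      (fun p hp => h p hp _) (fun p hp => h p hp _)
  obtain ⟨c', hc'⟩ := const (fun p => kap Φ p * w p) (sk.mul sw) fun p hp v => by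
    rw [pd_mul (dd sk p hp) (dd sw p hp), hΦ.pd_kap hp, pw p hp, (hΦ.theta_kap hp).1]; ring
  obtain ⟨d, hd⟩ := const (fun p => w p + c' * p.2.2.1) (sw.add (contDiffOn_const.mul sy))
    fun p hp v => by
      rw [pd_add (dd sw p hp) ((dd sy p hp).const_mul c'), pd_const_mul (dd sy p hp), pd_coord_y,
        pw p hp]
      linear_combination (-v.2.2.1) * hc' p hp
  -- First integrals for the numerator: `(Y_y w)_y = κ w Y_y = c' Y_y`, and hence `(Y w)_y = Y_y w -
  -- c' Y = a`.
  obtain ⟨a, ha⟩ := const (fun p => pd ey (cY Φ) p * w p - c' * cY Φ p)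
    ((sYy.mul sw).sub (contDiffOn_const.mul sY)) fun p hp v => by
      rw [pd_sub ((dd sYy p hp).fun_mul (dd sw p hp)) ((dd sY p hp).const_mul c'),
        pd_mul (dd sYy p hp) (dd sw p hp), pd_const_mul (dd sY p hp), hΦ.pd_cY hp v, pw p hp,
        hΦ.pd_cY_ey hp, hΦ.cY_ey_ey hp]
      linear_combination (v.2.2.1 * pd ey (cY Φ) p) * hc' p hp
  obtain ⟨b, hb⟩ := const (fun p => cY Φ p * w p - a * p.2.2.1)
    ((sY.mul sw).sub (contDiffOn_const.mul sy)) fun p hp v => by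
      rw [pd_sub ((dd sY p hp).fun_mul (dd sw p hp)) ((dd sy p hp).const_mul a),
        pd_mul (dd sY p hp) (dd sw p hp), pd_const_mul (dd sy p hp), hΦ.pd_cY hp, pw p hp,
        pd_coord_y]
      linear_combination v.2.2.1 * ha p hp - v.2.2.1 * cY Φ p * hc' p hp
  have hwc : ∀ p ∈ Φ.source, -c' * p.2.2.1 + d = w p := fun p hp => by
    have := hd p hp
    linarith
  have hεsq : ε * ε = 1 := by rcases hε with rfl | rfl <;> norm_num
  refine ⟨ε, a, b, -c', d, hε, ?_, fun p hp => ?_⟩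
  · obtain ⟨p, hp⟩ := hc.nonempty
    have h1 := ha p hp
    have h2 := hb p hp
    have h3 := hwc p hp
    have h4 := hw2 p hp
    linear_combination a * h3 + (-w p) * h1 - c' * h2 + ε * h4 - pd ey (cY Φ) p * w p ^ 2 * hεsq
  · rw [hwc p hp]
    refine ⟨hw0 p hp, hpos p hp, hw2 p hp, ?_, ?_⟩
    · have := hb p hp
      linarith
    · rw [hc' p hp]; ring

/-- The structure of the point symmetries with connected domain. -/
theorem IsPointSymmetry.exists_normalForm (hΦ : IsPointSymmetry Φ) (hc : IsConnected Φ.source) :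
    ∃ (τ ε a b c d K : ℝ) (h : Total → ℝ), (ε = 1 ∨ ε = -1) ∧ a * d - b * c = ε ∧
      ContDiffOn ℝ ∞ h Φ.source ∧ (∀ p ∈ Φ.source, pd eu h p = 0) ∧
      (∀ p ∈ Φ.source, pd et h p + p.2.1 * pd ey h p = p.2.1 ^ 2 * pd ex (pd ex h) p) ∧
      ∀ p ∈ Φ.source, 0 < c * p.2.2.1 + d ∧ 0 < ε * pd ey (cY Φ) p ∧ 0 < K * pd eu (cU Φ) p ∧
        Φ p = normalForm τ ε a b c d K (h p) p := by
  have hO := Φ.open_source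
  obtain ⟨ε, a, b, c, d, hε, hdet, hM⟩ := hΦ.exists_moebius hc
  have dd : ∀ {f : Total → ℝ}, ContDiffOn ℝ ∞ f Φ.source → ∀ q ∈ Φ.source,
      DifferentiableAt ℝ f q := fun hf q hq => differentiableAt_of_smooth hO hf hq
  have const : ∀ f : Total → ℝ, ContDiffOn ℝ ∞ f Φ.source →
      (∀ p ∈ Φ.source, ∀ v, pd v f p = 0) → ∃ c, ∀ p ∈ Φ.source, f p = c := fun f hf h =>
    exists_const_of_pd hO hc.isPreconnected hf (fun p hp => h p hp _) (fun p hp => h p hp _)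
      (fun p hp => h p hp _) (fun p hp => h p hp _)
  have st : ContDiffOn ℝ ∞ (fun p : Total => p.1) Φ.source := ContDiff.contDiffOn (by fun_prop)
  have sx : ContDiffOn ℝ ∞ (fun p : Total => p.2.1) Φ.source := ContDiff.contDiffOn (by fun_prop)
  have su : ContDiffOn ℝ ∞ (fun p : Total => p.2.2.2) Φ.source :=
    ContDiff.contDiffOn (by fun_prop)
  have sT := hΦ.1.smooth_cT
  have sU := hΦ.1.smooth_cU
  have sk := hΦ.smooth_kap
  obtain ⟨τ, hτ⟩ := const (fun p => cT Φ p - p.1) (sT.sub st) fun p hp v => by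
    rw [pd_sub (dd sT p hp) (dd st p hp), hΦ.pd_cT hp, pd_coord_t]; ring
  obtain ⟨θ, hθ⟩ : ∃ θ, θ = pd eu (cU Φ) := ⟨_, rfl⟩
  have sθ : ContDiffOn ℝ ∞ θ Φ.source := hθ ▸ smooth_pd hO sU eu
  have θ0 : ∀ p ∈ Φ.source, θ p ≠ 0 := fun p hp => hθ ▸ hΦ.cU_eu_ne_zero hp
  have pθ : ∀ p ∈ Φ.source, ∀ v, pd v θ p =
      -(v.2.1 * (kap Φ p * θ p)) - v.2.2.1 * (p.2.1 * kap Φ p ^ 2 * θ p) := by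
    intro p hp v
    rw [pd_total, hθ, (hΦ.theta_kap hp).2.1, (hΦ.theta_kap hp).2.2, hΦ.cU_ex_eu hp,
      hΦ.cU_eu_eu hp]
    ring
  have skx : ContDiffOn ℝ ∞ (fun p => kap Φ p * p.2.1) Φ.source := sk.mul sx
  -- By `θ_x = -κθ`, `θ_y = -xκ²θ` and `κ_y = κ²`, the product `θ exp(κx)` has zero differential.
  obtain ⟨K, hK⟩ := const (fun p => θ p * Real.exp (kap Φ p * p.2.1))
    (sθ.mul skx.exp) fun p hp v => by
      rw [pd_mul (dd sθ p hp) (dd skx.exp p hp), pd_comp_real (Real.hasDerivAt_exp _) (dd skx p hp),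
        pd_mul (dd sk p hp) (dd sx p hp), pd_coord_x, pθ p hp, hΦ.pd_kap hp,
        (hΦ.theta_kap hp).1]
      ring
  have hκ : ∀ p ∈ Φ.source, kap Φ p = -(c / (c * p.2.2.1 + d)) := by
    intro p hp
    obtain ⟨h0, -, -, -, h4⟩ := hM p hp
    rw [← neg_div, ← h4, mul_div_assoc, div_self h0.ne', mul_one]
  have hθK : ∀ p ∈ Φ.source, θ p = K * Real.exp (c * p.2.1 / (c * p.2.2.1 + d)) := by
    intro p hp
    rw [← hK p hp, mul_assoc, ← Real.exp_add, hκ p hp]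
    ring_nf
    simp
  have sV : ContDiffOn ℝ ∞ (fun p => cU Φ p / θ p) Φ.source := sU.div sθ θ0
  -- As `U` is affine in `u` with slope `θ`, the quotient `V = U/θ` has slope one, and `V - u` is
  -- the added solution `h`.
  obtain ⟨V, hV⟩ : ∃ V, V = fun p => cU Φ p / θ p := ⟨_, rfl⟩
  rw [← hV] at sV
  have hUV : ∀ p ∈ Φ.source, cU Φ p = θ p * V p := fun p hp => by
    have := θ0 p hp
    rw [hV]; field_simp
  have pU : ∀ p ∈ Φ.source, ∀ v, pd v (cU Φ) p = pd v θ p * V p + θ p * pd v V p :=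
    fun p hp v => by rw [pd_congr hO hUV hp, pd_mul (dd sθ p hp) (dd sV p hp)]
  have hVu : ∀ p ∈ Φ.source, pd eu V p = 1 := by
    intro p hp
    have h1 := pU p hp eu
    rw [pθ p hp] at h1
    simp only at h1
    apply mul_left_cancel₀ (θ0 p hp)
    rw [← hθ] at h1
    linarith
  have ph : ∀ p ∈ Φ.source, ∀ v, pd v (fun p => V p - p.2.2.2) p = pd v V p - v.2.2.2 :=
    fun p hp v => by rw [pd_sub (dd sV p hp) (dd su p hp), pd_coord_u]
  refine ⟨τ, ε, a, b, c, d, K, fun p => V p - p.2.2.2, hε, hdet, sV.sub su, ?_, ?_, ?_⟩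
  · intro p hp
    rw [ph p hp, hVu p hp]; simp
  · intro p hp
    have e : EqOn (pd ex fun p => V p - p.2.2.2) (pd ex V) Φ.source := fun q hq => by
      rw [ph q hq]; simp
    rw [ph p hp, ph p hp, pd_congr hO e hp]
    have hE := hΦ.cU_equation hp
    have e2 : EqOn (pd ex (cU Φ)) (fun p => θ p * pd ex V p - (kap Φ p * θ p) * V p)
        Φ.source := fun q hq => by
      rw [pU q hq, pθ q hq]; simp; ring
    have sVx := smooth_pd hO sV ex
    have dk := dd sk p hp
    have dθ := dd sθ p hp
    have dV := dd sV p hp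
    have dVx := dd sVx p hp
    rw [pd_congr hO e2 hp, pd_sub (dθ.fun_mul dVx) ((dk.fun_mul dθ).fun_mul dV), pd_mul dθ dVx,
      pd_mul (dk.fun_mul dθ) dV, pd_mul dk dθ, pU p hp et, pU p hp ey, pU p hp ex, pθ p hp,
      pθ p hp, pθ p hp, hΦ.pd_kap hp] at hE
    simp only at hE
    apply mul_left_cancel₀ (θ0 p hp)
    simp only
    linear_combination hE
  · intro p hp
    obtain ⟨h0, h1, h2, h3, h4⟩ := hM p hp
    refine ⟨h0, h1, ?_, ?_⟩
    · have hne := θ0 p hp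
      rw [hθK p hp] at hne
      have hK0 : K ≠ 0 := left_ne_zero_of_mul hne
      rw [← hθ, hθK p hp, ← mul_assoc]
      exact mul_pos (mul_self_pos.2 hK0) (Real.exp_pos _)
    · have eT : cT Φ p = p.1 + τ := by have := hτ p hp; linarith
      have eY : cY Φ p = (a * p.2.2.1 + b) / (c * p.2.2.1 + d) := by
        rw [← h3, mul_div_assoc, div_self h0.ne', mul_one]
      have eX : cX Φ p = ε * p.2.1 / (c * p.2.2.1 + d) ^ 2 := by
        rw [hΦ.cX_eq hp, eq_div_iff (by positivity)]
        have hεsq : ε * ε = 1 := by rcases hε with rfl | rfl <;> norm_num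
        linear_combination ε * p.2.1 * h2
          - p.2.1 * pd ey (cY Φ) p * (c * p.2.2.1 + d) ^ 2 * hεsq
      have eU : cU Φ p = K * Real.exp (c * p.2.1 / (c * p.2.2.1 + d)) *
          (p.2.2.2 + (V p - p.2.2.2)) := by
        rw [hUV p hp, hθK p hp]; ring
      ext
      exacts [eT, eX, eY, eU]

end NormalForm

/-! ### Transformations in normal form are point symmetries -/

theorem pd_base_t (v p : Base) : pd v (fun q => q.1) p = v.1 :=
  pd_clm (ContinuousLinearMap.fst ℝ ℝ (ℝ × ℝ)) v p

theorem pd_base_x (v p : Base) : pd v (fun q => q.2.1) p = v.2.1 :=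
  pd_clm ((ContinuousLinearMap.fst ℝ ℝ ℝ).comp (ContinuousLinearMap.snd ℝ ℝ (ℝ × ℝ))) v p

theorem pd_base_y (v p : Base) : pd v (fun q => q.2.2) p = v.2.2 :=
  pd_clm ((ContinuousLinearMap.snd ℝ ℝ ℝ).comp (ContinuousLinearMap.snd ℝ ℝ (ℝ × ℝ))) v p

theorem kolm_add {Ω : Set Base} (hΩ : IsOpen Ω) {g h : Base → ℝ} (hg : ContDiffOn ℝ ∞ g Ω)
    (hh : ContDiffOn ℝ ∞ h Ω) {b : Base} (hb : b ∈ Ω) :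
    kolm (fun b => g b + h b) b = kolm g b + kolm h b := by
  have e : ∀ v, ∀ b ∈ Ω, pd v (fun b => g b + h b) b = pd v g b + pd v h b := fun v b hb =>
    pd_add (differentiableAt_of_smooth hΩ hg hb) (differentiableAt_of_smooth hΩ hh hb) v
  simp only [kolm]
  rw [e bt b hb, e bY b hb, pd_congr hΩ (e bx) hb,
    pd_add (differentiableAt_of_smooth hΩ (smooth_pd hΩ hg bx) hb)
      (differentiableAt_of_smooth hΩ (smooth_pd hΩ hh bx) hb)]
  ring

theorem kolm_const_mul {Ω : Set Base} (hΩ : IsOpen Ω) {g : Base → ℝ} (hg : ContDiffOn ℝ ∞ g Ω)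
    (r : ℝ) {b : Base} (hb : b ∈ Ω) : kolm (fun b => r * g b) b = r * kolm g b := by
  have e : ∀ v, ∀ b ∈ Ω, pd v (fun b => r * g b) b = r * pd v g b := fun v b hb =>
    pd_const_mul (differentiableAt_of_smooth hΩ hg hb) r v
  simp only [kolm]
  rw [e bt b hb, e bY b hb, pd_congr hΩ (e bx) hb,
    pd_const_mul (differentiableAt_of_smooth hΩ (smooth_pd hΩ hg bx) hb)]
  ring

/-- The action of a transformation in normal form on the independent variables. -/
noncomputable def baseMap (τ ε a b c d : ℝ) (q : Base) : Base :=
  (q.1 + τ, ε * q.2.1 / (c * q.2.2 + d) ^ 2, (a * q.2.2 + b) / (c * q.2.2 + d))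

/-- The multiplier of a transformation in normal form. -/
noncomputable def multiplier (c d K : ℝ) (q : Base) : ℝ :=
  K * Real.exp (c * q.2.1 / (c * q.2.2 + d))

/-- The behaviour of the operator `kolm` under a transformation in normal form. -/
theorem kolm_transform {τ ε a b c d K : ℝ} (hdet : a * d - b * c = ε)
    {Ω Ω' : Set Base} (hΩ : IsOpen Ω) (hΩ' : IsOpen Ω') {g g' : Base → ℝ}
    (hg : ContDiffOn ℝ ∞ g Ω) (hg' : ContDiffOn ℝ ∞ g' Ω')
    (hw : ∀ q ∈ Ω, c * q.2.2 + d ≠ 0) (hmap : ∀ q ∈ Ω, baseMap τ ε a b c d q ∈ Ω')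
    (hval : ∀ q ∈ Ω, g' (baseMap τ ε a b c d q) = multiplier c d K q * g q)
    {q : Base} (hq : q ∈ Ω) :
    kolm g' (baseMap τ ε a b c d q) = multiplier c d K q * kolm g q := by
  -- All quotients are written as products with `r = 1/(cy + d)`, whose derivative is again
  -- polynomial in `r`.
  let r : Base → ℝ := fun q => (c * q.2.2 + d)⁻¹
  let T : Base → ℝ := fun q => q.1 + τ
  let X : Base → ℝ := fun q => (ε * q.2.1) * (r q * r q)
  let Y : Base → ℝ := fun q => (a * q.2.2 + b) * r q
  let m : Base → ℝ := fun q => K * Real.exp ((c * q.2.1) * r q)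
  have hbm : ∀ q, baseMap τ ε a b c d q = (T q, X q, Y q) := fun q => by
    simp only [baseMap, T, X, Y, r, div_eq_mul_inv, pow_two, mul_inv]
  have hmm : ∀ q, multiplier c d K q = m q := fun q => by
    simp only [multiplier, m, r, div_eq_mul_inv]
  have hr : ∀ q ∈ Ω, (c * q.2.2 + d) * r q = 1 := fun q hq => mul_inv_cancel₀ (hw q hq)
  have dt : ∀ q, DifferentiableAt ℝ (fun q : Base => q.1) q := fun q => by fun_prop
  have dx : ∀ q, DifferentiableAt ℝ (fun q : Base => q.2.1) q := fun q => by fun_prop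
  have dy : ∀ q, DifferentiableAt ℝ (fun q : Base => q.2.2) q := fun q => by fun_prop
  have dw : ∀ q, DifferentiableAt ℝ (fun q : Base => c * q.2.2 + d) q := fun q => by fun_prop
  have day : ∀ q, DifferentiableAt ℝ (fun q : Base => a * q.2.2 + b) q := fun q => by fun_prop
  have dr : ∀ q ∈ Ω, DifferentiableAt ℝ r q := fun q hq => (dw q).inv (hw q hq)
  have dT : ∀ q, DifferentiableAt ℝ T q := fun q => (dt q).add_const τ
  have dX : ∀ q ∈ Ω, DifferentiableAt ℝ X q := fun q hq =>
    ((dx q).const_mul ε).fun_mul ((dr q hq).fun_mul (dr q hq))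
  have dY : ∀ q ∈ Ω, DifferentiableAt ℝ Y q := fun q hq => (day q).fun_mul (dr q hq)
  have dcx : ∀ q ∈ Ω, DifferentiableAt ℝ (fun q => (c * q.2.1) * r q) q := fun q hq =>
    ((dx q).const_mul c).fun_mul (dr q hq)
  have dm : ∀ q ∈ Ω, DifferentiableAt ℝ m q := fun q hq => (dcx q hq).exp.const_mul K
  have plin : ∀ (α β : ℝ) (v q : Base), pd v (fun q : Base => α * q.2.2 + β) q = α * v.2.2 := by
    intro α β v q
    rw [pd_add ((dy q).const_mul α) (differentiableAt_const β), pd_const_mul (dy q), pd_base_y,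
      pd_const, add_zero]
  have pr : ∀ q ∈ Ω, ∀ v, pd v r q = -(c * v.2.2 * (r q * r q)) := by
    intro q hq v
    have := pd_comp_real (f := fun q : Base => c * q.2.2 + d) (hasDerivAt_inv (hw q hq)) (dw q) v
    rw [plin] at this
    refine this.trans ?_
    simp only [r, pow_two, mul_inv]
    ring
  have pT : ∀ q v, pd v T q = v.1 := fun q v => by
    rw [pd_add (dt q) (differentiableAt_const τ), pd_base_t, pd_const, add_zero]
  have pX : ∀ q ∈ Ω, ∀ v, pd v X q = ε * v.2.1 * (r q * r q)
      - 2 * c * ε * q.2.1 * v.2.2 * (r q * r q * r q) := fun q hq v => by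
    rw [pd_mul ((dx q).const_mul ε) ((dr q hq).fun_mul (dr q hq)), pd_const_mul (dx q), pd_base_x,
      pd_mul (dr q hq) (dr q hq), pr q hq]
    ring
  have pY : ∀ q ∈ Ω, ∀ v, pd v Y q = ε * v.2.2 * (r q * r q) := fun q hq v => by
    rw [pd_mul (day q) (dr q hq), pr q hq, plin]
    have := hr q hq
    linear_combination (-(v.2.2 * a * r q)) * this + v.2.2 * r q * r q * hdet
  have pm : ∀ q ∈ Ω, ∀ v, pd v m q
      = m q * (c * v.2.1 * r q - c * c * q.2.1 * v.2.2 * (r q * r q)) := fun q hq v => by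
    have e : pd v m q = K * pd v (fun q => Real.exp ((c * q.2.1) * r q)) q :=
      pd_const_mul (dcx q hq).exp K v
    rw [e, pd_comp_real (Real.hasDerivAt_exp _) (dcx q hq),
      pd_mul ((dx q).const_mul c) (dr q hq), pd_const_mul (dx q), pd_base_x, pr q hq]
    simp only [m]
    ring
  have hmap' : ∀ q ∈ Ω, (T q, X q, Y q) ∈ Ω' := fun q hq => hbm q ▸ hmap q hq
  have hEq : EqOn (fun q => g' (T q, X q, Y q)) (fun q => m q * g q) Ω := fun q hq => by
    simp only [← hbm, ← hmm]; exact hval q hq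
  have s' := fun v => smooth_pd hΩ' hg' v
  have s := fun v => smooth_pd hΩ hg v
  have d' : ∀ {f : Base → ℝ}, ContDiffOn ℝ ∞ f Ω' → ∀ q ∈ Ω,
      DifferentiableAt ℝ f (T q, X q, Y q) := fun hf q hq =>
    differentiableAt_of_smooth hΩ' hf (hmap' q hq)
  have dg := fun q hq => differentiableAt_of_smooth hΩ hg (p := q) hq
  have first : ∀ q ∈ Ω, ∀ v, pd bt g' (T q, X q, Y q) * v.1
      + pd bx g' (T q, X q, Y q) * (ε * v.2.1 * (r q * r q)
        - 2 * c * ε * q.2.1 * v.2.2 * (r q * r q * r q))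
      + pd bY g' (T q, X q, Y q) * (ε * v.2.2 * (r q * r q))
      = m q * (c * v.2.1 * r q - c * c * q.2.1 * v.2.2 * (r q * r q)) * g q + m q * pd v g q := by
    intro q hq v
    have h := pd_congr hΩ hEq hq v
    rw [pd_comp_base (d' hg' q hq) (dT q) (dX q hq) (dY q hq), pd_mul (dm q hq) (dg q hq), pT,
      pX q hq, pY q hq, pm q hq] at h
    exact h
  have ht := first q hq bt
  have hx := first q hq bx
  have hy := first q hq bY
  have hEq2 : EqOn (fun q => pd bx g' (T q, X q, Y q) * (ε * (r q * r q)))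
      (fun q => m q * (c * r q * g q + pd bx g q)) Ω := fun q hq => by
    have := first q hq bx
    simp only at this ⊢
    linear_combination this
  have hxx := pd_congr hΩ hEq2 hq bx
  have dgx := d' (s' bx) q hq
  have dgx' : DifferentiableAt ℝ (fun q => pd bx g' (T q, X q, Y q)) q :=
    DifferentiableAt.comp q (g := pd bx g') (f := fun q => (T q, X q, Y q)) dgx
      ((dT q).prodMk ((dX q hq).prodMk (dY q hq)))
  have dsx := differentiableAt_of_smooth hΩ (s bx) hq
  have drr := (dr q hq).fun_mul (dr q hq)
  have dcr := (dr q hq).const_mul c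
  rw [pd_mul dgx' (drr.const_mul ε), pd_comp_base dgx (dT q) (dX q hq) (dY q hq),
    pd_const_mul drr, pd_mul (dr q hq) (dr q hq), pT, pX q hq, pY q hq, pr q hq,
    pd_mul (dm q hq) ((dcr.fun_mul (dg q hq)).fun_add dsx), pd_add (dcr.fun_mul (dg q hq)) dsx,
    pd_mul dcr (dg q hq), pd_const_mul (dr q hq), pm q hq, pr q hq] at hxx
  simp only at ht hx hy hxx
  rw [hmm, hbm]
  simp only [kolm]
  simp only [X] at *
  -- The multiple of `hx` cancels two terms at once: the `g'_x` term coming from `X_y`, and the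
  -- `g_x` term coming from the mixed product `2 m_x g_x` in the second derivative.
  linear_combination ht + q.2.1 * hy + 2 * c * q.2.1 ^ 2 * r q * hx - q.2.1 ^ 2 * hxx

/-- Transformations in normal form are point symmetries. -/
theorem isPointSymmetry_of_normalForm {Φ : OpenPartialHomeomorph Total Total}
    (hΦ : IsPointTransformation Φ) {τ ε a b c d K : ℝ}
    (hdet : a * d - b * c = ε) (hK : K ≠ 0) {O : Set Base} {h : Base → ℝ}
    (hh : ContDiffOn ℝ ∞ h O) (hk : ∀ q ∈ O, kolm h q = 0)
    (hw : ∀ p ∈ Φ.source, toBase p ∈ O ∧ 0 < c * p.2.2.1 + d)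
    (hform : ∀ p ∈ Φ.source, Φ p = normalForm τ ε a b c d K (h (toBase p)) p) :
    IsPointSymmetry Φ := by
  refine ⟨hΦ, ?_⟩
  intro Ω Ω' g g' hΩ hΩ' hg hg' hsub himg
  have hmem : ∀ q ∈ Ω, lift q (g q) ∈ Φ.source := fun q hq =>
    hsub (show lift q (g q) ∈ graphOver g Ω from ⟨hq, rfl⟩)
  have hΩO : Ω ⊆ O := fun q hq => (hw _ (hmem q hq)).1
  have hΦq : ∀ q ∈ Ω, Φ (lift q (g q)) =
      lift (baseMap τ ε a b c d q) (multiplier c d K q * (g q + h q)) := fun q hq => by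
    rw [hform _ (hmem q hq)]; rfl
  have hin : ∀ q ∈ Ω, baseMap τ ε a b c d q ∈ Ω' ∧
      multiplier c d K q * (g q + h q) = g' (baseMap τ ε a b c d q) := by
    intro q hq
    have : Φ (lift q (g q)) ∈ graphOver g' Ω' := himg ▸ ⟨_, ⟨hq, rfl⟩, rfl⟩
    rw [hΦq q hq] at this
    exact this
  have hsurj : ∀ q' ∈ Ω', ∃ q ∈ Ω, baseMap τ ε a b c d q = q' := by
    intro q' hq'
    have : lift q' (g' q') ∈ Φ '' graphOver g Ω := by
      rw [himg]; exact ⟨hq', rfl⟩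
    obtain ⟨p, ⟨hpΩ, hpu⟩, hp⟩ := this
    have hpl : p = lift (toBase p) (g (toBase p)) := by
      ext
      exacts [rfl, rfl, rfl, hpu]
    rw [hpl, hΦq _ hpΩ] at hp
    exact ⟨toBase p, hpΩ, congrArg toBase hp⟩
  have hhΩ := hh.mono hΩO
  have htrans : ∀ q ∈ Ω, kolm g' (baseMap τ ε a b c d q) = multiplier c d K q * kolm g q := by
    intro q hq
    rw [kolm_transform hdet hΩ hΩ' (hg.add hhΩ) hg' (fun q hq => (hw _ (hmem q hq)).2.ne')
      (fun q hq => (hin q hq).1) (fun q hq => (hin q hq).2.symm) hq]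
    change _ * kolm (fun q => g q + h q) q = _
    rw [kolm_add hΩ hg hhΩ hq, hk q (hΩO hq), add_zero]
  rw [isSolutionOn_iff hΩ hg, isSolutionOn_iff hΩ' hg']
  constructor
  · intro hs q' hq'
    obtain ⟨q, hq, rfl⟩ := hsurj q' hq'
    rw [htrans q hq, hs q hq, mul_zero]
  · intro hs q hq
    have h1 := htrans q hq
    rw [hs _ (hin q hq).1] at h1
    have hm : multiplier c d K q ≠ 0 := mul_ne_zero hK (Real.exp_pos _).ne'
    exact (mul_eq_zero.1 h1.symm).resolve_left hm

/-- The orientation-preserving transformations in normal form are point transformations. -/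
theorem exists_pointTransformation_normalForm {τ a b c d K : ℝ} (hdet : a * d - b * c = 1)
    (hK : K ≠ 0) {O : Set Base} (hO : IsOpen O) {h : Base → ℝ} (hh : ContDiffOn ℝ ∞ h O) :
    ∃ H : OpenPartialHomeomorph Total Total, IsPointTransformation H ∧
      H.source = {p | toBase p ∈ O ∧ 0 < c * p.2.2.1 + d} ∧
      ∀ p, H p = normalForm τ 1 a b c d K (h (toBase p)) p := by
  let S : Set Total := {p | toBase p ∈ O ∧ 0 < c * p.2.2.1 + d}
  -- The inverse on the base: on the image, `a - cY = 1/(cy + d)`, so the positivity of the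
  -- denominator passes to the target.
  let inv : Total → Base := fun q =>
    (q.1 - τ, q.2.1 / (a - c * q.2.2.1) ^ 2, (d * q.2.2.1 - b) / (a - c * q.2.2.1))
  let S' : Set Total := {q | 0 < a - c * q.2.2.1} ∩ inv ⁻¹' O
  let F : Total → Total := fun p => normalForm τ 1 a b c d K (h (toBase p)) p
  let G : Total → Total := fun q => lift (inv q)
    (q.2.2.2 / (K * Real.exp (c * q.2.1 / (a - c * q.2.2.1))) - h (inv q))
  have hA : IsOpen {q : Total | 0 < a - c * q.2.2.1} :=
    isOpen_lt (by fun_prop) (by fun_prop)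
  have sinv : ContDiffOn ℝ ∞ inv {q : Total | 0 < a - c * q.2.2.1} := by
    refine ContDiffOn.prodMk (ContDiff.contDiffOn (by fun_prop)) (ContDiffOn.prodMk
      (ContDiffOn.div (ContDiff.contDiffOn (by fun_prop)) (ContDiff.contDiffOn (by fun_prop)) ?_)
      (ContDiffOn.div (ContDiff.contDiffOn (by fun_prop)) (ContDiff.contDiffOn (by fun_prop)) ?_))
    · exact fun q hq => pow_ne_zero 2 (ne_of_gt hq)
    · exact fun q hq => ne_of_gt hq
  have oS : IsOpen S := by
    have h1 : IsOpen {p : Total | 0 < c * p.2.2.1 + d} := isOpen_lt (by fun_prop) (by fun_prop)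
    exact (hO.preimage (f := toBase) (by unfold toBase; fun_prop)).inter h1
  have oS' : IsOpen S' := sinv.continuousOn.isOpen_inter_preimage hA hO
  have hw : ∀ p ∈ S, a - c * ((a * p.2.2.1 + b) / (c * p.2.2.1 + d)) = 1 / (c * p.2.2.1 + d) := by
    intro p hp
    have := hp.2.ne'
    field_simp
    linear_combination hdet
  have hinv : ∀ p ∈ S, inv (F p) = toBase p := by
    intro p hp
    have h0 := hp.2.ne'
    have h1 := hw p hp
    simp only [inv, F, normalForm]
    rw [h1]
    refine Prod.ext (by simp) (Prod.ext ?_ ?_)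
    · simp only; field_simp
    · simp only
      rw [div_div_eq_mul_div, div_one]
      linear_combination d * div_mul_cancel₀ (a * p.2.2.1 + b) h0 + p.2.2.1 * hdet
  have hexp : ∀ p ∈ S, c * (F p).2.1 / (a - c * (F p).2.2.1)
      = c * p.2.1 / (c * p.2.2.1 + d) := by
    intro p hp
    have h0 := hp.2.ne'
    simp only [F, normalForm]
    rw [hw p hp]
    field_simp
  have hw' : ∀ q ∈ S', c * (inv q).2.2 + d = 1 / (a - c * q.2.2.1) := by
    intro q hq
    have h0 : a - c * q.2.2.1 ≠ 0 := ne_of_gt hq.1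
    simp only [inv]
    field_simp
    linear_combination hdet
  have sF : ContDiffOn ℝ ∞ F S := by
    have hb : ContDiffOn ℝ ∞ (fun p => h (toBase p)) S :=
      hh.comp (ContDiff.contDiffOn (by unfold toBase; fun_prop)) fun p hp => hp.1
    have hy : ContDiffOn ℝ ∞ (fun p : Total => c * p.2.2.1 + d) S :=
      ContDiff.contDiffOn (by fun_prop)
    have hne : ∀ p ∈ S, c * p.2.2.1 + d ≠ 0 := fun p hp => hp.2.ne'
    have hx : ContDiffOn ℝ ∞ (fun p : Total => c * p.2.1) S := ContDiff.contDiffOn (by fun_prop)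
    have hu : ContDiffOn ℝ ∞ (fun p : Total => p.2.2.2) S := ContDiff.contDiffOn (by fun_prop)
    refine ContDiffOn.prodMk (ContDiff.contDiffOn (by fun_prop)) (ContDiffOn.prodMk
      (ContDiffOn.div (ContDiff.contDiffOn (by fun_prop)) (hy.pow 2) ?_) (ContDiffOn.prodMk
      (ContDiffOn.div (ContDiff.contDiffOn (by fun_prop)) hy hne)
      ((contDiffOn_const.mul (hx.div hy hne).exp).mul (hu.add hb))))
    exact fun p hp => pow_ne_zero 2 (hne p hp)
  have sG : ContDiffOn ℝ ∞ G S' := by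
    have si : ContDiffOn ℝ ∞ inv S' := sinv.mono inter_subset_left
    have hb : ContDiffOn ℝ ∞ (fun p => h (inv p)) S' := hh.comp si fun p hp => hp.2
    have hy : ContDiffOn ℝ ∞ (fun p : Total => a - c * p.2.2.1) S' :=
      ContDiff.contDiffOn (by fun_prop)
    have hx : ContDiffOn ℝ ∞ (fun p : Total => c * p.2.1) S' := ContDiff.contDiffOn (by fun_prop)
    have hu : ContDiffOn ℝ ∞ (fun p : Total => p.2.2.2) S' := ContDiff.contDiffOn (by fun_prop)
    have hne : ∀ p ∈ S', a - c * p.2.2.1 ≠ 0 := fun p hp => ne_of_gt hp.1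
    refine si.fst.prodMk (si.snd.fst.prodMk (si.snd.snd.prodMk ((hu.div
      (contDiffOn_const.mul (hx.div hy hne).exp) ?_).sub hb)))
    exact fun p _ => mul_ne_zero hK (Real.exp_pos _).ne'
  let H : OpenPartialHomeomorph Total Total :=
    { toFun := F
      invFun := G
      source := S
      target := S'
      map_source' := by
        intro p hp
        refine ⟨?_, ?_⟩
        · change 0 < a - c * ((a * p.2.2.1 + b) / (c * p.2.2.1 + d))
          rw [hw p hp]
          exact one_div_pos.2 hp.2
        · change inv (F p) ∈ O
          rw [hinv p hp]; exact hp.1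
      map_target' := by
        intro q hq
        refine ⟨hq.2, ?_⟩
        change 0 < c * (inv q).2.2 + d
        rw [hw' q hq]
        exact one_div_pos.2 hq.1
      left_inv' := by
        intro p hp
        simp only [G]
        rw [hinv p hp, hexp p hp]
        have e : (F p).2.2.2 / (K * Real.exp (c * p.2.1 / (c * p.2.2.1 + d)))
            = p.2.2.2 + h (toBase p) :=
          mul_div_cancel_left₀ _ (mul_ne_zero hK (Real.exp_pos _).ne')
        rw [e, add_sub_cancel_right]
      right_inv' := by
        intro q hq
        have h0 : a - c * q.2.2.1 ≠ 0 := ne_of_gt hq.1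
        have h1 := hw' q hq
        have e1 : c * (G q).2.2.1 + d = 1 / (a - c * q.2.2.1) := h1
        have e2 : c * (G q).2.1 / (c * (G q).2.2.1 + d) = c * q.2.1 / (a - c * q.2.2.1) := by
          rw [e1]
          change c * (q.2.1 / (a - c * q.2.2.1) ^ 2) / _ = _
          field_simp
        simp only [F, normalForm]
        rw [e2, e1]
        refine Prod.ext ?_ (Prod.ext ?_ (Prod.ext ?_ ?_))
        · change q.1 - τ + τ = q.1
          ring
        · change 1 * (q.2.1 / (a - c * q.2.2.1) ^ 2) / (1 / (a - c * q.2.2.1)) ^ 2 = q.2.1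
          field_simp
        · change (a * ((d * q.2.2.1 - b) / (a - c * q.2.2.1)) + b) / (1 / (a - c * q.2.2.1))
            = q.2.2.1
          rw [div_div_eq_mul_div, div_one]
          linear_combination a * div_mul_cancel₀ (d * q.2.2.1 - b) h0 + q.2.2.1 * hdet
        · change K * Real.exp (c * q.2.1 / (a - c * q.2.2.1)) *
            (q.2.2.2 / (K * Real.exp (c * q.2.1 / (a - c * q.2.2.1))) - h (inv q) + h (inv q))
            = q.2.2.2
          rw [sub_add_cancel]
          exact mul_div_cancel₀ _ (mul_ne_zero hK (Real.exp_pos _).ne')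
      open_source := oS
      open_target := oS'
      continuousOn_toFun := sF.continuousOn
      continuousOn_invFun := sG.continuousOn }
  exact ⟨H, ⟨sF, sG⟩, rfl, fun p => rfl⟩

/-! ### Deformation to the identity -/

theorem IsPointTransformation.restrOpen {Φ : OpenPartialHomeomorph Total Total}
    (hΦ : IsPointTransformation Φ) {V : Set Total} (hV : IsOpen V) :
    IsPointTransformation (Φ.restrOpen V hV) := by
  refine ⟨hΦ.1.mono ?_, hΦ.2.mono ?_⟩
  · rw [OpenPartialHomeomorph.restrOpen_source]; exact inter_subset_left
  · intro q hq
    exact hq.1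

theorem IsPointSymmetry.restrOpen {Φ : OpenPartialHomeomorph Total Total}
    (hΦ : IsPointSymmetry Φ) {V : Set Total} (hV : IsOpen V) :
    IsPointSymmetry (Φ.restrOpen V hV) := by
  refine ⟨hΦ.1.restrOpen hV, fun Ω Ω' g g' h1 h2 h3 h4 h5 h6 => ?_⟩
  refine hΦ.2 Ω Ω' g g' h1 h2 h3 h4 (h5.trans ?_) h6
  rw [OpenPartialHomeomorph.restrOpen_source]; exact inter_subset_left

/-- A function with vanishing `u`-derivative on a vertically connected open set descends to the
base. -/
theorem exists_descend {U : Set Total} (hU : IsOpen U) (hv : VerticallyConnected U)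
    {h : Total → ℝ} (hh : ContDiffOn ℝ ∞ h U) (hu : ∀ p ∈ U, pd eu h p = 0)
    (heq : ∀ p ∈ U, pd et h p + p.2.1 * pd ey h p = p.2.1 ^ 2 * pd ex (pd ex h) p) :
    ∃ (O : Set Base) (f : Base → ℝ), IsOpen O ∧ ContDiffOn ℝ ∞ f O ∧ (∀ q ∈ O, kolm f q = 0) ∧
      ∀ p ∈ U, toBase p ∈ O ∧ f (toBase p) = h p := by
  classical
  have hcont : ∀ u : ℝ, Continuous fun b : Base => lift b u := fun u => by fun_prop
  let O : Set Base := ⋃ u : ℝ, (fun b => lift b u) ⁻¹' U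
  have hOo : IsOpen O := isOpen_iUnion fun u => hU.preimage (hcont u)
  have hO : ∀ b ∈ O, ∃ u, lift b u ∈ U := fun b hb => by simpa [O] using hb
  -- The value at any chosen point of the fibre, and `0` over points not covered by `U`. The choice
  -- is immaterial because `h` is constant on a fibre, which is an open interval.
  let f : Base → ℝ := fun b => if hb : ∃ u, lift b u ∈ U then h (lift b hb.choose) else 0
  have hf : ∀ b u, lift b u ∈ U → f b = h (lift b u) := by
    intro b u hbu
    have hb : ∃ u, lift b u ∈ U := ⟨u, hbu⟩
    simp only [f, dif_pos hb]
    have hso : IsOpen {u : ℝ | ((b.1, b.2.1, b.2.2, u) : Total) ∈ U} :=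
      hU.preimage (f := fun u : ℝ => ((b.1, b.2.1, b.2.2, u) : Total)) (by fun_prop)
    have hd : ∀ u ∈ {u : ℝ | ((b.1, b.2.1, b.2.2, u) : Total) ∈ U},
        HasDerivAt (fun u => h (b.1, b.2.1, b.2.2, u)) 0 u := by
      intro u hu'
      have h1 := deriv_line (differentiableAt_of_smooth hU hh hu')
        (hasDerivAt_line_eu b.1 b.2.1 b.2.2 u) rfl
      rwa [hu _ hu'] at h1
    exact hso.is_const_of_deriv_eq_zero (hv b.1 b.2.1 b.2.2).isPreconnected
      (fun s hs => (hd s hs).differentiableAt.differentiableWithinAt)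
      (fun s hs => (hd s hs).deriv) hb.choose_spec hbu
  have hs : ∀ u : ℝ, ContDiffOn ℝ ∞ (fun b => h (lift b u)) ((fun b => lift b u) ⁻¹' U) :=
    fun u => hh.comp (ContDiff.contDiffOn (by fun_prop)) fun b hb => hb
  have hpd : ∀ (k : Total → ℝ), ContDiffOn ℝ ∞ k U → ∀ u, ∀ b ∈ (fun b => lift b u) ⁻¹' U,
      ∀ v : Base, pd v (fun b => k (lift b u)) b = pd et k (lift b u) * v.1
        + pd ex k (lift b u) * v.2.1 + pd ey k (lift b u) * v.2.2 := by
    intro k hk u b hb v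
    have := pd_comp_total (E := Base) (T := fun b => b.1) (X := fun b => b.2.1)
      (Y := fun b => b.2.2) (W := fun _ => u) (p := b)
      (differentiableAt_of_smooth hU hk hb) (by fun_prop) (by fun_prop) (by fun_prop)
      (differentiableAt_const u) v
    rw [pd_const, pd_base_t, pd_base_x, pd_base_y, mul_zero, add_zero] at this
    exact this
  refine ⟨O, f, hOo, ?_, ?_, ?_⟩
  · intro b hb
    obtain ⟨u, hu'⟩ := hO b hb
    have hn : (fun b => lift b u) ⁻¹' U ∈ nhds b := (hU.preimage (hcont u)).mem_nhds hu'
    have h1 : ContDiffAt ℝ ∞ (fun b => h (lift b u)) b := (hs u).contDiffAt hn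
    refine (h1.congr_of_eventuallyEq ?_).contDiffWithinAt
    filter_upwards [hn] with b' hb'
    exact hf b' u hb'
  · intro b hb
    obtain ⟨u, hu'⟩ := hO b hb
    have ho := hU.preimage (hcont u)
    have e : EqOn f (fun b => h (lift b u)) ((fun b => lift b u) ⁻¹' U) := fun b' hb' =>
      hf b' u hb'
    have e1 : ∀ v : Base, ∀ b' ∈ (fun b => lift b u) ⁻¹' U, pd v f b' =
        pd et h (lift b' u) * v.1 + pd ex h (lift b' u) * v.2.1 + pd ey h (lift b' u) * v.2.2 :=
      fun v b' hb' => by rw [pd_congr ho e hb', hpd h hh u b' hb']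
    have e2 : EqOn (pd bx f) (fun b => pd ex h (lift b u)) ((fun b => lift b u) ⁻¹' U) :=
      fun b' hb' => by rw [e1 bx b' hb']; simp
    rw [kolm, e1 bt b hu', e1 bY b hu', pd_congr ho e2 hu', hpd _ (smooth_pd hU hh ex) u b hu']
    have := heq _ hu'
    simp only at this ⊢
    linear_combination this
  · intro p hp
    exact ⟨mem_iUnion.2 ⟨p.2.2.2, hp⟩, hf (toBase p) p.2.2.2 hp⟩

theorem normalForm_identity (p : Total) : normalForm 0 1 1 0 0 1 1 0 p = p := by
  ext <;> simp [normalForm]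

/-- A family of transformations in normal form whose parameters depend smoothly on the
parameter is smooth. -/
theorem contDiffOn_normalForm_family {τ a b c d K : ℝ → ℝ} {J : Set ℝ} {V : Set Total}
    {z : ℝ × Total → ℝ} (hτ : ContDiffOn ℝ ∞ τ J) (ha : ContDiffOn ℝ ∞ a J)
    (hb : ContDiffOn ℝ ∞ b J) (hc : ContDiffOn ℝ ∞ c J) (hd : ContDiffOn ℝ ∞ d J)
    (hK : ContDiffOn ℝ ∞ K J) (hz : ContDiffOn ℝ ∞ z (J ×ˢ V))
    (hw : ∀ s ∈ J, ∀ p ∈ V, c s * p.2.2.1 + d s ≠ 0) :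
    ContDiffOn ℝ ∞ (fun q : ℝ × Total =>
      normalForm (τ q.1) 1 (a q.1) (b q.1) (c q.1) (d q.1) (K q.1) (z q) q.2) (J ×ˢ V) := by
  have up : ∀ {f : ℝ → ℝ}, ContDiffOn ℝ ∞ f J →
      ContDiffOn ℝ ∞ (fun q : ℝ × Total => f q.1) (J ×ˢ V) := fun hf =>
    hf.comp contDiffOn_fst fun q hq => hq.1
  have ht : ContDiffOn ℝ ∞ (fun q : ℝ × Total => q.2.1) (J ×ˢ V) :=
    ContDiff.contDiffOn (by fun_prop)
  have hx : ContDiffOn ℝ ∞ (fun q : ℝ × Total => q.2.2.1) (J ×ˢ V) :=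
    ContDiff.contDiffOn (by fun_prop)
  have hy : ContDiffOn ℝ ∞ (fun q : ℝ × Total => q.2.2.2.1) (J ×ˢ V) :=
    ContDiff.contDiffOn (by fun_prop)
  have hu : ContDiffOn ℝ ∞ (fun q : ℝ × Total => q.2.2.2.2) (J ×ˢ V) :=
    ContDiff.contDiffOn (by fun_prop)
  have hden := ((up hc).mul hy).add (up hd)
  have hne : ∀ q ∈ J ×ˢ V, c q.1 * q.2.2.2.1 + d q.1 ≠ 0 := fun q hq => hw _ hq.1 _ hq.2
  exact (ht.add (up hτ)).prodMk (((contDiffOn_const.mul hx).div (hden.pow 2)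
    fun q hq => pow_ne_zero 2 (hne q hq)).prodMk
    (((((up ha).mul hy).add (up hb)).div hden hne).prodMk
    (((up hK).mul (((up hc).mul hx).div hden hne).exp).mul (hu.add hz))))

/-- A point symmetry with connected and vertically connected domain differs from a continuous one
by the involution with the same signs of `U_u` and `Y_y`. -/
theorem IsPointSymmetry.factorsOn (k : ℕ∞) {Φ : OpenPartialHomeomorph Total Total}
    (hΦ : IsPointSymmetry Φ) (hconn : IsConnected Φ.source) (hv : VerticallyConnected Φ.source)
    {D : Total ≃ₜ Total} {δ ε : ℝ} (hδ : δ = 1 ∨ δ = -1) (hε : ε = 1 ∨ ε = -1)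
    (hD : ∀ p, D p = (p.1, ε * p.2.1, ε * p.2.2.1, δ * p.2.2.2))
    (hU : ∀ p ∈ Φ.source, 0 < δ * pd eu (cU Φ) p) (hY : ∀ p ∈ Φ.source, 0 < ε * pd ey (cY Φ) p) :
    FactorsOn k Φ D Φ.source := by
  obtain ⟨τ, ε', a, b, c, d, K, h, hε', hdet, sh, hhu, hheq, hform⟩ := hΦ.exists_normalForm hconn
  obtain ⟨O, f, hO, sf, hkf, hfO⟩ := exists_descend Φ.open_source hv sh hhu hheq
  obtain ⟨p₀, hp₀⟩ := hconn.nonempty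
  obtain rfl : ε = ε' := by
    have h1 := (hform p₀ hp₀).2.1
    have h2 := hY p₀ hp₀
    rcases hε with rfl | rfl <;> rcases hε' with rfl | rfl <;> first | rfl | linarith
  have hδK : 0 < δ * K := by
    have h1 := (hform p₀ hp₀).2.2.1
    have h2 := hU p₀ hp₀
    have h3 := mul_pos h1 h2
    by_contra hneg
    nlinarith [mul_self_nonneg (pd eu (cU Φ) p₀)]
  have hεε : ε * ε = 1 := by rcases hε with rfl | rfl <;> norm_num
  have hδδ : δ * δ = 1 := by rcases hδ with rfl | rfl <;> norm_num
  -- The row `(c, d)` moves along the segment from `(0, 1)`. The denominator at `y` is then a convex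
  -- combination of `1` and `cy + d`, so it stays positive on the whole domain.
  let cs : ℝ → ℝ := fun s => s * c
  let ds : ℝ → ℝ := fun s => 1 - s + s * d
  let ns : ℝ → ℝ := fun s => cs s ^ 2 + ds s ^ 2
  -- The row `(d, -c)/(c² + d²)` completes `(c, d)` to determinant one, and every other completion
  -- differs from it by a multiple of `(c, d)`. Here `m` is the multiple that yields `(εa, εb)`;
  -- scaling it by `s` joins this row to `(1, 0)` at `s = 0`.
  let m : ℝ := (ε * a * c + ε * b * d) / (c ^ 2 + d ^ 2)
  let as : ℝ → ℝ := fun s => ds s / ns s + s * m * cs s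
  let bs : ℝ → ℝ := fun s => -cs s / ns s + s * m * ds s
  let Ks : ℝ → ℝ := fun s => 1 - s + s * (δ * K)
  have hpos : ∀ s ∈ Icc (0 : ℝ) 1, ∀ r : ℝ, 0 < r → 0 < 1 - s + s * r := by
    intro s hs r hr
    rcases eq_or_lt_of_le hs.2 with rfl | hlt
    · linarith
    · have := mul_nonneg hs.1 hr.le
      linarith
  have hws : ∀ s ∈ Icc (0 : ℝ) 1, ∀ p ∈ Φ.source, 0 < cs s * p.2.2.1 + ds s := by
    intro s hs p hp
    have := hpos s hs _ (hform p hp).1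
    have e : cs s * p.2.2.1 + ds s = 1 - s + s * (c * p.2.2.1 + d) := by
      simp only [cs, ds]; ring
    rwa [e]
  have hns : ∀ s ∈ Icc (0 : ℝ) 1, ns s ≠ 0 := by
    intro s hs h0
    have h1 := hws s hs p₀ hp₀
    have hc0 : cs s = 0 := by nlinarith [sq_nonneg (cs s), sq_nonneg (ds s)]
    have hd0 : ds s = 0 := by nlinarith [sq_nonneg (cs s), sq_nonneg (ds s)]
    rw [hc0, hd0] at h1
    simp at h1
  have hdets : ∀ s ∈ Icc (0 : ℝ) 1, as s * ds s - bs s * cs s = 1 := by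
    intro s hs
    have h0 := hns s hs
    have e : as s * ds s - bs s * cs s = (cs s ^ 2 + ds s ^ 2) / ns s := by
      simp only [as, bs]; ring
    rw [e]; exact div_self h0
  have hmem1 : (1 : ℝ) ∈ Icc (0 : ℝ) 1 := ⟨zero_le_one, le_rfl⟩
  have hmem0 : (0 : ℝ) ∈ Icc (0 : ℝ) 1 := ⟨le_rfl, zero_le_one⟩
  have hex : ∀ s, ∃ H : OpenPartialHomeomorph Total Total, s ∈ Icc (0 : ℝ) 1 →
      IsPointSymmetry H ∧ H.source = Φ.source ∧ ∀ p ∈ Φ.source,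
        H p = normalForm (s * τ) 1 (as s) (bs s) (cs s) (ds s) (Ks s) (s * f (toBase p)) p := by
    intro s
    by_cases hs : s ∈ Icc (0 : ℝ) 1
    swap
    -- Outside `[0, 1]` the family is arbitrary.
    · exact ⟨Φ, fun h => absurd h hs⟩
    have sfs : ContDiffOn ℝ ∞ (fun q => s * f q) O := contDiffOn_const.mul sf
    have hKs : Ks s ≠ 0 := (hpos s hs _ hδK).ne'
    obtain ⟨H, hH, hHs, hHf⟩ := exists_pointTransformation_normalForm (τ := s * τ)
      (hdets s hs) hKs hO sfs
    -- Here the descent of `h` to the base matters: it makes each intermediate map injective. If `h`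
    -- differed between components of a fibre, `u + s h` could identify two points.
    have hsrc : (H.restrOpen Φ.source Φ.open_source).source = Φ.source := by
      rw [OpenPartialHomeomorph.restrOpen_source, hHs]
      exact inter_eq_right.2 fun p hp => ⟨(hfO p hp).1, hws s hs p hp⟩
    refine ⟨H.restrOpen Φ.source Φ.open_source, fun _ => ⟨?_, hsrc, fun p _ => hHf p⟩⟩
    refine isPointSymmetry_of_normalForm (hH.restrOpen Φ.open_source) (hdets s hs) hKs sfs
      (fun q hq => by rw [kolm_const_mul hO sf s hq, hkf q hq, mul_zero]) ?_ (fun p _ => hHf p)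
    intro p hp
    rw [hsrc] at hp
    exact ⟨(hfO p hp).1, hws s hs p hp⟩
  choose H hH using hex
  obtain ⟨hH1s, hH1src, hH1f⟩ := hH 1 hmem1
  refine ⟨H 1, ⟨H, fun s hs => ⟨(hH s hs).1, (hH s hs).2.1.trans hH1src.symm⟩, ?_, ?_, ?_⟩,
    hH1src, ?_⟩
  · rw [hH1src]
    have sid : ∀ r : ℝ, ContDiffOn ℝ ∞ (fun s : ℝ => s * r) (Icc 0 1) := fun r =>
      ContDiff.contDiffOn (by fun_prop)
    have saff : ∀ r : ℝ, ContDiffOn ℝ ∞ (fun s : ℝ => 1 - s + s * r) (Icc 0 1) := fun r =>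
      ContDiff.contDiffOn (by fun_prop)
    have scs : ContDiffOn ℝ ∞ cs (Icc 0 1) := sid c
    have sds : ContDiffOn ℝ ∞ ds (Icc 0 1) := saff d
    have sns : ContDiffOn ℝ ∞ ns (Icc 0 1) := (scs.pow 2).add (sds.pow 2)
    have hz : ContDiffOn ℝ ∞ (fun q : ℝ × Total => q.1 * f (toBase q.2))
        (Icc (0 : ℝ) 1 ×ˢ Φ.source) :=
      contDiffOn_fst.mul (sf.comp (ContDiff.contDiffOn (by unfold toBase; fun_prop))
        fun q hq => (hfO q.2 hq.2).1)
    have := contDiffOn_normalForm_family (sid τ) ((sds.div sns hns).add ((sid m).mul scs))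
      ((scs.neg.div sns hns).add ((sid m).mul sds)) scs sds (saff (δ * K)) hz
      fun s hs p hp => (hws s hs p hp).ne'
    refine (this.congr fun q hq => ?_).of_le (by exact_mod_cast le_top)
    exact (hH q.1 hq.1).2.2 q.2 hq.2
  · intro p hp
    rw [hH1src] at hp
    rw [(hH 0 hmem0).2.2 p hp]
    simp [as, bs, cs, ds, ns, Ks, normalForm_identity]
  · intro p _
    rfl
  · intro p hp
    obtain ⟨h0, -, -, hΦp⟩ := hform p hp
    have hn1 : c ^ 2 + d ^ 2 ≠ 0 := by
      have := hns 1 hmem1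
      simpa [ns, cs, ds] using this
    have ec : cs 1 = c := by simp [cs]
    have ed : ds 1 = d := by simp [ds]
    have ea : as 1 = ε * a := by
      simp only [as, ns, ec, ed, m]
      field_simp
      linear_combination (-(ε * d)) * hdet - d * hεε
    have eb : bs 1 = ε * b := by
      simp only [bs, ns, ec, ed, m]
      field_simp
      linear_combination (ε * c) * hdet + c * hεε
    have eK : Ks 1 = δ * K := by simp [Ks]
    rw [hΦp]
    simp only
    rw [hD, hH1f p hp, ea, eb, ec, ed, eK, one_mul, one_mul, (hfO p hp).2]
    simp only [normalForm]
    refine Prod.ext rfl (Prod.ext ?_ (Prod.ext ?_ ?_))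
    · simp only; ring
    · simp only
      have : ε * ((ε * a * p.2.2.1 + ε * b) / (c * p.2.2.1 + d))
        = ε * ε * ((a * p.2.2.1 + b) / (c * p.2.2.1 + d)) := by ring
      rw [this, hεε, one_mul]
    · simp only
      linear_combination (-(K * Real.exp (c * p.2.1 / (c * p.2.2.1 + d)) * (p.2.2.2 + h p))) * hδδ

/-! ### The signs of `U_u` and `Y_y` -/

/-- Along a continuous family of transformations that starts at the identity and for which a
derivative `∂(L ∘ H_s)/∂e` does not vanish, this derivative stays positive. -/
theorem pd_pos_of_family {H : ℝ → Total → Total} {V : Set Total} (hV : IsOpen V)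
    (hcont : ContinuousOn (fun q : ℝ × Total => H q.1 q.2) (Icc (0 : ℝ) 1 ×ˢ V))
    (h0 : EqOn (H 0) id V) (L : Total →L[ℝ] ℝ) {e : Total} (hLe : L e = 1)
    (hd : ∀ s ∈ Icc (0 : ℝ) 1, ∀ p ∈ V, DifferentiableAt ℝ (fun p => L (H s p)) p)
    (hne : ∀ s ∈ Icc (0 : ℝ) 1, ∀ p ∈ V, pd e (fun p => L (H s p)) p ≠ 0) {p : Total}
    (hp : p ∈ V) : 0 < pd e (fun p => L (H 1 p)) p := by
  have hmem1 : (1 : ℝ) ∈ Icc (0 : ℝ) 1 := ⟨zero_le_one, le_rfl⟩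
  have hmem0 : (0 : ℝ) ∈ Icc (0 : ℝ) 1 := ⟨le_rfl, zero_le_one⟩
  have hline : ∀ r : ℝ, HasDerivAt (fun r : ℝ => p + r • e) e r := fun r => by
    simpa using ((hasDerivAt_id r).smul_const e).const_add p
  have hopen : IsOpen ((fun r : ℝ => p + r • e) ⁻¹' V) :=
    hV.preimage (by fun_prop)
  obtain ⟨ρ, hρ, hball⟩ := Metric.isOpen_iff.1 hopen 0 (by simpa using hp)
  have hin : ∀ r ∈ Ico (0 : ℝ) ρ, p + r • e ∈ V := fun r hr => hball (by
    rw [Metric.mem_ball, Real.dist_eq, sub_zero, abs_of_nonneg hr.1]; exact hr.2)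
  have hder : ∀ s ∈ Icc (0 : ℝ) 1, ∀ r ∈ Ico (0 : ℝ) ρ,
      HasDerivAt (fun r : ℝ => L (H s (p + r • e))) (pd e (fun p => L (H s p)) (p + r • e)) r :=
    fun s hs r hr => deriv_line (f := fun p => L (H s p)) (hd s hs _ (hin r hr)) (hline r) rfl
  -- Derivatives need not be continuous in `s` when `k = 0`, so increments are used. By Rolle's
  -- theorem the increment of `L ∘ H_s` along `e` never vanishes; it is continuous in `s` and equals
  -- `r > 0` at `s = 0`.
  have hdiff : ∀ r ∈ Ioo (0 : ℝ) ρ, 0 < L (H 1 (p + r • e)) - L (H 1 p) := by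
    intro r hr
    have hrV := hin r ⟨hr.1.le, hr.2⟩
    have hc : ∀ q ∈ V, ContinuousOn (fun s : ℝ => L (H s q)) (Icc 0 1) := fun q hq =>
      L.continuous.comp_continuousOn (hcont.comp (f := fun s : ℝ => (s, q)) (by fun_prop)
        fun s hs => ⟨hs, hq⟩)
    have hnz : ∀ s ∈ Icc (0 : ℝ) 1, L (H s (p + r • e)) - L (H s p) ≠ 0 := by
      intro s hs hz
      have hsub : ∀ r' ∈ Icc (0 : ℝ) r, r' ∈ Ico (0 : ℝ) ρ := fun r' hr' =>
        ⟨hr'.1, hr'.2.trans_lt hr.2⟩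
      obtain ⟨r', hr', hz'⟩ := exists_hasDerivAt_eq_zero hr.1
        (fun r' hr' => (hder s hs r' (hsub r' hr')).continuousAt.continuousWithinAt)
        (by simpa using (sub_eq_zero.1 hz).symm)
        (fun r' hr' => hder s hs r' (hsub r' (Ioo_subset_Icc_self hr')))
      exact hne s hs _ (hin r' (hsub r' (Ioo_subset_Icc_self hr'))) hz'
    rcases sign_const_of_ne_zero (convex_Icc (0 : ℝ) 1).isPreconnected ((hc _ hrV).sub (hc p hp))
      hnz with h | h
    · exact h 1 hmem1
    · have : L (H 0 (p + r • e)) - L (H 0 p) < 0 := h 0 hmem0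
      rw [h0 hrV, h0 hp] at this
      simp only [id, map_add, map_smul, hLe, smul_eq_mul, mul_one] at this
      linarith [hr.1]
  have h1 := (hder 1 hmem1 0 ⟨le_rfl, hρ⟩).tendsto_slope_zero_right
  -- The limit of positive difference quotients is only nonnegative; strictness comes from the
  -- nonvanishing hypothesis.
  have hge : 0 ≤ pd e (fun p => L (H 1 p)) (p + (0 : ℝ) • e) := by
    refine ge_of_tendsto h1 ?_
    filter_upwards [Ioo_mem_nhdsGT hρ] with r hr
    have := hdiff r hr
    simp only [zero_add, zero_smul, add_zero, smul_eq_mul]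
    exact mul_nonneg (inv_nonneg.2 hr.1.le) this.le
  rw [zero_smul, add_zero] at hge
  exact lt_of_le_of_ne hge (hne 1 hmem1 p hp).symm

/-- Continuous point symmetries have positive `U_u` and `Y_y`. -/
theorem IsContinuousSymmetry.signs {k : ℕ∞} {C : OpenPartialHomeomorph Total Total}
    (hC : IsContinuousSymmetry k C) {p : Total} (hp : p ∈ C.source) :
    0 < pd eu (cU C) p ∧ 0 < pd ey (cY C) p := by
  obtain ⟨H, hH, hcont, h0, h1⟩ := hC
  let Lu : Total →L[ℝ] ℝ := (ContinuousLinearMap.snd ℝ ℝ ℝ).comp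
    ((ContinuousLinearMap.snd ℝ ℝ (ℝ × ℝ)).comp (ContinuousLinearMap.snd ℝ ℝ (ℝ × ℝ × ℝ)))
  let Ly : Total →L[ℝ] ℝ := (ContinuousLinearMap.fst ℝ ℝ ℝ).comp
    ((ContinuousLinearMap.snd ℝ ℝ (ℝ × ℝ)).comp (ContinuousLinearMap.snd ℝ ℝ (ℝ × ℝ × ℝ)))
  have hd : ∀ s ∈ Icc (0 : ℝ) 1, ∀ p ∈ C.source, DifferentiableAt ℝ (H s) p := by
    intro s hs p hp
    obtain ⟨hsym, hsrc⟩ := hH s hs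
    rw [← hsrc] at hp
    exact (hsym.1.1.contDiffAt ((H s).open_source.mem_nhds hp)).differentiableAt (by simp)
  have hU := pd_pos_of_family C.open_source hcont.continuousOn h0 Lu (e := eu) rfl
    (fun s hs p hp => Lu.differentiableAt.comp p (hd s hs p hp))
    (fun s hs p hp => (hH s hs).1.cU_eu_ne_zero (by rw [(hH s hs).2]; exact hp)) hp
  have hY := pd_pos_of_family C.open_source hcont.continuousOn h0 Ly (e := ey) rfl
    (fun s hs p hp => Ly.differentiableAt.comp p (hd s hs p hp))
    (fun s hs p hp => (hH s hs).1.cY_ey_ne_zero (by rw [(hH s hs).2]; exact hp)) hp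
  have eU : pd eu (cU C) p = pd eu (fun p => Lu (H 1 p)) p :=
    pd_congr C.open_source (fun q hq => congrArg Lu (h1 hq).symm) hp eu
  have eY : pd ey (cY C) p = pd ey (fun p => Ly (H 1 p)) p :=
    pd_congr C.open_source (fun q hq => congrArg Ly (h1 hq).symm) hp ey
  rw [eU, eY]
  exact ⟨hU, hY⟩

/-- The derivatives `U_u` and `Y_y` are multiplicative. -/
theorem IsPointSymmetry.signs_comp {Φ Ψ : OpenPartialHomeomorph Total Total}
    (hΦ : IsPointSymmetry Φ) (hΨ : IsPointSymmetry Ψ) {Θ : Total → Total} {V : Set Total}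
    (hV : IsOpen V) (hs : V ⊆ (Ψ.trans Φ).source) (he : EqOn Θ (fun p => Φ (Ψ p)) V) {p : Total}
    (hp : p ∈ V) :
    pd eu (cU Θ) p = pd eu (cU Φ) (Ψ p) * pd eu (cU Ψ) p ∧
      pd ey (cY Θ) p = pd ey (cY Φ) (Ψ p) * pd ey (cY Ψ) p := by
  have hpΨ : p ∈ Ψ.source := by
    have := hs hp
    rw [OpenPartialHomeomorph.trans_source] at this
    exact this.1
  have hpΦ : Ψ p ∈ Φ.source := by
    have := hs hp
    rw [OpenPartialHomeomorph.trans_source] at this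
    exact this.2
  have dT := differentiableAt_of_smooth Ψ.open_source hΨ.1.smooth_cT hpΨ
  have dX := differentiableAt_of_smooth Ψ.open_source hΨ.1.smooth_cX hpΨ
  have dY := differentiableAt_of_smooth Ψ.open_source hΨ.1.smooth_cY hpΨ
  have dU := differentiableAt_of_smooth Ψ.open_source hΨ.1.smooth_cU hpΨ
  have chain : ∀ f : Total → ℝ, ContDiffOn ℝ ∞ f Φ.source → ∀ v, pd v (fun q => f (Ψ q)) p
      = pd et f (Ψ p) * pd v (cT Ψ) p + pd ex f (Ψ p) * pd v (cX Ψ) p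
        + pd ey f (Ψ p) * pd v (cY Ψ) p + pd eu f (Ψ p) * pd v (cU Ψ) p := fun f hf v =>
    pd_comp_total (differentiableAt_of_smooth Φ.open_source hf hpΦ) dT dX dY dU v
  have eU : EqOn (cU Θ) (fun q => cU Φ (Ψ q)) V := fun q hq =>
    congrArg (fun w : Total => w.2.2.2) (he hq)
  have eY : EqOn (cY Θ) (fun q => cY Φ (Ψ q)) V := fun q hq =>
    congrArg (fun w : Total => w.2.2.1) (he hq)
  -- The chain rule leaves a single product in each case: `T`, `X` and `Y` do not depend on `u`, and
  -- `Y` depends on `y` alone.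
  rw [pd_congr hV eU hp, pd_congr hV eY hp, chain _ hΦ.1.smooth_cU, chain _ hΦ.1.smooth_cY,
    hΨ.pd_cT hpΨ, hΨ.pd_cT hpΨ, hΨ.pd_cX hpΨ eu, hΨ.pd_cY hpΨ eu, hΦ.pd_cY hpΦ et,
    hΦ.pd_cY hpΦ ex, hΦ.pd_cY hpΦ eu]
  constructor <;> simp

/-! ### The four involutions and the factorization -/

/-- `D` is the involution that multiplies `x` and `y` by `ε` and `u` by `δ`. -/
def IsSignMap (D : Total ≃ₜ Total) (δ ε : ℝ) : Prop :=
  (δ = 1 ∨ δ = -1) ∧ (ε = 1 ∨ ε = -1) ∧ ∀ p, D p = (p.1, ε * p.2.1, ε * p.2.2.1, δ * p.2.2.2)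

theorem isSignMap_one : IsSignMap 1 1 1 := ⟨.inl rfl, .inl rfl, fun p => by simp⟩

theorem isSignMap_involI : IsSignMap involI (-1) 1 :=
  ⟨.inr rfl, .inl rfl, fun p => by simp [involI]⟩

theorem isSignMap_involJ : IsSignMap involJ 1 (-1) :=
  ⟨.inl rfl, .inr rfl, fun p => by simp [involJ]⟩

theorem isSignMap_involI_mul_involJ : IsSignMap (involI * involJ) (-1) (-1) :=
  ⟨.inr rfl, .inr rfl, fun p => by
    change involI (involJ p) = _
    simp [involI, involJ]⟩

theorem exists_isSignMap {δ ε : ℝ} (hδ : δ = 1 ∨ δ = -1) (hε : ε = 1 ∨ ε = -1) :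
    ∃ D ∈ ({1, involI, involJ, involI * involJ} : Set (Total ≃ₜ Total)), IsSignMap D δ ε := by
  rcases hδ with rfl | rfl <;> rcases hε with rfl | rfl
  · exact ⟨1, by simp, isSignMap_one⟩
  · exact ⟨involJ, by simp, isSignMap_involJ⟩
  · exact ⟨involI, by simp, isSignMap_involI⟩
  · exact ⟨involI * involJ, by simp, isSignMap_involI_mul_involJ⟩

theorem isSignMap_of_mem {D : Total ≃ₜ Total}
    (hD : D ∈ ({1, involI, involJ, involI * involJ} : Set (Total ≃ₜ Total))) :
    ∃ δ ε, IsSignMap D δ ε := by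
  rcases hD with rfl | rfl | rfl | rfl
  exacts [⟨_, _, isSignMap_one⟩, ⟨_, _, isSignMap_involI⟩, ⟨_, _, isSignMap_involJ⟩,
    ⟨_, _, isSignMap_involI_mul_involJ⟩]

theorem IsSignMap.isPointSymmetry {D : Total ≃ₜ Total} {δ ε : ℝ} (hD : IsSignMap D δ ε) :
    IsPointSymmetry D.toOpenPartialHomeomorph := by
  obtain ⟨hδ, hε, hDp⟩ := hD
  have hεε : ε * ε = 1 := by rcases hε with rfl | rfl <;> norm_num
  have hδδ : δ * δ = 1 := by rcases hδ with rfl | rfl <;> norm_num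
  have hs : ContDiff ℝ ∞ D := by
    rw [show (D : Total → Total) = fun p => (p.1, ε * p.2.1, ε * p.2.2.1, δ * p.2.2.2) from
      funext hDp]
    fun_prop
  have hinv : ∀ p, D.symm p = D p := fun p => by
    rw [Homeomorph.symm_apply_eq, hDp, hDp]
    simp only [← mul_assoc, hεε, hδδ, one_mul]
  have hs' : ContDiff ℝ ∞ D.symm := by
    rwa [show (D.symm : Total → Total) = D from funext hinv]
  have htr : IsPointTransformation D.toOpenPartialHomeomorph := ⟨hs.contDiffOn, hs'.contDiffOn⟩
  refine isPointSymmetry_of_normalForm (τ := 0) (ε := ε) (a := ε) (b := 0) (c := 0) (d := 1)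
    (K := δ) (O := univ) (h := fun _ => 0) htr (by ring) ?_ contDiffOn_const ?_ ?_ ?_
  · rcases hδ with rfl | rfl <;> norm_num
  · intro q _
    have e : ∀ v : Base, pd v (fun _ : Base => (0 : ℝ)) = fun _ => 0 := fun v =>
      funext fun b => pd_const v 0 b
    simp only [kolm, e]
    ring
  · intro p _
    simp
  · intro p _
    change D p = _
    rw [hDp]
    simp [normalForm]

theorem verticallyConnected_ball (p : Total) (r : ℝ) : VerticallyConnected (Metric.ball p r) := by
  intro t x y
  refine ⟨fun u hu u' hu' w hw => ?_⟩
  simp only [mem_ofPred_eq, Metric.mem_ball, Prod.dist_eq, max_lt_iff, Real.dist_eq,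
    abs_lt] at hu hu' ⊢
  exact ⟨hu.1, hu.2.1, hu.2.2.1, by linarith [hw.1], by linarith [hw.2]⟩

/-- A point symmetry factors near every point through the involution with the same signs. -/
theorem IsPointSymmetry.factorsOn_ball (k : ℕ∞) {Φ : OpenPartialHomeomorph Total Total}
    (hΦ : IsPointSymmetry Φ) {D : Total ≃ₜ Total} {δ ε : ℝ} (hD : IsSignMap D δ ε)
    (hU : ∀ p ∈ Φ.source, 0 < δ * pd eu (cU Φ) p) (hY : ∀ p ∈ Φ.source, 0 < ε * pd ey (cY Φ) p)
    {p : Total} {r : ℝ} (hr : 0 < r) (hsub : Metric.ball p r ⊆ Φ.source) :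
    FactorsOn k Φ D (Metric.ball p r) := by
  have hsrc : (Φ.restrOpen (Metric.ball p r) Metric.isOpen_ball).source = Metric.ball p r := by
    rw [OpenPartialHomeomorph.restrOpen_source]; exact inter_eq_right.2 hsub
  have h := (hΦ.restrOpen (V := Metric.ball p r) Metric.isOpen_ball).factorsOn k
    (by rw [hsrc]; exact (convex_ball p r).isConnected (Metric.nonempty_ball.2 hr))
    (by rw [hsrc]; exact verticallyConnected_ball p r) hD.1 hD.2.1 hD.2.2
    (fun q hq => hU q (by rw [hsrc] at hq; exact hsub hq))
    (fun q hq => hY q (by rw [hsrc] at hq; exact hsub hq))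
  rw [hsrc] at h
  exact h

/-- The signs of an involution through which a point symmetry factors. -/
theorem FactorsOn.signs {k : ℕ∞} {Φ : OpenPartialHomeomorph Total Total} {D : Total ≃ₜ Total}
    {δ ε : ℝ} (hD : IsSignMap D δ ε) {V : Set Total} (hV : IsOpen V) (h : FactorsOn k Φ D V)
    {p : Total} (hp : p ∈ V) : 0 < δ * pd eu (cU Φ) p ∧ 0 < ε * pd ey (cY Φ) p := by
  obtain ⟨C, hC, rfl, he⟩ := h
  obtain ⟨hδ, hε, hDp⟩ := hD
  have hεε : ε * ε = 1 := by rcases hε with rfl | rfl <;> norm_num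
  have hδδ : δ * δ = 1 := by rcases hδ with rfl | rfl <;> norm_num
  obtain ⟨s1, s2⟩ := hC.signs hp
  -- Where `f` is not differentiable, `fderiv` is `0` by convention; a positive `pd` therefore
  -- already gives differentiability.
  have hd : ∀ {f : Total → ℝ} {v : Total}, 0 < pd v f p → DifferentiableAt ℝ f p := by
    intro f v hpos
    by_contra hn
    rw [pd, fderiv_zero_of_not_differentiableAt hn] at hpos
    simp at hpos
  have eU : EqOn (cU Φ) (fun q => δ * cU C q) C.source := fun q hq => by
    simp only [cU, he hq, hDp]
  have eY : EqOn (cY Φ) (fun q => ε * cY C q) C.source := fun q hq => by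
    simp only [cY, he hq, hDp]
  rw [pd_congr hV eU hp, pd_congr hV eY hp, pd_const_mul (hd s1), pd_const_mul (hd s2),
    ← mul_assoc, ← mul_assoc, hεε, hδδ, one_mul, one_mul]
  exact ⟨s1, s2⟩

theorem IsPointSymmetry.exists_signs {Φ : OpenPartialHomeomorph Total Total}
    (hΦ : IsPointSymmetry Φ) (hc : IsConnected Φ.source) :
    ∃ δ ε : ℝ, (δ = 1 ∨ δ = -1) ∧ (ε = 1 ∨ ε = -1) ∧ (∀ p ∈ Φ.source, 0 < δ * pd eu (cU Φ) p) ∧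
      ∀ p ∈ Φ.source, 0 < ε * pd ey (cY Φ) p := by
  have key : ∀ f : Total → ℝ, ContDiffOn ℝ ∞ f Φ.source → (∀ p ∈ Φ.source, f p ≠ 0) →
      ∃ δ : ℝ, (δ = 1 ∨ δ = -1) ∧ ∀ p ∈ Φ.source, 0 < δ * f p := by
    intro f hf h0
    rcases sign_const_of_ne_zero hc.isPreconnected hf.continuousOn h0 with h | h
    · exact ⟨1, .inl rfl, fun p hp => by simpa using h p hp⟩
    · exact ⟨-1, .inr rfl, fun p hp => by simpa using h p hp⟩
  obtain ⟨δ, hδ, hδ'⟩ := key _ (smooth_pd Φ.open_source hΦ.1.smooth_cU eu)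
    fun p hp => hΦ.cU_eu_ne_zero hp
  obtain ⟨ε, hε, hε'⟩ := key _ (smooth_pd Φ.open_source hΦ.1.smooth_cY ey)
    fun p hp => hΦ.cY_ey_ne_zero hp
  exact ⟨δ, ε, hδ, hε, hδ', hε'⟩

theorem eq_of_sign {δ δ' r : ℝ} (hδ : δ = 1 ∨ δ = -1) (hδ' : δ' = 1 ∨ δ' = -1) (h : 0 < δ * r)
    (h' : 0 < δ' * r) : δ = δ' := by
  rcases hδ with rfl | rfl <;> rcases hδ' with rfl | rfl <;> first | rfl | linarith

/-- The factorization of point symmetries, with uniqueness of the discrete factor. -/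
theorem IsPointSymmetry.existsUnique_factor (k : ℕ∞) {Φ : OpenPartialHomeomorph Total Total}
    (hΦ : IsPointSymmetry Φ) (hc : IsConnected Φ.source) :
    ∃! D : Total ≃ₜ Total, D ∈ ({1, involI, involJ, involI * involJ} : Set (Total ≃ₜ Total)) ∧
      (∀ p ∈ Φ.source, ∃ V : Set Total, IsOpen V ∧ p ∈ V ∧ V ⊆ Φ.source ∧ FactorsOn k Φ D V) ∧
      (VerticallyConnected Φ.source → FactorsOn k Φ D Φ.source) := by
  obtain ⟨δ, ε, hδ, hε, hU, hY⟩ := hΦ.exists_signs hc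
  obtain ⟨D, hDmem, hD⟩ := exists_isSignMap hδ hε
  refine ⟨D, ⟨hDmem, fun p hp => ?_, fun hv => ?_⟩, ?_⟩
  · obtain ⟨r, hr, hsub⟩ := Metric.isOpen_iff.1 Φ.open_source p hp
    exact ⟨Metric.ball p r, Metric.isOpen_ball, Metric.mem_ball_self hr, hsub,
      hΦ.factorsOn_ball k hD hU hY hr hsub⟩
  · exact hΦ.factorsOn k hc hv hδ hε hD.2.2 hU hY
  -- The local factorization at one point suffices: it determines both signs, and these determine
  -- the involution.
  · rintro D' ⟨hmem', hloc, -⟩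
    obtain ⟨δ', ε', hD'⟩ := isSignMap_of_mem hmem'
    obtain ⟨p, hp⟩ := hc.nonempty
    obtain ⟨V, hV, hpV, -, hfac⟩ := hloc p hp
    obtain ⟨h1, h2⟩ := hfac.signs hD' hV hpV
    obtain rfl := eq_of_sign hD'.1 hδ h1 (hU p hp)
    obtain rfl := eq_of_sign hD'.2.1 hε h2 (hY p hp)
    ext1 q
    rw [hD'.2.2, hD.2.2]

/-! ### The group of discrete symmetries -/

/-- Two commuting involutions of a group define a homomorphism from the Klein four-group. -/
theorem exists_klein_hom {G : Type*} [Group G] {x y : G} (hx : x ^ 2 = 1) (hy : y ^ 2 = 1)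
    (hxy : Commute x y) : ∃ ψ : Multiplicative (ZMod 2 × ZMod 2) →* G, ∀ i j : ZMod 2,
      ψ (Multiplicative.ofAdd (i, j)) = x ^ i.val * y ^ j.val := by
  have hpow : ∀ {z : G}, z ^ 2 = 1 → ∀ i j : ZMod 2, z ^ (i + j).val = z ^ i.val * z ^ j.val := by
    intro z hz i j
    rw [ZMod.val_add, ← pow_eq_pow_mod _ hz, pow_add]
  refine ⟨MonoidHom.mk' (fun z => x ^ z.toAdd.1.val * y ^ z.toAdd.2.val) ?_, fun i j => rfl⟩
  intro z w
  simp only [toAdd_mul, Prod.fst_add, Prod.snd_add, hpow hx, hpow hy]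
  exact (hxy.pow_pow _ _).mul_mul_mul_comm _ _

/-- The sign of a nonzero real number as an element of `ZMod 2`. -/
noncomputable def signBit (r : ℝ) : ZMod 2 := if 0 < r then 0 else 1

theorem signBit_of_pos {r : ℝ} (h : 0 < r) : signBit r = 0 := if_pos h

theorem signBit_of_neg {r : ℝ} (h : r < 0) : signBit r = 1 := if_neg h.not_gt

theorem signBit_mul {r s : ℝ} (hr : r ≠ 0) (hs : s ≠ 0) :
    signBit (r * s) = signBit r + signBit s := by
  rcases lt_or_gt_of_ne hr with h | h <;> rcases lt_or_gt_of_ne hs with h' | h'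
  · rw [signBit_of_neg h, signBit_of_neg h', signBit_of_pos (mul_pos_of_neg_of_neg h h')]; rfl
  · rw [signBit_of_neg h, signBit_of_pos h', signBit_of_neg (mul_neg_of_neg_of_pos h h')]; rfl
  · rw [signBit_of_pos h, signBit_of_neg h', signBit_of_neg (mul_neg_of_pos_of_neg h h')]; rfl
  · rw [signBit_of_pos h, signBit_of_pos h', signBit_of_pos (mul_pos h h')]; rfl

/-- The signs of `U_u` and `Y_y` of a point symmetry with connected domain. -/
noncomputable def signClass (Φ : ConnSymmetry) : Multiplicative (ZMod 2 × ZMod 2) :=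
  Multiplicative.ofAdd (signBit (pd eu (cU Φ.1) Φ.2.2.nonempty.some),
    signBit (pd ey (cY Φ.1) Φ.2.2.nonempty.some))

/-- The signs are constant on the connected domain, so the chosen base point is irrelevant. -/
theorem signClass_eq (Φ : ConnSymmetry) {p : Total} (hp : p ∈ Φ.1.source) :
    signClass Φ = Multiplicative.ofAdd (signBit (pd eu (cU Φ.1) p),
      signBit (pd ey (cY Φ.1) p)) := by
  obtain ⟨δ, ε, hδ, hε, hU, hY⟩ := Φ.2.1.exists_signs Φ.2.2
  have key : ∀ {δ r s : ℝ}, (δ = 1 ∨ δ = -1) → 0 < δ * r → 0 < δ * s → signBit r = signBit s := by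
    rintro δ r s (rfl | rfl) hr hs
    · rw [signBit_of_pos (by linarith), signBit_of_pos (by linarith)]
    · rw [signBit_of_neg (by linarith), signBit_of_neg (by linarith)]
  have h0 := Φ.2.2.nonempty.some_mem
  rw [signClass, key hδ (hU _ h0) (hU p hp), key hε (hY _ h0) (hY p hp)]

theorem signClass_comp (Φ Ψ Θ : ConnSymmetry) (hs : Θ.1.source ⊆ (Ψ.1.trans Φ.1).source)
    (he : EqOn Θ.1 (fun p => Φ.1 (Ψ.1 p)) Θ.1.source) :
    signClass Φ * signClass Ψ = signClass Θ := by
  obtain ⟨p, hp⟩ := Θ.2.2.nonempty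
  have hp' := hs hp
  rw [OpenPartialHomeomorph.trans_source] at hp'
  obtain ⟨h1, h2⟩ := Φ.2.1.signs_comp Ψ.2.1 Θ.1.open_source hs he hp
  rw [signClass_eq Θ hp, signClass_eq Ψ hp'.1, signClass_eq Φ (p := Ψ.1 p) hp'.2, h1, h2,
    signBit_mul (Φ.2.1.cU_eu_ne_zero hp'.2) (Ψ.2.1.cU_eu_ne_zero hp'.1),
    signBit_mul (Φ.2.1.cY_ey_ne_zero hp'.2) (Ψ.2.1.cY_ey_ne_zero hp'.1)]
  rfl

theorem signClass_of_continuous {k : ℕ∞} (C : ConnSymmetry) (hC : IsContinuousSymmetry k C.1) :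
    signClass C = 1 := by
  obtain ⟨p, hp⟩ := C.2.2.nonempty
  obtain ⟨h1, h2⟩ := hC.signs hp
  rw [signClass_eq C hp, signBit_of_pos h1, signBit_of_pos h2]
  rfl

theorem lift_signClass_eq_one (k : ℕ∞) :
    ∀ r ∈ {r : FreeGroup ConnSymmetry | DiscreteRel k r}, FreeGroup.lift signClass r = 1 := by
  rintro r (⟨Φ, Ψ, Θ, hs, he⟩ | ⟨C, hC⟩)
  · simp [signClass_comp Φ Ψ Θ hs he]
  · simp [signClass_of_continuous C hC]

section DiscreteClass

variable (k : ℕ∞)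

theorem discreteClass_comp (Φ Ψ Θ : ConnSymmetry) (hs : Θ.1.source ⊆ (Ψ.1.trans Φ.1).source)
    (he : EqOn Θ.1 (fun p => Φ.1 (Ψ.1 p)) Θ.1.source) :
    discreteClass k Φ * discreteClass k Ψ = discreteClass k Θ := by
  have h := PresentedGroup.one_of_mem (rels := {r : FreeGroup ConnSymmetry | DiscreteRel k r})
    (DiscreteRel.comp Φ Ψ Θ hs he)
  rw [map_mul, map_mul, map_inv, mul_inv_eq_one] at h
  exact h

theorem discreteClass_of_continuous (C : ConnSymmetry) (hC : IsContinuousSymmetry k C.1) :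
    discreteClass k C = 1 :=
  PresentedGroup.one_of_mem (rels := {r : FreeGroup ConnSymmetry | DiscreteRel k r})
    (DiscreteRel.cont C hC)

/-- The involutions as point symmetries with connected domain. -/
def IsSignMap.toConn {D : Total ≃ₜ Total} {δ ε : ℝ} (hD : IsSignMap D δ ε) : ConnSymmetry :=
  ⟨D.toOpenPartialHomeomorph, hD.isPointSymmetry, isConnected_univ⟩

theorem discreteClass_one : discreteClass k isSignMap_one.toConn = 1 := by
  refine discreteClass_of_continuous k _ ⟨fun _ => isSignMap_one.toConn.1,
    fun s _ => ⟨isSignMap_one.isPointSymmetry, rfl⟩, ?_, fun p _ => rfl, fun p _ => rfl⟩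
  exact contDiffOn_snd

theorem discreteClass_mul {D D' D'' : Total ≃ₜ Total} {δ ε δ' ε' δ'' ε'' : ℝ}
    (hD : IsSignMap D δ ε) (hD' : IsSignMap D' δ' ε') (hD'' : IsSignMap D'' δ'' ε'')
    (hδ : δ'' = δ * δ') (hε : ε'' = ε * ε') :
    discreteClass k hD.toConn * discreteClass k hD'.toConn = discreteClass k hD''.toConn := by
  refine discreteClass_comp k _ _ _ (fun p _ => ?_) fun p _ => ?_
  · rw [OpenPartialHomeomorph.trans_source]
    exact ⟨mem_univ _, mem_univ _⟩
  · change D'' p = D (D' p)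
    rw [hD.2.2, hD'.2.2, hD''.2.2, hδ, hε]
    simp only [mul_assoc]

/-- The class of a point symmetry is the class of the involution with the same signs. -/
theorem discreteClass_eq (Φ : ConnSymmetry) {D : Total ≃ₜ Total} {δ ε : ℝ}
    (hD : IsSignMap D δ ε) (hU : ∀ p ∈ Φ.1.source, 0 < δ * pd eu (cU Φ.1) p)
    (hY : ∀ p ∈ Φ.1.source, 0 < ε * pd ey (cY Φ.1) p) :
    discreteClass k Φ = discreteClass k hD.toConn := by
  obtain ⟨p, hp⟩ := Φ.2.2.nonempty
  obtain ⟨r, hr, hsub⟩ := Metric.isOpen_iff.1 Φ.1.open_source p hp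
  obtain ⟨C, hC, hCs, he⟩ := Φ.2.1.factorsOn_ball k hD hU hY hr hsub
  have hball : IsConnected (Metric.ball p r) :=
    (convex_ball p r).isConnected (Metric.nonempty_ball.2 hr)
  have hsrc : (Φ.1.restrOpen (Metric.ball p r) Metric.isOpen_ball).source = Metric.ball p r := by
    rw [OpenPartialHomeomorph.restrOpen_source]; exact inter_eq_right.2 hsub
  let Θ : ConnSymmetry := ⟨Φ.1.restrOpen (Metric.ball p r) Metric.isOpen_ball,
    Φ.2.1.restrOpen Metric.isOpen_ball, by rw [hsrc]; exact hball⟩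
  -- Continuity of `C` only provides a point symmetry `H 1` that agrees with `C` on its source; the
  -- inverses then agree on the target of `C`, and the property transfers.
  have hCsym : IsPointSymmetry C := by
    obtain ⟨H, hH, -, -, h1⟩ := hC
    obtain ⟨hs, hsrc1⟩ := hH 1 ⟨zero_le_one, le_rfl⟩
    have hinv : EqOn C.symm (H 1).symm C.target := fun q hq => by
      have hm := C.map_target hq
      have e : (H 1) (C.symm q) = q := by rw [h1 hm, C.right_inv hq]
      have hm' : C.symm q ∈ (H 1).source := hsrc1 ▸ hm
      calc C.symm q = (H 1).symm ((H 1) (C.symm q)) := ((H 1).left_inv hm').symm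
        _ = (H 1).symm q := by rw [e]
    have htgt : C.target ⊆ (H 1).target := fun q hq => by
      have hm := C.map_target hq
      have e : (H 1) (C.symm q) = q := by rw [h1 hm, C.right_inv hq]
      rw [← e]
      exact (H 1).map_source (hsrc1 ▸ hm)
    refine ⟨⟨?_, (hs.1.2.mono htgt).congr hinv⟩, fun Ω Ω' g g' a1 a2 a3 a4 a5 a6 => ?_⟩
    · exact (hsrc1 ▸ hs.1.1).congr fun q hq => (h1 hq).symm
    · refine hs.2 Ω Ω' g g' a1 a2 a3 a4 (hsrc1 ▸ a5) ?_
      rw [← a6]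
      exact image_congr fun q hq => h1 (a5 hq)
  let C' : ConnSymmetry := ⟨C, hCsym, by rw [hCs]; exact hball⟩
  -- A restriction of `Φ` is a restriction of `Φ ∘ id`, so it has the same class. On the ball, this
  -- restriction is also `D ∘ C`.
  have e1 : discreteClass k Φ * discreteClass k isSignMap_one.toConn = discreteClass k Θ := by
    refine discreteClass_comp k _ _ _ (fun q hq => ?_) fun q _ => rfl
    rw [OpenPartialHomeomorph.trans_source]
    rw [hsrc] at hq
    exact ⟨mem_univ _, hsub hq⟩
  have e2 : discreteClass k hD.toConn * discreteClass k C' = discreteClass k Θ := by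
    refine discreteClass_comp k _ _ _ (fun q hq => ?_) fun q hq => ?_
    · rw [OpenPartialHomeomorph.trans_source]
      rw [hsrc] at hq
      exact ⟨by rw [← hCs] at hq; exact hq, mem_univ _⟩
    · rw [hsrc] at hq
      exact he hq
  rw [discreteClass_one, mul_one] at e1
  rw [discreteClass_of_continuous k C' hC, mul_one] at e2
  rw [e1, e2]

theorem signClass_toConn {D : Total ≃ₜ Total} {δ ε : ℝ} (hD : IsSignMap D δ ε) :
    signClass hD.toConn = Multiplicative.ofAdd (signBit δ, signBit ε) := by
  rw [signClass_eq hD.toConn (p := 0) (mem_univ _)]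
  have dU : pd eu (fun q : Total => δ * q.2.2.2) 0 = δ := by
    rw [pd_const_mul (by fun_prop), pd_coord_u]; simp
  have dY : pd ey (fun q : Total => ε * q.2.2.1) 0 = ε := by
    rw [pd_const_mul (by fun_prop), pd_coord_y]; simp
  have eU : cU hD.toConn.1 = fun q : Total => δ * q.2.2.2 := funext fun q =>
    congrArg (fun w : Total => w.2.2.2) (hD.2.2 q)
  have eY : cY hD.toConn.1 = fun q : Total => ε * q.2.2.1 := funext fun q =>
    congrArg (fun w : Total => w.2.2.1) (hD.2.2 q)
  rw [eU, eY, dU, dY]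

/-- The group of discrete symmetries is the Klein four-group. -/
theorem exists_discrete_equiv :
    ∃ e : DiscreteSymmetryGroup k ≃* Multiplicative (ZMod 2 × ZMod 2),
      e (discreteClass k isSignMap_involI.toConn) = Multiplicative.ofAdd (1, 0) ∧
      e (discreteClass k isSignMap_involJ.toConn) = Multiplicative.ofAdd (0, 1) := by
  obtain ⟨x, hx⟩ : ∃ x, x = discreteClass k isSignMap_involI.toConn := ⟨_, rfl⟩
  obtain ⟨y, hy⟩ : ∃ y, y = discreteClass k isSignMap_involJ.toConn := ⟨_, rfl⟩
  obtain ⟨z, hz⟩ : ∃ z, z = discreteClass k isSignMap_involI_mul_involJ.toConn := ⟨_, rfl⟩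
  have hxx : x ^ 2 = 1 := by
    rw [pow_two, hx, discreteClass_mul k isSignMap_involI isSignMap_involI isSignMap_one
      (by norm_num) (by norm_num), discreteClass_one]
  have hyy : y ^ 2 = 1 := by
    rw [pow_two, hy, discreteClass_mul k isSignMap_involJ isSignMap_involJ isSignMap_one
      (by norm_num) (by norm_num), discreteClass_one]
  have hxyz : x * y = z := by
    rw [hx, hy, hz]
    exact discreteClass_mul k _ _ _ (by norm_num) (by norm_num)
  have hyxz : y * x = z := by
    rw [hx, hy, hz]
    exact discreteClass_mul k _ _ _ (by norm_num) (by norm_num)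
  obtain ⟨ψ, hψ⟩ := exists_klein_hom hxx hyy (hxyz.trans hyxz.symm)
  have p1 : signBit 1 = 0 := signBit_of_pos one_pos
  have m1 : signBit (-1) = 1 := signBit_of_neg (by norm_num)
  let φ : DiscreteSymmetryGroup k →* Multiplicative (ZMod 2 × ZMod 2) :=
    PresentedGroup.toGroup (lift_signClass_eq_one k)
  have hφ : ∀ Φ, φ (discreteClass k Φ) = signClass Φ := fun Φ =>
    PresentedGroup.toGroup.of (lift_signClass_eq_one k)
  have v1 : (1 : ZMod 2).val = 1 := rfl
  have v0 : (0 : ZMod 2).val = 0 := rfl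
  -- Injectivity of the sign homomorphism: a generator has the class of the involution with its
  -- signs, and that class is a product of powers of `x` and `y`.
  have hψφ : ψ.comp φ = MonoidHom.id _ := by
    refine PresentedGroup.ext fun Φ => ?_
    change ψ (φ (discreteClass k Φ)) = discreteClass k Φ
    rw [hφ]
    obtain ⟨δ, ε, hδ, hε, hU, hY⟩ := Φ.2.1.exists_signs Φ.2.2
    obtain ⟨D, -, hD⟩ := exists_isSignMap hδ hε
    have hcl := discreteClass_eq k Φ hD hU hY
    have hsg : signClass Φ = signClass hD.toConn := by
      rw [← hφ, hcl, hφ]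
    rw [hsg, signClass_toConn, hψ]
    rcases hδ with rfl | rfl <;> rcases hε with rfl | rfl
    · rw [discreteClass_eq k Φ isSignMap_one hU hY, discreteClass_one]
      simp only [p1, v0, pow_zero, mul_one]
    · rw [discreteClass_eq k Φ isSignMap_involJ hU hY, ← hy]
      simp only [p1, m1, v0, v1, pow_zero, pow_one, one_mul]
    · rw [discreteClass_eq k Φ isSignMap_involI hU hY, ← hx]
      simp only [p1, m1, v0, v1, pow_zero, pow_one, mul_one]
    · rw [discreteClass_eq k Φ isSignMap_involI_mul_involJ hU hY, ← hz, ← hxyz]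
      simp only [m1, v1, pow_one]
  have fx : φ x = Multiplicative.ofAdd (1, 0) := by
    rw [hx, hφ, signClass_toConn, m1, p1]
  have fy : φ y = Multiplicative.ofAdd (0, 1) := by
    rw [hy, hφ, signClass_toConn, m1, p1]
  have hφψ : φ.comp ψ = MonoidHom.id _ := by
    refine MonoidHom.ext fun w => ?_
    obtain ⟨i, j⟩ := w
    change φ (ψ (Multiplicative.ofAdd (i, j))) = Multiplicative.ofAdd (i, j)
    rw [hψ, map_mul, map_pow, map_pow, fx, fy, ← ofAdd_nsmul, ← ofAdd_nsmul, ← ofAdd_add]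
    simp
  refine ⟨φ.toMulEquiv ψ hψφ hφψ, ?_, ?_⟩
  · rw [← hx]; exact fx
  · rw [← hy]; exact fy

end DiscreteClass

theorem involI_mul_self : involI * involI = 1 := by
  ext1 p
  change involI (involI p) = p
  simp [involI]

theorem involJ_mul_self : involJ * involJ = 1 := by
  ext1 p
  change involJ (involJ p) = p
  simp [involJ]

end FineKolmogorov

theorem mainTheorem4 (k : ℕ∞) :
    -- `I'` and `J'` are involutions
    (FineKolmogorov.involI * FineKolmogorov.involI = 1 ∧
      FineKolmogorov.involJ * FineKolmogorov.involJ = 1) ∧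
    -- completeness and independence of the list `1, I', J', I' J'`
    (∀ Φ : OpenPartialHomeomorph FineKolmogorov.Total FineKolmogorov.Total,
      FineKolmogorov.IsPointSymmetry Φ → IsConnected Φ.source →
      ∃! D : FineKolmogorov.Total ≃ₜ FineKolmogorov.Total,
        D ∈ ({1, FineKolmogorov.involI, FineKolmogorov.involJ,
          FineKolmogorov.involI * FineKolmogorov.involJ} :
            Set (FineKolmogorov.Total ≃ₜ FineKolmogorov.Total)) ∧
        (∀ p ∈ Φ.source, ∃ V : Set FineKolmogorov.Total,
          IsOpen V ∧ p ∈ V ∧ V ⊆ Φ.source ∧ FineKolmogorov.FactorsOn k Φ D V) ∧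
        (FineKolmogorov.VerticallyConnected Φ.source →
          FineKolmogorov.FactorsOn k Φ D Φ.source)) ∧
    -- `I'` and `J'` are point symmetries, and the group of discrete symmetries is the Klein
    -- four-group generated by their classes
    (∃ I J : FineKolmogorov.ConnSymmetry,
      I.1 = FineKolmogorov.involI.toOpenPartialHomeomorph ∧
      J.1 = FineKolmogorov.involJ.toOpenPartialHomeomorph ∧
      ∃ e : FineKolmogorov.DiscreteSymmetryGroup k ≃* Multiplicative (ZMod 2 × ZMod 2),
        e (FineKolmogorov.discreteClass k I) = Multiplicative.ofAdd (1, 0) ∧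
        e (FineKolmogorov.discreteClass k J) = Multiplicative.ofAdd (0, 1)) := by
  refine ⟨⟨FineKolmogorov.involI_mul_self, FineKolmogorov.involJ_mul_self⟩,
    fun Φ hΦ hc => hΦ.existsUnique_factor k hc, FineKolmogorov.isSignMap_involI.toConn,
    FineKolmogorov.isSignMap_involJ.toConn, rfl, rfl, FineKolmogorov.exists_discrete_equiv k⟩
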